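/- Let $F$ be a totally real number field and $p$ an odd prime which is unramified in $F$. Let $n,m,\alpha$ be families of non-negative integers indexed by the infinite places of $F$ such that $h:=n_\sigma-\alpha_\sigma\ge 0$ and $a:=\alpha_\sigma+2m_\sigma$ do not depend on $\sigma$; put $k_\alpha=2h+2$. Let $\mathfrak n\neq 0$ be an ideal of $\mathcal O_F$, let $\omega=\prod_v\omega_v$ be a Hecke character of $F$ which is trivial on $F_\infty^\times$, unramified at all places above $p$ and of conductor dividing $\mathfrak n$, and let $v_0\nmid p$ be a finite place (for instance $\omega=\omega_\pi|_{F_{\mathbf A}^\times}$ and $\mathfrak n=\mathfrak N\cap\mathcal O_F$ for a cohomological cuspidal automorphic representation $\pi$ of ${\rm GL}_2$ over a CM quadratic extension of $F$, with conductor $\mathfrak N$, central character $\omega_\pi$ unramified at $p$, and cohomological weight $(n,m)$). Let $|\cdot|_v$ be the normalized absolute values, $q_v$ the residue cardinalities, $|d|_{\rm fin}=\prod_{v<\infty}|d_v|_v$, and $\psi_F=\prod_v\psi_{F,v}=\psi_{\mathbf Q}\circ{\rm Tr}_{F/\mathbf Q}$ the standard additive character of $F\backslash F_{\mathbf A}$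 with $\psi_{\mathbf Q}(x_\infty)=e^{2\pi i x_\infty}$. Put $\phi_1=|\cdot|^{\frac12-a}$ and, for $\sigma\mid\infty$, $\phi_{2,\sigma}=|\cdot|_\sigma^{-2h-a-\frac12}$. For $r\ge 1$ define $\Phi^{(r)}_v:F_v^2\to\mathbf C$ by: - $2^{-k_\alpha}(x+iy)^{k_\alpha}e^{-\pi(x^2+y^2)}$ if $v\mid\infty$; - $\psi_{F,v}(x/p^r)\,\mathbf 1_{\mathcal O_{F,v}^2}(x,y)$ if $v\mid p$; - $\omega_v(y)^{-1}\,\mathbf 1_{\mathfrak n\mathcal O_{F,v}\times\mathcal O_{F,v}^\times}(x,y)$ if $v\mid\mathfrak n$ and $v\nmid p$; - $\mathbf 1_{\mathcal O_{F,v}^2}(x,y)$ at the remaining finite places, except that, if $h=0$ and $\mathfrak n$ has no prime divisor outside $p$, one takes $\mathbf 1_{\mathcal O_{F,v_0}^\times\times\mathcal O_{F,v_0}}(x,y)$ at $v=v_0$. For $g\in{\rm GL}_2(F_{\mathbf A})$ and $s\in\mathbf C$ let $$T_{r,s}(g)=\prod_{\sigma\mid\infty}\Big(\phi_{1,\sigma}(\det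 g_\sigma)|\det g_\sigma|^{s+\frac12}\int_{\mathbf R^\times}\Phi^{(r)}_\sigma((0,t)g_\sigma)\,\phi_{1,\sigma}\phi_{2,\sigma}^{-1}(t)|t|^{2s+1}\,\tfrac{dt}{|t|}\Big)\cdot\Phi^{(r)}_{\rm fin}((0,1)g_{\rm fin})\,\phi_{1,\rm fin}(\det g)\,|\det g|_{\rm fin}^{s+\frac12}.$$ Let $U_r\subset\mathcal O_F^\times$ be the group of units congruent to $1$ modulo $p^r\mathfrak n$; one has $T_{r,s}(\varepsilon g)=T_{r,s}(g)$ for $\varepsilon\in U_r$. Define $$\mathcal F_{\Phi^{(r)}}(g,s)=\frac1{[\mathcal O_F^\times:\{\pm1\}U_r]}\sum_{x\in F^\times/U_r}T_{r,s}(xg),\qquad E_{r,s}(g)=\sum_{\gamma\in{\rm B}_2(F)\backslash{\rm GL}_2(F)}\mathcal F_{\Phi^{(r)}}(\gamma g,s),$$ where ${\rm B}_2$ is the group of upper triangular matrices (for $F=\mathbf Q$ the inner sum is just the sum over $\mathbf Q^\times$). For other values of $s$, $E_{r,s}(g)$ denotes the value at $s$ of the holomorphic continuation of this function of $s$ to $\mathbf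 C$. Put $$c_{r,\alpha,s}=\omega_p(p^{-r})\prod_{v\mid p}q_v^{2(s+h)r},\qquad \omega_p(p^{-r})=\prod_{v\mid p}\omega_v(p^{-r}).$$ Then for every $r\ge1$ and every $g\in {\rm GL}_2(F_{\mathbf A})$, $$c_{r+1,\alpha,s}\sum_{x,y\in\mathcal O_{F,p}/p\mathcal O_{F,p}}E_{r+1,s}\Big(g\begin{pmatrix}1+xp^r&0\\ yp^r&1\end{pmatrix}\Big)=c_{r,\alpha,s}\,E_{r,s}(g),$$ where $\mathcal O_{F,p}=\prod_{v\mid p}\mathcal O_{F,v}$, $x$ and $y$ run over any complete system of representatives, and the matrix is placed at the places above $p$. More precisely, there is a real number $C$ such that for all $s$ with ${\rm Re}(s)>C$ and all $g$ the double series over $(\gamma,x)$ defining $E_{r,s}(g)$ and $E_{r+1,s}(g)$ converge absolutely and the identity holds; and the identity holds for all $s\in\mathbf C$ for the holomorphic continuations of $E_{r,s}$ and $E_{r+1,s}$. -/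

import Mathlib

open NumberField IsDedekindDomain
open scoped Matrix

noncomputable section

namespace DistEis

variable (F : Type*) [Field F] [NumberField F]

/-- The ring of adeles `F_𝐀`. -/
abbrev Adele : Type _ := AdeleRing (𝓞 F) F

/-- The finite places of `F`. -/
abbrev FinPlace : Type _ := HeightOneSpectrum (𝓞 F)

/-- The completion `F_v` at a finite place. Its norm is the normalised absolute value. -/
abbrev Fv (v : FinPlace F) : Type _ := v.adicCompletion F

/-- The ring of integers `𝒪_{F,v}` of `F_v`. -/
abbrev Ov (v : FinPlace F) : Type _ := v.adicCompletionIntegers F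

variable {F}

/-- The set `𝔫 𝒪_{F,v}`, as a subset of `F_v`. -/
def localIdeal (I : Ideal (𝓞 F)) (v : FinPlace F) : Set (Fv F v) :=
  {x | ∃ a ∈ I.map (algebraMap (𝓞 F) (Ov F v)), (a : Fv F v) = x}

/-- The residue cardinality `q_v`. -/
def qv (v : FinPlace F) : ℕ := Ideal.absNorm v.asIdeal

/-- The finite idele norm `|d|_fin = ∏_v |d_v|_v`. -/
def finNorm (d : FiniteAdeleRing (𝓞 F) F) : ℝ := ∏ᶠ v : FinPlace F, ‖d v‖

/-- The component at a (real) infinite place, as a real number. -/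
def infComp [IsTotallyReal F] (σ : InfinitePlace F) : Adele F → ℝ := fun a =>
  InfinitePlace.Completion.extensionEmbeddingOfIsReal (IsTotallyReal.isReal σ) (a.1 σ)

open Classical in
/-- The idele with component `y` at the finite place `v` and `1` at all other places. -/
def localIdele (v : FinPlace F) (y : (Fv F v)ˣ) : (Adele F)ˣ where
  val := (1, ⟨Function.update (fun w => (1 : Fv F w)) v (y : Fv F v), by
    refine Filter.mem_of_superset (Set.finite_singleton v).compl_mem_cofinite fun w hw => ?_
    have hw' : w ≠ v := hw
    simp [Function.update_of_ne hw']⟩)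
  inv := (1, ⟨Function.update (fun w => (1 : Fv F w)) v ((y⁻¹ : (Fv F v)ˣ) : Fv F v), by
    refine Filter.mem_of_superset (Set.finite_singleton v).compl_mem_cofinite fun w hw => ?_
    have hw' : w ≠ v := hw
    simp [Function.update_of_ne hw']⟩)
  val_inv := by
    refine Prod.ext (one_mul _) (FiniteAdeleRing.ext F fun w => ?_)
    change Function.update (fun w => (1 : Fv F w)) v (y : Fv F v) w *
      Function.update (fun w => (1 : Fv F w)) v ((y⁻¹ : (Fv F v)ˣ) : Fv F v) w = 1
    by_cases h : w = v
    · subst h; simp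
    · simp [Function.update_of_ne h]
  inv_val := by
    refine Prod.ext (one_mul _) (FiniteAdeleRing.ext F fun w => ?_)
    change Function.update (fun w => (1 : Fv F w)) v ((y⁻¹ : (Fv F v)ˣ) : Fv F v) w *
      Function.update (fun w => (1 : Fv F w)) v (y : Fv F v) w = 1
    by_cases h : w = v
    · subst h; simp
    · simp [Function.update_of_ne h]

open Classical in
/-- The `v`-component of the standard additive character `ψ_F = ψ_ℚ ∘ Tr` of `F \ F_𝐀`, with
`ψ_ℚ(x_∞) = exp(2πi x_∞)`. It is trivial on `𝒪_{F,v}`; and if `y ∈ F` is integral at all finite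
places other than `v`, then `ψ_{F,v}(y) = ψ_{F,∞}(y)⁻¹ = exp(-2πi Tr y)` because `ψ_F(y) = 1`.
Every `x ∈ F_v` is congruent modulo `𝒪_{F,v}` to such a `y`, and the value does not depend on
its choice, since two choices differ by an element of `𝓞 F`, whose trace is an integer. -/
def psi (v : FinPlace F) (x : Fv F v) : ℂ :=
  if h : ∃ y : F, (∀ w : FinPlace F, w ≠ v → (y : Fv F w) ∈ w.adicCompletionIntegers F) ∧
      x - (y : Fv F v) ∈ v.adicCompletionIntegers F then
    Complex.exp (-(2 * Real.pi * Complex.I * ((Algebra.trace ℚ F h.choose : ℚ) : ℂ)))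
  else 1

/-- The value of `psi` does not depend on the choice of `y`. -/
theorem psi_eq (v : FinPlace F) (x : Fv F v) (y : F)
    (h1 : ∀ w : FinPlace F, w ≠ v → (y : Fv F w) ∈ w.adicCompletionIntegers F)
    (h2 : x - (y : Fv F v) ∈ v.adicCompletionIntegers F) :
    psi v x =
      Complex.exp (-(2 * Real.pi * Complex.I * ((Algebra.trace ℚ F y : ℚ) : ℂ))) := by
  have h : ∃ y : F, (∀ w : FinPlace F, w ≠ v → (y : Fv F w) ∈ w.adicCompletionIntegers F) ∧
      x - (y : Fv F v) ∈ v.adicCompletionIntegers F := ⟨y, h1, h2⟩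
  rw [psi, dif_pos h]
  have hz := h.choose_spec
  set z := h.choose
  have hint : ∀ w : FinPlace F, w.valuation F (z - y) ≤ 1 := by
    intro w
    rw [← HeightOneSpectrum.valuedAdicCompletion_eq_valuation']
    by_cases hw : w = v
    · subst hw
      have := sub_mem h2 hz.2
      rw [sub_sub_sub_cancel_left] at this
      have q : (algebraMap F (Fv F w) z - algebraMap F (Fv F w) y) ∈ w.adicCompletionIntegers F := this
      rw [← map_sub] at q
      exact q
    · have := sub_mem (hz.1 w hw) (h1 w hw)
      have q : (algebraMap F (Fv F w) z - algebraMap F (Fv F w) y) ∈ w.adicCompletionIntegers F := this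
      rw [← map_sub] at q
      exact q
  obtain ⟨o, ho⟩ := HeightOneSpectrum.mem_integers_of_valuation_le_one F (z - y) hint
  have ht : Algebra.trace ℚ F (z - y) = (Algebra.trace ℤ (𝓞 F) o : ℤ) := by
    rw [← ho]; exact (Algebra.trace_localization ℤ (nonZeroDivisors ℤ) o)
  rw [Complex.exp_eq_exp_iff_exists_int]
  refine ⟨-(Algebra.trace ℤ (𝓞 F) o), ?_⟩
  have : (Algebra.trace ℚ F z) = Algebra.trace ℚ F y + (Algebra.trace ℤ (𝓞 F) o : ℤ) := by rw [← ht, map_sub]; ring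
  rw [this]; push_cast; ring

variable (F) in
/-- The finite set of places of `F` above `p`. -/
def placesAbove (p : ℕ) [Fact p.Prime] : Finset (FinPlace F) :=
  (Ideal.finite_factors (R := 𝓞 F) (I := Ideal.span {(p : 𝓞 F)}) (by
    simpa [Ideal.span_singleton_eq_bot] using (Fact.out : p.Prime).ne_zero)).toFinset

variable (F) in
/-- `𝒪_{F,p} = ∏_{v ∣ p} 𝒪_{F,v}`. -/
abbrev Op (p : ℕ) [Fact p.Prime] : Type _ := (v : placesAbove F p) → Ov F v.1

variable (F) in
/-- The data from which the Eisenstein series are built: the weights `n, m, α` with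
`n - α = h·t` and `α + 2m = a·t` parallel and `0 ≤ α ≤ n`; the level `𝔫`; a Hecke character `ω` of
`F` which is trivial on `F_∞ˣ`, of conductor dividing `𝔫` and unramified at `p`; and a
finite place `v₀` prime to `p`. -/
structure Datum (p : ℕ) [Fact p.Prime] where
  n : InfinitePlace F → ℕ
  m : InfinitePlace F → ℕ
  α : InfinitePlace F → ℕ
  /-- the common value of `n_σ - α_σ` -/
  h : ℕ
  /-- the common value of `α_σ + 2 m_σ` -/
  a : ℕ
  n_eq : ∀ σ, n σ = α σ + h
  a_eq : ∀ σ, α σ + 2 * m σ = a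
  level : Ideal (𝓞 F)
  level_ne_bot : level ≠ ⊥
  ω : (Adele F)ˣ →* ℂˣ
  ω_continuous : Continuous ω
  ω_principal : ∀ x : Fˣ, ω (Units.map (algebraMap F (Adele F)).toMonoidHom x) = 1
  ω_infinite : ∀ u : (Adele F)ˣ, (u : Adele F).2 = 1 → ω u = 1
  ω_conductor : ∀ (v : FinPlace F) (u : (Fv F v)ˣ), ‖(u : Fv F v)‖ = 1 →
    (u : Fv F v) - 1 ∈ localIdeal level v → ω (localIdele v u) = 1
  ω_unramified : ∀ v ∈ placesAbove F p, ∀ u : (Fv F v)ˣ, ‖(u : Fv F v)‖ = 1 →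
    ω (localIdele v u) = 1
  v₀ : FinPlace F
  v₀_notMem : v₀ ∉ placesAbove F p

variable {p : ℕ} [Fact p.Prime]

namespace Datum

variable (D : Datum F p)

open Classical in
/-- The local component `ω_v` on `F_vˣ` (and `0` at `0`). -/
def ωv (v : FinPlace F) (y : Fv F v) : ℂ :=
  if hy : y = 0 then 0 else (D.ω (localIdele v (Units.mk0 y hy)) : ℂ)

/-- `ω_p(p^{-r}) = ∏_{v ∣ p} ω_v(p^{-r})`. -/
def ωp_inv_pow (r : ℕ) : ℂ := ∏ v ∈ placesAbove F p, D.ωv v (((p : Fv F v) ^ r)⁻¹)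

/-- The constant `c_{r,α,s} = ω_p(p^{-r}) ∏_{v ∣ p} q_v^{2(s+n-α)r}`. -/
def c (r : ℕ) (s : ℂ) : ℂ :=
  D.ωp_inv_pow r * ∏ v ∈ placesAbove F p, (qv v : ℂ) ^ (2 * (s + (D.h : ℂ)) * (r : ℂ))

/-- `k_α = 2n - 2α + 2t`. -/
def k (σ : InfinitePlace F) : ℕ := 2 * D.n σ - 2 * D.α σ + 2

/-- `φ_{1,σ}` for an infinite place, where `φ₁ = |·|^{-(α+2m)+1/2}`. -/
def φ₁Inf (t : ℝ) : ℂ := ((|t| : ℝ) : ℂ) ^ (-(D.a : ℂ) + 1 / 2)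

/-- `φ_{1,fin}`. -/
def φ₁Fin (d : FiniteAdeleRing (𝓞 F) F) : ℂ := (finNorm d : ℂ) ^ (-(D.a : ℂ) + 1 / 2)

/-- `φ_{2,σ} = |·|^{-2(n-α)-(α+2m)-1/2}` for an infinite place. -/
def φ₂Inf (t : ℝ) : ℂ := ((|t| : ℝ) : ℂ) ^ (-2 * (D.h : ℂ) - (D.a : ℂ) - 1 / 2)

/-- The Schwartz function `Φ_σ` at an infinite place. -/
def ΦInf (σ : InfinitePlace F) (x y : ℝ) : ℂ :=
  (2 : ℂ)⁻¹ ^ D.k σ * ((x : ℂ) + Complex.I * y) ^ D.k σ *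
    Complex.exp (-(Real.pi * (x ^ 2 + y ^ 2) : ℝ))

/-- The auxiliary place is used when `n = α` and `𝔫` is trivial away from `p`. -/
def UsesAux : Prop := D.h = 0 ∧ ∀ v : FinPlace F, v.asIdeal ∣ D.level → v ∈ placesAbove F p

open Classical in
/-- The Schwartz-Bruhat function `Φ_v^{(r)}` at a finite place. -/
def ΦFin (r : ℕ) (v : FinPlace F) (x y : Fv F v) : ℂ :=
  if v ∈ placesAbove F p then
    if ‖x‖ ≤ 1 ∧ ‖y‖ ≤ 1 then psi v (x / (p : Fv F v) ^ r) else 0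
  else if v.asIdeal ∣ D.level then
    if x ∈ localIdeal D.level v ∧ ‖y‖ = 1 then (D.ωv v y)⁻¹ else 0
  else if D.UsesAux ∧ v = D.v₀ then
    if ‖x‖ = 1 ∧ ‖y‖ ≤ 1 then 1 else 0
  else
    if ‖x‖ ≤ 1 ∧ ‖y‖ ≤ 1 then 1 else 0

end Datum

/-- The archimedean local section
`μ₁(det g) |det g|^{s+1/2} ∫_{ℝˣ} Φ((0,t)g) (μ₁ μ₂⁻¹)(t) |t|^{2s+1} dˣt`, with `dˣt = dt/|t|`. -/
def realSection (μ₁ μ₂ : ℝ → ℂ) (Φ : ℝ → ℝ → ℂ) (s : ℂ) (g : Matrix (Fin 2) (Fin 2) ℝ) : ℂ :=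
  μ₁ g.det * ((|g.det| : ℝ) : ℂ) ^ (s + 1 / 2) *
    ∫ t : ℝ, Φ (t * g 1 0) (t * g 1 1) * (μ₁ t * (μ₂ t)⁻¹) * ((|t| : ℝ) : ℂ) ^ (2 * s + 1) *
      ((|t| : ℝ) : ℂ)⁻¹

/-- The upper triangular Borel subgroup `B₂(F)`. -/
def borel (K : Type*) [Field K] : Subgroup (GL (Fin 2) K) where
  carrier := {g | g 1 0 = 0}
  one_mem' := by simp
  mul_mem' := by
    intro a b ha hb
    simp only [Set.mem_ofPred_eq] at ha hb ⊢
    simp [Matrix.mul_apply, Fin.sum_univ_two, ha, hb]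
  inv_mem' := by
    intro a ha
    simp only [Set.mem_ofPred_eq] at ha ⊢
    rw [Matrix.coe_units_inv, Matrix.inv_def]
    simp [Matrix.adjugate_fin_two, ha]

variable (F) in
/-- The diagonal embedding `GL₂(F) → GL₂(F_𝐀)`. -/
def glEmb : GL (Fin 2) F →* GL (Fin 2) (Adele F) :=
  Matrix.GeneralLinearGroup.map (algebraMap F (Adele F))

variable (F) in
/-- The diagonal embedding `Fˣ → GL₂(F_𝐀)`, as scalar matrices. -/
def scalarEmb : Fˣ →* GL (Fin 2) (Adele F) :=
  (glEmb F).comp (Matrix.GeneralLinearGroup.scalar (Fin 2))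

/-- The units of `𝓞 F` congruent to `1` modulo an ideal. -/
def congruenceUnits (I : Ideal (𝓞 F)) : Subgroup (𝓞 F)ˣ :=
  (Units.map (Ideal.Quotient.mk I).toMonoidHom).ker

namespace Datum

variable (D : Datum F p)

/-- The units congruent to `1` modulo `p^r 𝔫`: a subgroup of finite index of `(𝓞 F)ˣ` such that
`Φ_fin^{(r)}(εx, εy) = Φ_fin^{(r)}(x, y)` for all `ε` in it. -/
def units (r : ℕ) : Subgroup (𝓞 F)ˣ :=
  congruenceUnits (Ideal.span {(p : 𝓞 F)} ^ r * D.level)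

/-- The same group, inside `Fˣ`. -/
def unitsF (r : ℕ) : Subgroup Fˣ :=
  (D.units r).map (Units.map (algebraMap (𝓞 F) F).toMonoidHom)

/-- The index of the subgroup generated by `-1` and `D.units r` in `(𝓞 F)ˣ`
(it is `1` for `F = ℚ`). -/
def unitIndex (r : ℕ) : ℕ := (D.units r ⊔ Subgroup.zpowers (-1)).index

theorem unitIndex_rat (D : Datum ℚ p) (r : ℕ) : D.unitIndex r = 1 := by
  rw [Datum.unitIndex, Subgroup.index_eq_one, eq_top_iff]
  intro u _
  have : u = 1 ∨ u = -1 := by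
    have := Int.units_eq_one_or (Units.map (Rat.ringOfIntegersEquiv : 𝓞 ℚ →+* ℤ).toMonoidHom u)
    rcases this with h | h
    · left; ext; have := congrArg Units.val h; simpa using this
    · right; ext; have := congrArg Units.val h
      have t : Rat.ringOfIntegersEquiv (u : 𝓞 ℚ) = -1 := by simpa using this
      have t2 : (u : 𝓞 ℚ) = -1 := Rat.ringOfIntegersEquiv.injective (by rw [t]; simp)
      simp [t2]
  rcases this with rfl | rfl
  · exact one_mem _
  · exact Subgroup.mem_sup_right (Subgroup.mem_zpowers _)

variable [IsTotallyReal F]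

/-- `𝓕_∞(g,s) Φ_fin((0,1)g) φ_{1,fin}(det g) |det g|_fin^{s+1/2}`. -/
def term (r : ℕ) (s : ℂ) (g : GL (Fin 2) (Adele F)) : ℂ :=
  (∏ σ : InfinitePlace F,
      realSection D.φ₁Inf D.φ₂Inf (D.ΦInf σ) s (Matrix.of fun i j => infComp σ (g i j))) *
    (∏ᶠ v : FinPlace F, D.ΦFin r v ((g 1 0 : Adele F).2 v) ((g 1 1 : Adele F).2 v)) *
    D.φ₁Fin (g : Matrix (Fin 2) (Fin 2) (Adele F)).det.2 *
    (finNorm (g : Matrix (Fin 2) (Fin 2) (Adele F)).det.2 : ℂ) ^ (s + 1 / 2)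

/-- `𝓕_{Φ^{(r)}}(g,s)`: the sum of `D.term r s (x g)` over `x ∈ Fˣ`, taken modulo the action of
the units. The summand is invariant under `D.units r`, and the sum over
`Fˣ / D.units r` is divided by the index `D.unitIndex r`, so that it does not change if
the group of units is made smaller. For `F = ℚ` and `p > 2`, `r ≥ 1`, the group is trivial, the
index is `1`, and this is the sum over all of `ℚˣ`. -/
def sect (r : ℕ) (s : ℂ) (g : GL (Fin 2) (Adele F)) : ℂ :=
  (D.unitIndex r : ℂ)⁻¹ * ∑' x : Fˣ ⧸ D.unitsF r, D.term r s (scalarEmb F x.out * g)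

/-- The Eisenstein series `∑_{γ ∈ B₂(F) \ GL₂(F)} 𝓕_{Φ^{(r)}}(γ g, s)`. The summand does not depend
on the choice of `γ` in its class. -/
def series (r : ℕ) (s : ℂ) (g : GL (Fin 2) (Adele F)) : ℂ :=
  ∑' γ : Quotient (QuotientGroup.rightRel (borel F)), D.sect r s (glEmb F γ.out * g)

/-- Absolute convergence of the double series defining `D.series r s g`. -/
def AbsConverges (r : ℕ) (s : ℂ) (g : GL (Fin 2) (Adele F)) : Prop :=
  Summable fun q : Quotient (QuotientGroup.rightRel (borel F)) × (Fˣ ⧸ D.unitsF r) =>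
    ‖D.term r s (scalarEmb F q.2.out * (glEmb F q.1.out * g))‖

/-- `E s g` is the holomorphic continuation to all `s ∈ ℂ` of the Eisenstein series, which
converges for `Re(s) ≫ 0`. -/
def IsContinuation (r : ℕ) (E : ℂ → GL (Fin 2) (Adele F) → ℂ) : Prop :=
  (∀ g, Differentiable ℂ fun s => E s g) ∧
    ∀ g, ∃ C : ℝ, ∀ s : ℂ, C < s.re → D.AbsConverges r s g ∧ E s g = D.series r s g

end Datum

open Classical in
/-- The element of `F_𝐀` with components `x_v` at `v ∣ p` and `0` at all other places. -/
def extendOp (x : Op F p) : Adele F :=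
  (0, ⟨fun v => if h : v ∈ placesAbove F p then (x ⟨v, h⟩ : Fv F v) else 0,
    Filter.Eventually.of_forall fun v => by
      by_cases h : v ∈ placesAbove F p
      · simp only [h, dite_true]; exact (x ⟨v, h⟩).2
      · simp only [h, dite_false]; exact zero_mem _⟩)

theorem valued_p_lt_one {v : FinPlace F} (hv : v ∈ placesAbove F p) :
    Valued.v ((p : Fv F v)) < 1 := by
  have h1 : v.asIdeal ∣ Ideal.span {(p : 𝓞 F)} := by
    simpa [placesAbove] using hv
  have h2 := (HeightOneSpectrum.valuation_lt_one_iff_dvd (K := F) v (p : 𝓞 F)).2 h1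
  have h3 : ((p : F) : Fv F v) = (p : Fv F v) := by
    exact map_natCast (algebraMap F (Fv F v)) p
  rw [← h3, HeightOneSpectrum.valuedAdicCompletion_eq_valuation']
  simpa using h2

theorem isUnit_one_add (r : ℕ) (hr : 1 ≤ r) (x : Op F p) :
    IsUnit (1 + extendOp x * (p : Adele F) ^ r) := by
  classical
  have key : ∀ v : FinPlace F,
      Valued.v ((1 + extendOp x * (p : Adele F) ^ r : Adele F).2 v) = 1 := by
    intro v
    have e : (1 + extendOp x * (p : Adele F) ^ r : Adele F).2 v =
        1 + (extendOp x).2 v * (p : Fv F v) ^ r := by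
      have hp : ((p : Adele F) : Adele F).2 v = (p : Fv F v) := by
        have h0 : (p : Adele F) = algebraMap F (Adele F) (p : F) := by simp
        rw [h0, AdeleRing.algebraMap_snd_apply]
        exact map_natCast (algebraMap F (Fv F v)) p
      have hpow : ∀ k : ℕ, ((p : Adele F) ^ k).2 v = (p : Fv F v) ^ k := by
        intro k
        induction k with
        | zero => rfl
        | succ k ih =>
          rw [pow_succ, pow_succ, ← ih, ← hp]; rfl
      rw [← hpow r]; rfl
    rw [e]
    by_cases h : v ∈ placesAbove F p
    · have hx : Valued.v ((extendOp x).2 v) ≤ 1 := by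
        have : (extendOp x).2 v = (x ⟨v, h⟩ : Fv F v) := by
          change (if h : v ∈ placesAbove F p then (x ⟨v, h⟩ : Fv F v) else (0 : Fv F v)) = _
          rw [dif_pos h]
        rw [this]
        exact (x ⟨v, h⟩).2
      have hlt : Valued.v ((extendOp x).2 v * (p : Fv F v) ^ r) < 1 := by
        rw [map_mul, map_pow]
        refine lt_of_le_of_lt (mul_le_mul_left hx _) ?_
        rw [one_mul]
        exact pow_lt_one₀ zero_le (valued_p_lt_one h) (by omega)
      exact Valuation.map_one_add_of_lt _ hlt
    · have : (extendOp x).2 v = 0 := by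
        change (if h : v ∈ placesAbove F p then (x ⟨v, h⟩ : Fv F v) else (0 : Fv F v)) = _
        rw [dif_neg h]
      simp [this]
  refine Prod.isUnit_iff.2 ⟨?_, ?_⟩
  · have : (1 + extendOp x * (p : Adele F) ^ r : Adele F).1 = 1 := by
      change (1 : InfiniteAdeleRing F) + 0 * _ = 1
      rw [zero_mul, add_zero]
    rw [this]; exact isUnit_one
  · rw [FiniteAdeleRing.isUnit_iff]
    exact ⟨fun v h0 => by simpa [h0] using key v, Filter.Eventually.of_forall key⟩

/-- The element of `GL₂(F_p) ⊆ GL₂(F_𝐀)` given by the matrix `[[1 + x p^r, 0], [y p^r, 1]]` at the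
places above `p` (and the identity elsewhere), for `x, y ∈ 𝒪_{F,p}` and `r ≥ 1`. -/
def translation (r : ℕ) (hr : 1 ≤ r) (x y : Op F p) : GL (Fin 2) (Adele F) :=
  Matrix.GeneralLinearGroup.mk''
    !![1 + extendOp x * (p : Adele F) ^ r, 0; extendOp y * (p : Adele F) ^ r, 1]
    (by simpa [Matrix.det_fin_two] using isUnit_one_add r hr x)

end DistEis
end

noncomputable section

namespace DistEis

open HeightOneSpectrum

/-! ### Completions at finite places and the local additive characters. -/

section LocalFields

variable {F : Type*} [Field F] [NumberField F]

/-! The identity is proved for single terms, before any summation, and then carried through the sum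
over `Fˣ` modulo units and the sum over `B₂(F) \ GL₂(F)`. Write d for the degree of F. By `term_eq`
and `detFactor_eq`, a term sees g only through the idele norm of det g and through the bottom row
(a, b). The translating matrix has determinant of idele norm 1 and changes only a, only above p, to
a(1 + xp^r) + byp^r.

For a, b integral at v ∣ p, the function of level r + 1 then takes the value ψ_v(a/p^{r+1})
ψ_v(ax/p) ψ_v(by/p). The sum over x and y is therefore a product of two complete character sums on
𝒪_{F,p}/p (`sum_opChar`). As p is unramified, the different is prime to p and ψ_v has conductor
𝒪_{F,v} (`exists_psi_mul_ne_one`). The sum thus vanishes unless p divides a and b, and is then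
p^{2d} times the level r function at (a/p, b/p). At the finite places prime to p, passing from (a,
b) to (a/p, b/p) costs only factors ω_v(p)⁻¹ at places dividing the level (`ΦFin_p_smul`), and the
archimedean integrals are homogeneous (`archInt_smul`). So the averaged term is a constant times the
term of level r at p⁻¹g (`sum_term_translation`). The product formula for ω at p and ∏ q_v = p^d
show that this constant is the ratio c_r / c_{r+1} (`c_succ_mul`).

The shift by p⁻¹ disappears in the sum over `Fˣ`. Passing from units of level r to level r + 1
multiplies the sum by [U_r : U_{r+1}], and the normalising index grows by the same factor, because
-1 lies in neither group when p is odd (`unitIndex_succ`).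

Absolute convergence (`absConverges`) rests on the bound of a term by a negative power of ∏_σ
max(|c|_σ, |d|_σ), where (c, d) is the rational bottom row. Nonzero terms have (c, d) with bounded
denominator, and units balance the archimedean sizes. This injects the nonzero terms into 𝒪_F²,
where a product of two lattice sums dominates. For the continuations, both sides are entire and
agree on a right half-plane. -/

theorem norm_le_one_iff_mem {v : FinPlace F} {x : Fv F v} :
    ‖x‖ ≤ 1 ↔ x ∈ v.adicCompletionIntegers F :=
  Valued.toNormedField.norm_le_one_iff

theorem norm_eq_one_iff_valued {v : FinPlace F} {x : Fv F v} : ‖x‖ = 1 ↔ Valued.v x = 1 := by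
  rw [FinitePlace.norm_def]
  rw [NNReal.coe_eq_one]
  constructor
  · intro h
    have := WithZeroMulInt.toNNReal_eq_one_iff (e := (Ideal.absNorm v.asIdeal : NNReal))
      (Valued.v x) (absNorm_ne_zero v) (one_lt_absNorm_nnreal v).ne'
    exact this.1 h
  · intro h; rw [h, map_one]

theorem norm_coe_le_one (v : FinPlace F) (a : 𝓞 F) : ‖((a : F) : Fv F v)‖ ≤ 1 :=
  FinitePlace.norm_le_one F v a

theorem norm_coe_eq_one_iff (v : FinPlace F) (a : 𝓞 F) :
    ‖((a : F) : Fv F v)‖ = 1 ↔ a ∉ v.asIdeal :=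
  FinitePlace.norm_eq_one_iff_notMem F v a

theorem coe_eq_algebraMap (v : FinPlace F) (a : F) : (a : Fv F v) = algebraMap F (Fv F v) a := rfl

theorem natCast_coe (v : FinPlace F) (n : ℕ) : (((n : 𝓞 F) : F) : Fv F v) = (n : Fv F v) := by
  rw [coe_eq_algebraMap]; simp

theorem exists_norm_sub_coe_lt (v : FinPlace F) (x : Fv F v) {ε : ℝ} (hε : 0 < ε) :
    ∃ y : F, ‖x - (y : Fv F v)‖ < ε := by
  obtain ⟨y, hy⟩ := (denseRange_algebraMap F v).exists_dist_lt x hε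
  exact ⟨y, by rwa [dist_eq_norm] at hy⟩

theorem norm_coe_le_norm_coe_of_mul_eq (v : FinPlace F) {t u b c : 𝓞 F} (hu : u ∉ v.asIdeal)
    (h : t * u = b * c) : ‖((t : F) : Fv F v)‖ ≤ ‖((b : F) : Fv F v)‖ := by
  have h1 := (norm_coe_eq_one_iff v u).2 hu
  have h2 : ((t : F) : Fv F v) * ((u : F) : Fv F v) = ((b : F) : Fv F v) * ((c : F) : Fv F v) := by
    simp only [coe_eq_algebraMap, ← map_mul]
    rw [h]
  have h3 := congrArg norm h2
  rw [norm_mul, norm_mul, h1, mul_one] at h3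
  rw [h3]
  exact mul_le_of_le_one_right (norm_nonneg _) (norm_coe_le_one v c)

theorem exists_mem_pow_notMem (v w : FinPlace F) (h : w ≠ v) (n : ℕ) :
    ∃ u ∈ v.asIdeal ^ n, u ∉ w.asIdeal := by
  by_contra! hc
  have h1 : v.asIdeal ≤ w.asIdeal := w.isPrime.le_of_pow_le (n := n) hc
  exact h (HeightOneSpectrum.ext ((v.isMaximal.eq_of_le w.isPrime.ne_top h1).symm))

/-- Every element of `F_v` is congruent modulo `𝒪_{F,v}` to an element of `F` which is integral at
all other finite places. -/
theorem exists_integral_away (v : FinPlace F) (x : Fv F v) :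
    ∃ y : F, (∀ w : FinPlace F, w ≠ v → (y : Fv F w) ∈ w.adicCompletionIntegers F) ∧
      x - (y : Fv F v) ∈ v.adicCompletionIntegers F := by
  obtain ⟨y₀, hy₀⟩ := exists_norm_sub_coe_lt v x one_pos
  obtain ⟨⟨a, b, hb⟩, hab⟩ := IsLocalization.surj (nonZeroDivisors (𝓞 F)) y₀
  replace hab : y₀ * (b : F) = (a : F) := hab
  have hb0 : b ≠ 0 := nonZeroDivisors.ne_zero hb
  have hbF : (b : F) ≠ 0 := by simpa using hb0
  -- Write (b) = v^n J with J prime to v, and 1 = t + z with t ∈ J, z ∈ v^n. The element sought is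
  -- y₀t. At w ≠ v some u ∈ v^n is a unit and b ∣ ut, so t absorbs the denominator; at v the error
  -- y₀z is integral by the same argument with u ∈ J.
  obtain ⟨J, hJ, hbJ⟩ := Ideal.eq_prime_pow_mul_coprime (I := Ideal.span {b})
    (by simpa using hb0) v.asIdeal
  set n := Multiset.count v.asIdeal
    (UniqueFactorizationMonoid.normalizedFactors (Ideal.span {b})) with hn
  have hcop : J ⊔ v.asIdeal ^ n = ⊤ := by
    rw [← Ideal.isCoprime_iff_sup_eq] at hJ ⊢
    exact hJ.symm.pow_right
  obtain ⟨t, ht, z, hz, htz⟩ := Submodule.mem_sup.1 (hcop ▸ Submodule.mem_top : (1 : 𝓞 F) ∈ _)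
  have hdiv : ∀ x ∈ v.asIdeal ^ n, ∀ y ∈ J, ∃ c, x * y = b * c := by
    intro x hx y hy
    have : x * y ∈ Ideal.span {b} := hbJ ▸ Ideal.mul_mem_mul hx hy
    exact Ideal.mem_span_singleton.1 this
  have hnorm : ∀ (w : FinPlace F) (t : 𝓞 F), ‖((t : F) : Fv F w)‖ ≤ ‖((b : F) : Fv F w)‖ →
      ‖((y₀ * t : F) : Fv F w)‖ ≤ 1 := by
    intro w t hw
    have hb1 : ((b : F) : Fv F w) ≠ 0 := by
      rw [coe_eq_algebraMap]; simpa using hb0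
    have h1 : ((y₀ * t : F) : Fv F w) * ((b : F) : Fv F w) =
        ((a : F) : Fv F w) * ((t : F) : Fv F w) := by
      simp only [coe_eq_algebraMap, ← map_mul]
      have h0 : y₀ * (t : F) * (b : F) = (a : F) * (t : F) := by rw [← hab]; ring
      exact congrArg (algebraMap F (Fv F w)) h0
    have h2 := congrArg norm h1
    rw [norm_mul, norm_mul] at h2
    have h3 : 0 < ‖((b : F) : Fv F w)‖ := norm_pos_iff.2 hb1
    refine le_of_mul_le_mul_right ?_ h3
    rw [h2, one_mul]
    exact (mul_le_of_le_one_left (norm_nonneg _) (norm_coe_le_one w a)).trans hw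
  refine ⟨y₀ * t, fun w hw => ?_, ?_⟩
  · rw [← norm_le_one_iff_mem]
    refine hnorm w t ?_
    obtain ⟨u, hu, hu'⟩ := exists_mem_pow_notMem v w hw n
    obtain ⟨c, hc⟩ := hdiv u hu t ht
    exact norm_coe_le_norm_coe_of_mul_eq w hu' ((mul_comm _ _).trans hc)
  · have e : x - ((y₀ * t : F) : Fv F v) = (x - (y₀ : Fv F v)) + ((y₀ * z : F) : Fv F v) := by
      have : (z : F) = 1 - (t : F) := by rw [eq_sub_iff_add_eq', ← map_add, htz, map_one]
      have e2 : ((y₀ * z : F) : Fv F v) = (y₀ : Fv F v) - ((y₀ * t : F) : Fv F v) := by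
        rw [coe_eq_algebraMap, coe_eq_algebraMap, coe_eq_algebraMap, ← map_sub, this]
        congr 1; ring
      rw [e2]; ring
    rw [e]
    refine add_mem (norm_le_one_iff_mem.1 hy₀.le) (norm_le_one_iff_mem.1 (hnorm v z ?_))
    obtain ⟨u, hu, hu'⟩ : ∃ u ∈ J, u ∉ v.asIdeal := by
      by_contra! hc
      have : v.asIdeal ⊔ J = v.asIdeal := sup_eq_left.2 hc
      exact v.isPrime.ne_top (this.symm.trans hJ)
    obtain ⟨c, hc⟩ := hdiv z hz u hu
    exact norm_coe_le_norm_coe_of_mul_eq v hu' hc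

theorem psi_add (v : FinPlace F) (x y : Fv F v) : psi v (x + y) = psi v x * psi v y := by
  obtain ⟨a, ha, ha'⟩ := exists_integral_away v x
  obtain ⟨b, hb, hb'⟩ := exists_integral_away v y
  rw [psi_eq v x a ha ha', psi_eq v y b hb hb', psi_eq v (x + y) (a + b), ← Complex.exp_add]
  · congr 1; rw [map_add]; push_cast; ring
  · intro w hw
    rw [adicCompletion.coe_add]
    exact add_mem (ha w hw) (hb w hw)
  · rw [adicCompletion.coe_add, add_sub_add_comm]
    exact add_mem ha' hb'

theorem psi_of_mem (v : FinPlace F) {x : Fv F v} (hx : x ∈ v.adicCompletionIntegers F) :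
    psi v x = 1 := by
  rw [psi_eq v x 0]
  · simp
  · intro w _; rw [adicCompletion.coe_zero]; exact zero_mem _
  · rwa [adicCompletion.coe_zero, sub_zero]

theorem psi_eq_of_sub_mem (v : FinPlace F) {x y : Fv F v}
    (h : x - y ∈ v.adicCompletionIntegers F) : psi v x = psi v y := by
  rw [← sub_add_cancel x y, psi_add, psi_of_mem v h, one_mul]

/-! ### Places above p, the different, and the conductor of ψ_v. -/

section Unramified

variable {p : ℕ} [Fact p.Prime]

theorem mem_placesAbove_iff {v : FinPlace F} :
    v ∈ placesAbove F p ↔ (p : 𝓞 F) ∈ v.asIdeal := by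
  simp [placesAbove]

theorem valued_p_eq {v : FinPlace F} (hv : v ∈ placesAbove F p)
    (hunram : ¬ v.asIdeal ^ 2 ∣ Ideal.span {(p : 𝓞 F)}) :
    Valued.v (p : Fv F v) = WithZero.exp (-1 : ℤ) := by
  have hp0 : (p : 𝓞 F) ≠ 0 := by exact_mod_cast (Fact.out : p.Prime).ne_zero
  rw [← natCast_coe, valuedAdicCompletion_eq_valuation', valuation_of_algebraMap]
  have h1 := (v.intValuation_le_pow_iff_mem (p : 𝓞 F) 1).2 (by
    simpa using mem_placesAbove_iff.1 hv)
  have h2 : ¬ v.intValuation (p : 𝓞 F) ≤ WithZero.exp (-((2 : ℕ) : ℤ)) :=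
    fun h => hunram ((v.intValuation_le_pow_iff_dvd (p : 𝓞 F) 2).1 h)
  rw [v.intValuation_eq_exp_neg_multiplicity hp0] at h1 h2 ⊢
  rw [WithZero.exp_le_exp] at h1 h2
  congr 1
  push_cast at h1 h2
  omega

theorem norm_p_eq_one {v : FinPlace F} (hv : v ∉ placesAbove F p) : ‖(p : Fv F v)‖ = 1 := by
  rw [← natCast_coe, norm_coe_eq_one_iff]
  rwa [mem_placesAbove_iff] at hv

theorem p_ne_zero (v : FinPlace F) : (p : Fv F v) ≠ 0 := by
  rw [← natCast_coe, coe_eq_algebraMap]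
  refine (map_ne_zero _).2 ?_
  rw [show ((p : 𝓞 F) : F) = (p : F) from map_natCast (algebraMap _ _) p]
  exact Nat.cast_ne_zero.2 (Fact.out : p.Prime).ne_zero

/-- Write (p) = vQ. If v² does not divide (p), then Q is not contained in the maximal ideal v, so v
and Q are coprime and the standard criterion for the different applies. -/
theorem not_dvd_differentIdeal {v : FinPlace F} (hv : v ∈ placesAbove F p)
    (hunram : ¬ v.asIdeal ^ 2 ∣ Ideal.span {(p : 𝓞 F)}) :
    ¬ v.asIdeal ∣ differentIdeal ℤ (𝓞 F) := by
  have hprime : Prime (p : ℤ) := Nat.prime_iff_prime_int.1 Fact.out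
  have hp0 : Ideal.span {(p : ℤ)} ≠ ⊥ := by
    simpa using (Fact.out : p.Prime).ne_zero
  have hpr : (Ideal.span {(p : ℤ)}).IsPrime :=
    (Ideal.span_singleton_prime hprime.ne_zero).2 hprime
  have hmax : (Ideal.span {(p : ℤ)}).IsMaximal := hpr.isMaximal hp0
  have hmax' := v.isMaximal
  have hfin : Finite (ℤ ⧸ Ideal.span {(p : ℤ)}) :=
    Ideal.finiteQuotientOfFreeOfNeBot _ hp0
  have hmap : Ideal.map (algebraMap ℤ (𝓞 F)) (Ideal.span {(p : ℤ)}) =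
      Ideal.span {(p : 𝓞 F)} := by
    rw [Ideal.map_span]; simp
  obtain ⟨Q, hQ⟩ : v.asIdeal ∣ Ideal.span {(p : 𝓞 F)} := by
    rw [Ideal.dvd_span_singleton]; exact mem_placesAbove_iff.1 hv
  refine not_dvd_differentIdeal_of_isCoprime ℤ (p := Ideal.span {(p : ℤ)}) v.asIdeal Q ?_
    (by rw [hmap, hQ])
  rw [Ideal.isCoprime_iff_sup_eq]
  refine hmax'.1.2 _ (lt_of_le_of_ne le_sup_left fun h => hunram ?_)
  have hle : Q ≤ v.asIdeal := by rw [h]; exact le_sup_right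
  rw [hQ, pow_two]
  exact mul_dvd_mul_left _ (Ideal.dvd_iff_le.2 hle)

/-- The conductor of `ψ_{F,v}` is `𝒪_{F,v}` at a place which is unramified over `ℚ`. -/
theorem exists_psi_mul_ne_one {v : FinPlace F} (hv : v ∈ placesAbove F p)
    (hunram : ¬ v.asIdeal ^ 2 ∣ Ideal.span {(p : 𝓞 F)}) {c : Fv F v} (hc : 1 < ‖c‖) :
    ∃ x ∈ v.adicCompletionIntegers F, psi v (c * x) ≠ 1 := by
  -- If ψ_v were trivial on c𝒪_{F,v} with |c| > 1, then every y ∈ v⁻¹, being integral away from v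
  -- and lying in c𝒪_{F,v}, would satisfy exp(-2πi Tr y) = ψ_v(y) = 1. So Tr(v⁻¹) ⊆ ℤ, that is, v
  -- would divide the different.
  by_contra! H
  refine not_dvd_differentIdeal hv hunram ?_
  have hvb : v.asIdeal ≠ ⊥ := v.ne_bot
  rw [Ideal.dvd_iff_le, differentialIdeal_le_iff (K := ℚ) (L := F) hvb,
    Submodule.map_le_iff_le_comap]
  intro y hy
  have hc0 : c ≠ 0 := by
    intro h; rw [h, norm_zero] at hc; linarith
  rw [Submodule.restrictScalars_mem, FractionalIdeal.mem_coe,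
    FractionalIdeal.mem_inv_iff (by simpa using hvb)] at hy
  have hmul : ∀ u ∈ v.asIdeal, ∃ o : 𝓞 F, (o : F) = y * u := by
    intro u hu
    obtain ⟨o, ho⟩ := (FractionalIdeal.mem_one_iff _).1
      (hy (u : F) (FractionalIdeal.mem_coeIdeal_of_mem _ hu))
    exact ⟨o, ho⟩
  have haway : ∀ w : FinPlace F, w ≠ v → (y : Fv F w) ∈ w.adicCompletionIntegers F := by
    intro w hw
    obtain ⟨u, hu, hu'⟩ := exists_mem_pow_notMem v w hw 1
    obtain ⟨o, ho⟩ := hmul u (by simpa using hu)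
    have h1 : (y : Fv F w) * ((u : F) : Fv F w) = ((o : F) : Fv F w) := by
      simp only [coe_eq_algebraMap, ← map_mul]; rw [ho]
    have h2 := congrArg norm h1
    rw [norm_mul, (norm_coe_eq_one_iff w u).2 hu', mul_one] at h2
    rw [← norm_le_one_iff_mem, h2]
    exact norm_coe_le_one w o
  have hyc : c⁻¹ * (y : Fv F v) ∈ v.adicCompletionIntegers F := by
    obtain ⟨π, hπ⟩ := v.intValuation_exists_uniformizer
    have hπv : π ∈ v.asIdeal := by
      rw [← v.intValuation_lt_one_iff_mem, hπ, ← WithZero.exp_zero, WithZero.exp_lt_exp]; norm_num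
    obtain ⟨o, ho⟩ := hmul π hπv
    have h1 : v.valuation F (o : F) = v.valuation F y * v.valuation F (π : F) := by
      rw [ho, map_mul]
    rw [valuation_of_algebraMap v π, hπ] at h1
    have h2 : v.valuation F (o : F) ≤ 1 := v.valuation_le_one o
    have h3 : 1 < Valued.v c := by
      by_contra! h
      exact hc.not_ge (norm_le_one_iff_mem.2 h)
    -- The value group is discrete: a value greater than 1 is at least that of the inverse of a
    -- uniformizer, which bounds y ∈ v⁻¹.
    have h4 : WithZero.exp (1 : ℤ) ≤ Valued.v c := by
      obtain ⟨m, hm⟩ : ∃ m : ℤ, Valued.v c = WithZero.exp m :=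
        ⟨WithZero.log (Valued.v c), (WithZero.exp_log ((Valuation.ne_zero_iff _).2 hc0)).symm⟩
      rw [hm, ← WithZero.exp_zero, WithZero.exp_lt_exp] at h3
      rw [hm, WithZero.exp_le_exp]
      omega
    have h5 : v.valuation F y ≤ WithZero.exp (1 : ℤ) := by
      have : v.valuation F y = v.valuation F (o : F) * WithZero.exp (1 : ℤ) := by
        rw [h1, mul_assoc, ← WithZero.exp_add]; simp
      rw [this]
      exact mul_le_of_le_one_left zero_le h2
    rw [mem_adicCompletionIntegers, map_mul, map_inv₀, valuedAdicCompletion_eq_valuation']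
    exact inv_mul_le_one_of_le₀ (h5.trans h4) zero_le
  have hpsi := H _ hyc
  rw [mul_inv_cancel_left₀ hc0, psi_eq v _ y haway (by rw [sub_self]; exact zero_mem _),
    Complex.exp_eq_one_iff] at hpsi
  obtain ⟨n, hn⟩ := hpsi
  rw [Submodule.mem_comap, Submodule.mem_one]
  refine ⟨-n, ?_⟩
  have h2 : (2 * Real.pi * Complex.I : ℂ) ≠ 0 := Complex.two_pi_I_ne_zero
  have h3 : ((Algebra.trace ℚ F y : ℚ) : ℂ) = ((-n : ℤ) : ℂ) := by
    have : (2 * Real.pi * Complex.I : ℂ) * ((Algebra.trace ℚ F y : ℚ) : ℂ) =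
        (2 * Real.pi * Complex.I : ℂ) * ((-n : ℤ) : ℂ) := by
      push_cast
      linear_combination -hn
    exact mul_left_cancel₀ h2 this
  have h4 : Algebra.trace ℚ F y = ((-n : ℤ) : ℚ) := by exact_mod_cast h3
  simpa using h4.symm

end Unramified

end LocalFields

/-! ### The order of 𝒪_{F,p}/p and the product of the residue cardinalities. -/

section Counting

variable {F : Type*} [Field F] [NumberField F]

theorem finprod_norm_coe {x : F} (hx : x ≠ 0) :
    ∏ᶠ v : FinPlace F, ‖(x : Fv F v)‖ = |((Algebra.norm ℚ x : ℚ) : ℝ)|⁻¹ := by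
  have h := FinitePlace.prod_eq_inv_abs_norm hx
  rw [← finprod_comp_equiv FinitePlace.equivHeightOneSpectrum.symm] at h
  rw [← Rat.cast_abs, ← Rat.cast_inv]
  exact_mod_cast h

variable {p : ℕ} [Fact p.Prime]

theorem norm_p_eq {v : FinPlace F} (hv : v ∈ placesAbove F p)
    (hunram : ¬ v.asIdeal ^ 2 ∣ Ideal.span {(p : 𝓞 F)}) :
    ‖(p : Fv F v)‖ = (qv v : ℝ)⁻¹ := by
  rw [FinitePlace.norm_def, valued_p_eq hv hunram,
    WithZeroMulInt.toNNReal_neg_apply _ WithZero.exp_ne_zero]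
  have : Multiplicative.toAdd
      (WithZero.unzero (WithZero.exp_ne_zero : WithZero.exp (-1 : ℤ) ≠ 0)) = -1 := rfl
  rw [this, zpow_neg_one]
  rfl

theorem norm_p_lt_one {v : FinPlace F} (hv : v ∈ placesAbove F p) : ‖(p : Fv F v)‖ < 1 := by
  rw [← natCast_coe]
  exact (FinitePlace.norm_lt_one_iff_mem F v (p : 𝓞 F)).2 (mem_placesAbove_iff.1 hv)

/-- The product formula for p: the norms ‖p‖_v = q_v⁻¹ above p, all others being 1, multiply to
|N(p)|⁻¹ = p^{-d}. -/
theorem prod_qv (hunram : ∀ v ∈ placesAbove F p, ¬ v.asIdeal ^ 2 ∣ Ideal.span {(p : 𝓞 F)}) :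
    ∏ v ∈ placesAbove F p, qv v = p ^ Module.finrank ℚ F := by
  have hp0 : (p : F) ≠ 0 := Nat.cast_ne_zero.2 (Fact.out : p.Prime).ne_zero
  have h := finprod_norm_coe hp0
  have hcast : ∀ v : FinPlace F, ((p : F) : Fv F v) = (p : Fv F v) := fun v =>
    map_natCast (algebraMap F (Fv F v)) p
  simp only [hcast] at h
  rw [finprod_eq_prod_of_mulSupport_subset (s := placesAbove F p)] at h
  · rw [Finset.prod_congr rfl fun v hv => norm_p_eq hv (hunram v hv), Finset.prod_inv_distrib,
      inv_inj] at h
    have hn : Algebra.norm ℚ (p : F) = (p : ℚ) ^ Module.finrank ℚ F := by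
      have := Algebra.norm_algebraMap (S := F) (p : ℚ)
      simpa using this
    rw [hn, Rat.cast_pow, Rat.cast_natCast, abs_of_nonneg (by positivity)] at h
    exact_mod_cast h
  · intro v hv
    by_contra hv'
    exact hv (norm_p_eq_one hv')

theorem mem_span_p_iff {x : Op F p} :
    x ∈ Ideal.span {(p : Op F p)} ↔ ∀ v, ‖(x v : Fv F v.1)‖ ≤ ‖(p : Fv F v.1)‖ := by
  rw [Ideal.mem_span_singleton]
  constructor
  · rintro ⟨y, rfl⟩ v
    have : (((p : Op F p) * y) v : Fv F v.1) = (p : Fv F v.1) * (y v : Fv F v.1) := by simp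
    rw [this, norm_mul]
    exact mul_le_of_le_one_right (norm_nonneg _) (norm_le_one_iff_mem.2 (y v).2)
  · intro h
    have hm : ∀ v : placesAbove F p,
        (p : Fv F v.1)⁻¹ * (x v : Fv F v.1) ∈ v.1.adicCompletionIntegers F := by
      intro v
      rw [← norm_le_one_iff_mem, norm_mul, norm_inv]
      exact inv_mul_le_one_of_le₀ (h v) (norm_nonneg _)
    refine ⟨fun v => ⟨_, hm v⟩, ?_⟩
    ext v
    simp [mul_inv_cancel_left₀ (p_ne_zero v.1)]

/-- As p is a uniformizer at v, no absolute value lies strictly between |p|_v and 1. -/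
theorem norm_le_norm_p_iff {v : FinPlace F} (hv : v ∈ placesAbove F p)
    (hunram : ¬ v.asIdeal ^ 2 ∣ Ideal.span {(p : 𝓞 F)}) {x : Fv F v} :
    ‖x‖ ≤ ‖(p : Fv F v)‖ ↔ ‖x‖ < 1 := by
  refine ⟨fun h => h.trans_lt (norm_p_lt_one hv), fun h => ?_⟩
  rcases eq_or_ne x 0 with rfl | hx
  · simp
  have h1 : Valued.v x < 1 := by
    rcases lt_or_eq_of_le
      ((mem_adicCompletionIntegers _ _ _).1 (norm_le_one_iff_mem.1 h.le)) with h' | h'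
    · exact h'
    · exact absurd (norm_eq_one_iff_valued.2 h') h.ne
  have h2 : Valued.v x ≤ Valued.v (p : Fv F v) := by
    rw [valued_p_eq hv hunram]
    obtain ⟨m, hm⟩ : ∃ m : ℤ, Valued.v x = WithZero.exp m :=
      ⟨WithZero.log (Valued.v x), (WithZero.exp_log ((Valuation.ne_zero_iff _).2 hx)).symm⟩
    rw [hm, ← WithZero.exp_zero, WithZero.exp_lt_exp] at h1
    rw [hm, WithZero.exp_le_exp]
    omega
  rw [FinitePlace.norm_def, FinitePlace.norm_def]
  exact_mod_cast (WithZeroMulInt.toNNReal_strictMono (one_lt_absNorm_nnreal v)).monotone h2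

theorem exists_norm_sub_coe_integer_lt (v : FinPlace F) {x : Fv F v} (hx : ‖x‖ ≤ 1) :
    ∃ a : 𝓞 F, ‖x - ((a : F) : Fv F v)‖ < 1 := by
  obtain ⟨y, hy⟩ := exists_norm_sub_coe_lt v x one_pos
  have hy1 : (y : Fv F v) ∈ v.adicCompletionIntegers F := by
    have := sub_mem (norm_le_one_iff_mem.1 hx) (norm_le_one_iff_mem.1 hy.le)
    rwa [sub_sub_cancel] at this
  have hy2 : v.valuation F y ≤ 1 := by
    rw [← valuedAdicCompletion_eq_valuation']; exact hy1
  obtain ⟨a, ha⟩ := v.exists_valuation_sub_lt_of_integer hy2 1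
  refine ⟨a, ?_⟩
  have e : x - ((a : F) : Fv F v) = (x - (y : Fv F v)) + -(((a : F) - y : F) : Fv F v) := by
    have : (((a : F) - y : F) : Fv F v) = ((a : F) : Fv F v) - (y : Fv F v) := by
      rw [coe_eq_algebraMap, map_sub]; rfl
    rw [this]; ring
  have h2 : ‖(((a : F) - y : F) : Fv F v)‖ < 1 := by
    refine lt_of_le_of_ne ?_ fun h => ?_
    · rw [norm_le_one_iff_mem, mem_adicCompletionIntegers, valuedAdicCompletion_eq_valuation']
      exact ha.le
    · rw [norm_eq_one_iff_valued, valuedAdicCompletion_eq_valuation'] at h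
      exact ha.ne h
  rw [e]
  refine lt_of_le_of_lt (IsUltrametricDist.norm_add_le_max _ _) (max_lt hy ?_)
  rwa [norm_neg]

/-- Each component is congruent to a global integer modulo the maximal ideal, and the Chinese
remainder theorem glues these finitely many integers. A congruence modulo v is one modulo p, because
p is a uniformizer at v. -/
theorem exists_integer_sub_mem_span_p
    (hunram : ∀ v ∈ placesAbove F p, ¬ v.asIdeal ^ 2 ∣ Ideal.span {(p : 𝓞 F)}) (x : Op F p) :
    ∃ a : 𝓞 F, x - algebraMap (𝓞 F) (Op F p) a ∈ Ideal.span {(p : Op F p)} := by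
  choose b hb using fun v : placesAbove F p =>
    exists_norm_sub_coe_integer_lt v.1 (norm_le_one_iff_mem.2 (x v).2)
  obtain ⟨a, ha⟩ := IsDedekindDomain.exists_forall_sub_mem_ideal
    (s := placesAbove F p) (fun v => v.asIdeal) (fun _ => 1)
    (fun v _ => v.prime) (fun v _ w _ h h' => h (HeightOneSpectrum.ext h')) b
  refine ⟨a, mem_span_p_iff.2 fun v => ?_⟩
  rw [norm_le_norm_p_iff v.2 (hunram v.1 v.2)]
  have e : ((x - algebraMap (𝓞 F) (Op F p) a) v : Fv F v.1) =
      ((x v : Fv F v.1) - ((b v : F) : Fv F v.1)) + -(((a - b v : 𝓞 F) : F) : Fv F v.1) := by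
    have h1 : (((a - b v : 𝓞 F) : F) : Fv F v.1) =
        ((a : F) : Fv F v.1) - ((b v : F) : Fv F v.1) := by
      simp only [coe_eq_algebraMap]
      rw [← map_sub, ← map_sub]
    have h2 : ((x - algebraMap (𝓞 F) (Op F p) a) v : Fv F v.1) =
      (x v : Fv F v.1) - ((a : F) : Fv F v.1) := rfl
    rw [h1, h2]; ring
  rw [e]
  refine lt_of_le_of_lt (IsUltrametricDist.norm_add_le_max _ _) (max_lt (hb v) ?_)
  rw [norm_neg]
  refine (FinitePlace.norm_lt_one_iff_mem F v.1 _).2 ?_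
  simpa using ha v.1 v.2

/-- Global integers surject onto the quotient by the previous approximation. The kernel is (p),
because divisibility by p is only a condition at the places above p; its absolute norm is p^d. -/
theorem card_quotient_p
    (hunram : ∀ v ∈ placesAbove F p, ¬ v.asIdeal ^ 2 ∣ Ideal.span {(p : 𝓞 F)}) :
    Nat.card (Op F p ⧸ Ideal.span {(p : Op F p)}) = p ^ Module.finrank ℚ F := by
  let f : 𝓞 F →+* Op F p ⧸ Ideal.span {(p : Op F p)} :=
    (Ideal.Quotient.mk _).comp (algebraMap (𝓞 F) (Op F p))
  have hf : Function.Surjective f := by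
    intro x
    obtain ⟨x, rfl⟩ := Ideal.Quotient.mk_surjective x
    obtain ⟨a, ha⟩ := exists_integer_sub_mem_span_p hunram x
    exact ⟨a, (Ideal.Quotient.eq.2 ha).symm⟩
  have hp0 : (p : F) ≠ 0 := Nat.cast_ne_zero.2 (Fact.out : p.Prime).ne_zero
  have hcast : ∀ v : FinPlace F, ((p : F) : Fv F v) = (p : Fv F v) := fun v =>
    map_natCast (algebraMap F (Fv F v)) p
  have hker : RingHom.ker f = Ideal.span {(p : 𝓞 F)} := by
    ext a
    rw [RingHom.mem_ker, RingHom.comp_apply, Ideal.Quotient.eq_zero_iff_mem, mem_span_p_iff,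
      Ideal.mem_span_singleton]
    constructor
    · intro h
      obtain ⟨o, ho⟩ := mem_integers_of_valuation_le_one (R := 𝓞 F) F ((p : F)⁻¹ * (a : F)) (by
        intro w
        rw [← valuedAdicCompletion_eq_valuation']
        change _ ∈ w.adicCompletionIntegers F
        rw [← norm_le_one_iff_mem, adicCompletion.coe_mul, norm_mul]
        have e : (((p : F)⁻¹ : F) : Fv F w) = (p : Fv F w)⁻¹ := by
          rw [← hcast, coe_eq_algebraMap, map_inv₀]; rfl
        rw [e, norm_inv]
        by_cases hw : w ∈ placesAbove F p
        · exact inv_mul_le_one_of_le₀ (h ⟨w, hw⟩) (norm_nonneg _)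
        · rw [norm_p_eq_one hw, inv_one, one_mul]
          exact norm_coe_le_one w a)
      refine ⟨o, RingOfIntegers.ext ?_⟩
      have : (a : F) = (p : F) * (o : F) := by
        rw [show (o : F) = algebraMap (𝓞 F) F o from rfl, ho, mul_inv_cancel_left₀ hp0]
      rw [this]; simp
    · rintro ⟨b, rfl⟩ v
      have : (algebraMap (𝓞 F) (Op F p) ((p : 𝓞 F) * b) v : Fv F v.1) =
          (p : Fv F v.1) * ((b : F) : Fv F v.1) := by
        rw [map_mul, map_natCast]; rfl
      rw [this, norm_mul]
      exact mul_le_of_le_one_right (norm_nonneg _) (norm_coe_le_one v.1 b)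
  have e := RingHom.quotientKerEquivOfSurjective hf
  rw [← Nat.card_congr e.toEquiv, hker]
  have h2 : Ideal.absNorm (Ideal.span {(p : 𝓞 F)}) = p ^ Module.finrank ℚ F := by
    rw [Ideal.absNorm_span_singleton]
    have := Algebra.norm_algebraMap (S := 𝓞 F) (p : ℤ)
    rw [map_natCast, RingOfIntegers.rank] at this
    rw [this]
    simp [Int.natAbs_pow]
  rw [← h2, Ideal.absNorm_apply]
  rfl

end Counting

/-! ### Orthogonality of additive characters and the average at the places above p. -/

section CharacterSums

variable {F : Type*} [Field F] [NumberField F] {p : ℕ} [Fact p.Prime]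

/-- The additive character `x ↦ ∏_{v ∣ p} ψ_v(a_v x_v / p)` of `𝒪_{F,p}`. -/
def opChar (a : ∀ v : FinPlace F, Fv F v) (x : Op F p) : ℂ :=
  ∏ v : placesAbove F p, psi v.1 (a v.1 * (x v : Fv F v.1) / (p : Fv F v.1))

theorem opChar_add (a : ∀ v : FinPlace F, Fv F v) (x y : Op F p) :
    opChar a (x + y) = opChar a x * opChar a y := by
  rw [opChar, opChar, opChar, ← Finset.prod_mul_distrib]
  refine Finset.prod_congr rfl fun v _ => ?_
  rw [← psi_add]
  congr 1
  have : ((x + y) v : Fv F v.1) = (x v : Fv F v.1) + (y v : Fv F v.1) := rfl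
  rw [this]; ring

theorem mul_div_p_mem {v : FinPlace F} {a x : Fv F v} (ha : ‖a‖ ≤ 1)
    (hx : ‖x‖ ≤ ‖(p : Fv F v)‖) : a * x / (p : Fv F v) ∈ v.adicCompletionIntegers F := by
  rw [← norm_le_one_iff_mem, norm_div, norm_mul, div_le_one (norm_pos_iff.2 (p_ne_zero v))]
  exact (mul_le_of_le_one_left (norm_nonneg _) ha).trans hx

theorem opChar_of_mem {a : ∀ v : FinPlace F, Fv F v} (ha : ∀ v ∈ placesAbove F p, ‖a v‖ ≤ 1)
    {x : Op F p} (hx : x ∈ Ideal.span {(p : Op F p)}) : opChar a x = 1 := by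
  rw [mem_span_p_iff] at hx
  exact Finset.prod_eq_one fun v _ => psi_of_mem _ (mul_div_p_mem (ha v.1 v.2) (hx v))

open Classical in
-- The conductor of ψ_v is tested on an element supported at the single place v.
theorem exists_opChar_ne_one
    (hunram : ∀ v ∈ placesAbove F p, ¬ v.asIdeal ^ 2 ∣ Ideal.span {(p : 𝓞 F)})
    {a : ∀ v : FinPlace F, Fv F v} {v : FinPlace F} (hv : v ∈ placesAbove F p)
    (hav : ‖(p : Fv F v)‖ < ‖a v‖) : ∃ z : Op F p, opChar a z ≠ 1 := by
  have h1 : 1 < ‖a v / (p : Fv F v)‖ := by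
    rwa [norm_div, one_lt_div (norm_pos_iff.2 (p_ne_zero v))]
  obtain ⟨x, hx, hx'⟩ := exists_psi_mul_ne_one hv (hunram v hv) h1
  refine ⟨Pi.single (M := fun v : placesAbove F p => Ov F v.1) ⟨v, hv⟩ ⟨x, hx⟩, ?_⟩
  rw [opChar, Finset.prod_eq_single (⟨v, hv⟩ : placesAbove F p)]
  · rw [Pi.single_eq_same]
    rwa [div_mul_eq_mul_div] at hx'
  · intro w _ hw
    rw [Pi.single_eq_of_ne hw]
    simp only [ZeroMemClass.coe_zero, mul_zero, zero_div]
    exact psi_of_mem _ (zero_mem _)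
  · intro h; exact absurd (Finset.mem_univ _) h

/-- For integral a the character is trivial on (p), so the sum runs over the characters' values on
the finite group 𝒪_{F,p}/p. It is trivial there exactly when p divides every a_v with v ∣ p. -/
theorem sum_opChar
    (hunram : ∀ v ∈ placesAbove F p, ¬ v.asIdeal ^ 2 ∣ Ideal.span {(p : 𝓞 F)})
    (R : Finset (Op F p))
    (hR : Function.Bijective fun x : R => Ideal.Quotient.mk (Ideal.span {(p : Op F p)}) x.1)
    {a : ∀ v : FinPlace F, Fv F v} (ha : ∀ v ∈ placesAbove F p, ‖a v‖ ≤ 1) [Decidable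
      (∀ v ∈ placesAbove F p, ‖a v‖ ≤ ‖(p : Fv F v)‖)] :
    ∑ x ∈ R, opChar a x =
      if ∀ v ∈ placesAbove F p, ‖a v‖ ≤ ‖(p : Fv F v)‖ then (R.card : ℂ) else 0 := by
  split_ifs with h
  · rw [Finset.sum_congr rfl fun x _ => show opChar a x = 1 from ?_]
    · simp
    · refine Finset.prod_eq_one fun v _ => psi_of_mem _ ?_
      rw [mul_comm]
      exact mul_div_p_mem (norm_le_one_iff_mem.2 (x v).2) (h v.1 v.2)
  · push Not at h
    obtain ⟨v, hv, hav⟩ := h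
    obtain ⟨z, hz⟩ := exists_opChar_ne_one hunram hv hav
    have hinv : ∀ x y : Op F p, Ideal.Quotient.mk (Ideal.span {(p : Op F p)}) x =
        Ideal.Quotient.mk (Ideal.span {(p : Op F p)}) y → opChar a x = opChar a y := by
      intro x y hxy
      rw [← sub_add_cancel x y, opChar_add, opChar_of_mem ha (Ideal.Quotient.eq.1 hxy), one_mul]
    let e := Equiv.ofBijective _ hR
    have := Fintype.ofEquiv _ e
    let χ : Op F p ⧸ Ideal.span {(p : Op F p)} → ℂ := fun q => opChar a (Quotient.out q)
    have hχ : ∀ x, opChar a x = χ (Ideal.Quotient.mk _ x) := fun x =>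
      hinv _ _ (Quotient.out_eq (Ideal.Quotient.mk _ x)).symm
    have h1 : ∑ x ∈ R, opChar a x = ∑ q, χ q := by
      rw [← Finset.sum_coe_sort R]
      exact Fintype.sum_bijective _ hR _ _ fun x => hχ x.1
    -- Translating the summation variable by z multiplies the sum by a value different from 1, so
    -- the sum is 0.
    have h2 : ∑ q, χ q = opChar a z * ∑ q, χ q := by
      rw [Finset.mul_sum]
      symm
      refine Fintype.sum_bijective (fun q => Ideal.Quotient.mk _ z + q)
        (AddGroup.addLeft_bijective _) _ _ fun q => ?_
      obtain ⟨x, rfl⟩ := Ideal.Quotient.mk_surjective q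
      rw [← map_add, ← hχ, ← hχ, opChar_add]
    rw [h1]
    by_contra h0
    exact hz (mul_right_cancel₀ h0 (by rw [← h2, one_mul]))

variable (D : Datum F p)

open Classical in
theorem extendOp_snd_apply (x : Op F p) (v : placesAbove F p) :
    (extendOp x).2 v.1 = (x v : Fv F v.1) := by
  change (if h : v.1 ∈ placesAbove F p then (x ⟨v.1, h⟩ : Fv F v.1) else (0 : Fv F v.1)) = _
  rw [dif_pos v.2]

open Classical in
theorem extendOp_snd_apply_of_notMem (x : Op F p) {v : FinPlace F} (hv : v ∉ placesAbove F p) :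
    (extendOp x).2 v = 0 := by
  change (if h : v ∈ placesAbove F p then (x ⟨v, h⟩ : Fv F v) else (0 : Fv F v)) = _
  rw [dif_neg hv]

theorem norm_extendOp_le_one (x : Op F p) (v : FinPlace F) : ‖(extendOp x).2 v‖ ≤ 1 := by
  by_cases hv : v ∈ placesAbove F p
  · rw [extendOp_snd_apply x ⟨v, hv⟩]
    exact norm_le_one_iff_mem.2 (x ⟨v, hv⟩).2
  · rw [extendOp_snd_apply_of_notMem x hv, norm_zero]
    exact zero_le_one

theorem norm_one_add_extendOp {r : ℕ} (hr : 1 ≤ r) (x : Op F p) (v : FinPlace F) :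
    ‖1 + (extendOp x).2 v * (p : Fv F v) ^ r‖ = 1 := by
  by_cases hv : v ∈ placesAbove F p
  · have h : ‖(extendOp x).2 v * (p : Fv F v) ^ r‖ < 1 := by
      rw [norm_mul, norm_pow]
      refine lt_of_le_of_lt (mul_le_of_le_one_left (by positivity) (norm_extendOp_le_one x v)) ?_
      exact pow_lt_one₀ (norm_nonneg _) (norm_p_lt_one hv) (by omega)
    rw [IsUltrametricDist.norm_add_eq_max_of_norm_ne_norm (by rw [norm_one]; exact h.ne'),
      norm_one, max_eq_left h.le]
  · rw [extendOp_snd_apply_of_notMem x hv]; simp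

/-- Since r ≥ 1, the factor 1 + xp^r is a unit, and byp^r is integral when b is; so the translation
preserves the support condition of the Schwartz function. -/
theorem norm_translate_le_one_iff {r : ℕ} (hr : 1 ≤ r) (x y : Op F p) (v : FinPlace F)
    {a b : Fv F v} (hb : ‖b‖ ≤ 1) :
    ‖a * (1 + (extendOp x).2 v * (p : Fv F v) ^ r) + b * ((extendOp y).2 v * (p : Fv F v) ^ r)‖ ≤ 1
      ↔ ‖a‖ ≤ 1 := by
  have hp1 : ‖(p : Fv F v)‖ ≤ 1 := by
    rw [← natCast_coe]; exact norm_coe_le_one v _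
  have h1 : ‖b * ((extendOp y).2 v * (p : Fv F v) ^ r)‖ ≤ 1 := by
    rw [norm_mul, norm_mul, norm_pow]
    exact mul_le_one₀ hb (by positivity) (mul_le_one₀ (norm_extendOp_le_one y v) (by positivity)
      (pow_le_one₀ (norm_nonneg _) hp1))
  have h2 : ‖a * (1 + (extendOp x).2 v * (p : Fv F v) ^ r)‖ = ‖a‖ := by
    rw [norm_mul, norm_one_add_extendOp hr, mul_one]
  rw [← h2, norm_le_one_iff_mem, norm_le_one_iff_mem]
  exact add_mem_cancel_right (norm_le_one_iff_mem.1 h1)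

/-- Averaging `Φ_p^{(r+1)}` over the cosets of level `p^{r+1}` in level `p^r`. -/
theorem sum_prod_ΦFin_translate
    (hunram : ∀ v ∈ placesAbove F p, ¬ v.asIdeal ^ 2 ∣ Ideal.span {(p : 𝓞 F)})
    {r : ℕ} (hr : 1 ≤ r) (R : Finset (Op F p))
    (hR : Function.Bijective fun x : R => Ideal.Quotient.mk (Ideal.span {(p : Op F p)}) x.1)
    (a b : ∀ v : FinPlace F, Fv F v) :
    ∑ x ∈ R, ∑ y ∈ R, ∏ v ∈ placesAbove F p, D.ΦFin (r + 1) v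
      (a v * (1 + (extendOp x).2 v * (p : Fv F v) ^ r) +
        b v * ((extendOp y).2 v * (p : Fv F v) ^ r)) (b v) =
    (R.card : ℂ) ^ 2 * ∏ v ∈ placesAbove F p,
      D.ΦFin r v ((p : Fv F v)⁻¹ * a v) ((p : Fv F v)⁻¹ * b v) := by
  classical
  have hdiv : ∀ (v : FinPlace F) (c : Fv F v),
      ‖(p : Fv F v)⁻¹ * c‖ ≤ 1 ↔ ‖c‖ ≤ ‖(p : Fv F v)‖ := by
    intro v c
    rw [norm_mul, norm_inv, inv_mul_le_one₀ (norm_pos_iff.2 (p_ne_zero v))]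
  by_cases hint : ∀ v ∈ placesAbove F p, ‖a v‖ ≤ 1 ∧ ‖b v‖ ≤ 1
  -- Additivity of ψ_v is applied to (a(1 + xp^r) + byp^r)/p^{r+1} = a/p^{r+1} + ax/p + by/p.
  · have hL : ∀ x y : Op F p, ∏ v ∈ placesAbove F p, D.ΦFin (r + 1) v
        (a v * (1 + (extendOp x).2 v * (p : Fv F v) ^ r) +
          b v * ((extendOp y).2 v * (p : Fv F v) ^ r)) (b v) =
        (∏ v ∈ placesAbove F p, psi v (a v / (p : Fv F v) ^ (r + 1))) *
          (opChar a x * opChar b y) := by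
      intro x y
      rw [opChar, opChar, ← Finset.prod_coe_sort (placesAbove F p) fun v =>
          psi v (a v / (p : Fv F v) ^ (r + 1)),
        ← Finset.prod_coe_sort (placesAbove F p) fun v => D.ΦFin (r + 1) v
          (a v * (1 + (extendOp x).2 v * (p : Fv F v) ^ r) +
          b v * ((extendOp y).2 v * (p : Fv F v) ^ r)) (b v),
        ← Finset.prod_mul_distrib, ← Finset.prod_mul_distrib]
      refine Finset.prod_congr rfl fun v _ => ?_
      rw [Datum.ΦFin, if_pos v.2, if_pos
        ⟨(norm_translate_le_one_iff hr x y v.1 (hint v.1 v.2).2).2 (hint v.1 v.2).1,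
          (hint v.1 v.2).2⟩, ← psi_add, ← psi_add, extendOp_snd_apply, extendOp_snd_apply]
      congr 1
      have := p_ne_zero (p := p) v.1
      field_simp
      ring
    rw [Finset.sum_congr rfl fun x _ => Finset.sum_congr rfl fun y _ => hL x y]
    have : ∑ x ∈ R, ∑ y ∈ R, (∏ v ∈ placesAbove F p, psi v (a v / (p : Fv F v) ^ (r + 1))) *
          (opChar a x * opChar b y) =
        (∏ v ∈ placesAbove F p, psi v (a v / (p : Fv F v) ^ (r + 1))) *
          ((∑ x ∈ R, opChar a x) * ∑ y ∈ R, opChar b y) := by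
      rw [Finset.sum_mul_sum, Finset.mul_sum]
      exact Finset.sum_congr rfl fun x _ => by rw [Finset.mul_sum]
    rw [this, sum_opChar hunram R hR fun v hv => (hint v hv).1,
      sum_opChar hunram R hR fun v hv => (hint v hv).2]
    -- Orthogonality leaves exactly the rows divisible by p, which is also the support of the
    -- right-hand side.
    by_cases hab : ∀ v ∈ placesAbove F p, ‖a v‖ ≤ ‖(p : Fv F v)‖ ∧ ‖b v‖ ≤ ‖(p : Fv F v)‖
    · rw [if_pos fun v hv => (hab v hv).1, if_pos fun v hv => (hab v hv).2, ← pow_two, mul_comm]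
      congr 1
      refine Finset.prod_congr rfl fun v hv => ?_
      rw [Datum.ΦFin, if_pos hv, if_pos ⟨(hdiv v _).2 (hab v hv).1, (hdiv v _).2 (hab v hv).2⟩]
      congr 1
      have := p_ne_zero (p := p) v
      field_simp
      ring
    · push Not at hab
      obtain ⟨v, hv, hab⟩ := hab
      rw [Finset.prod_eq_zero (i := v) (s := placesAbove F p)
        (f := fun v => D.ΦFin r v ((p : Fv F v)⁻¹ * a v) ((p : Fv F v)⁻¹ * b v)) hv, mul_zero]
      · by_cases h : ‖a v‖ ≤ ‖(p : Fv F v)‖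
        · rw [if_neg (c := ∀ v ∈ placesAbove F p, ‖b v‖ ≤ ‖(p : Fv F v)‖)
            fun h' => (hab h).not_ge (h' v hv), mul_zero, mul_zero]
        · rw [if_neg fun h' => h (h' v hv), zero_mul, mul_zero]
      · rw [Datum.ΦFin, if_pos hv, if_neg]
        rw [hdiv, hdiv]
        exact fun h => (hab h.1).not_ge h.2
  -- Rows that are not integral above p contribute 0 on both sides: neither translation nor division
  -- by p can make them integral.
  · push Not at hint
    obtain ⟨v, hv, hint⟩ := hint
    rw [Finset.prod_eq_zero (i := v) (s := placesAbove F p)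
      (f := fun v => D.ΦFin r v ((p : Fv F v)⁻¹ * a v) ((p : Fv F v)⁻¹ * b v)) hv, mul_zero]
    · refine Finset.sum_eq_zero fun x _ => Finset.sum_eq_zero fun y _ => ?_
      refine Finset.prod_eq_zero hv ?_
      rw [Datum.ΦFin, if_pos hv, if_neg]
      rintro ⟨h1, h2⟩
      exact (hint ((norm_translate_le_one_iff hr x y v h2).1 h1)).not_ge h2
    · rw [Datum.ΦFin, if_pos hv, if_neg]
      rw [hdiv, hdiv]
      intro h
      exact (hint (h.1.trans (norm_p_lt_one hv).le)).not_ge (h.2.trans (norm_p_lt_one hv).le)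

end CharacterSums

/-! ### Local components of ω and the product formula at p. -/

section HeckeCharacter

variable {F : Type*} [Field F] [NumberField F] {p : ℕ} [Fact p.Prime]

/-- The component of an adele at a finite place. -/
def finComp (v : FinPlace F) : Adele F →+* Fv F v where
  toFun a := a.2 v
  map_one' := rfl
  map_mul' _ _ := rfl
  map_zero' := rfl
  map_add' _ _ := rfl

theorem finComp_apply (v : FinPlace F) (a : Adele F) : finComp v a = a.2 v := rfl

open Classical in
theorem finComp_localIdele_self (v : FinPlace F) (y : (Fv F v)ˣ) :
    finComp v (localIdele v y : Adele F) = y := by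
  change Function.update (fun w => (1 : Fv F w)) v (y : Fv F v) v = _
  rw [Function.update_self]

open Classical in
theorem finComp_localIdele_of_ne {v w : FinPlace F} (h : w ≠ v) (y : (Fv F v)ˣ) :
    finComp w (localIdele v y : Adele F) = 1 := by
  change Function.update (fun w => (1 : Fv F w)) v (y : Fv F v) w = _
  rw [Function.update_of_ne h]

theorem units_adele_ext {u u' : (Adele F)ˣ} (h1 : (u : Adele F).1 = (u' : Adele F).1)
    (h2 : ∀ v, finComp v (u : Adele F) = finComp v (u' : Adele F)) : u = u' :=
  Units.ext (Prod.ext h1 (FiniteAdeleRing.ext F h2))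

theorem localIdele_mul (v : FinPlace F) (y z : (Fv F v)ˣ) :
    localIdele v (y * z) = localIdele v y * localIdele v z := by
  refine units_adele_ext (one_mul _).symm fun w => ?_
  rw [Units.val_mul, map_mul]
  by_cases h : w = v
  · subst h; simp only [finComp_localIdele_self, Units.val_mul]
  · simp only [finComp_localIdele_of_ne h, mul_one]

/-- The embedding of `∏_v 𝒪_{F,v}ˣ` into the ideles. -/
def unitIdele : (∀ v : FinPlace F, (Ov F v)ˣ) →* (Adele F)ˣ where
  toFun z :=
    { val := (1, ⟨fun v => ((z v : Ov F v) : Fv F v), .of_forall fun v => (z v : Ov F v).2⟩)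
      inv := (1, ⟨fun v => (((z v)⁻¹ : (Ov F v)ˣ) : Ov F v),
        .of_forall fun v => (((z v)⁻¹ : (Ov F v)ˣ) : Ov F v).2⟩)
      val_inv := Prod.ext (one_mul _) (FiniteAdeleRing.ext F fun v => by
        change ((z v : Ov F v) : Fv F v) * (((z v)⁻¹ : (Ov F v)ˣ) : Ov F v) = 1
        exact_mod_cast congrArg (Subtype.val) (z v).mul_inv)
      inv_val := Prod.ext (one_mul _) (FiniteAdeleRing.ext F fun v => by
        change ((((z v)⁻¹ : (Ov F v)ˣ) : Ov F v) : Fv F v) * (z v : Ov F v) = 1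
        exact_mod_cast congrArg (Subtype.val) (z v).inv_mul) }
  map_one' := units_adele_ext rfl fun _ => rfl
  map_mul' _ _ := units_adele_ext (one_mul _).symm fun _ => rfl

theorem finComp_unitIdele (z : ∀ v : FinPlace F, (Ov F v)ˣ) (v : FinPlace F) :
    finComp v (unitIdele z : Adele F) = ((z v : Ov F v) : Fv F v) := rfl

/-- This makes an infinite product of local units the limit of its finite partial products inside
the ideles, so that a continuous character is determined on it by its local values. -/
theorem continuous_unitIdele : Continuous (unitIdele (F := F)) := by
  have key : Continuous fun x : (∀ v : FinPlace F, Ov F v) =>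
      (RestrictedProduct.structureMap (fun v : FinPlace F => Fv F v)
        (fun v => (v.adicCompletionIntegers F : Set (Fv F v))) Filter.cofinite x) :=
    RestrictedProduct.isEmbedding_structureMap.continuous
  rw [Units.continuous_iff]
  constructor
  · refine Continuous.prodMk (X := InfiniteAdeleRing F) (Y := FiniteAdeleRing (𝓞 F) F)
      continuous_const ?_
    exact key.comp (continuous_pi fun v => Units.continuous_val.comp (continuous_apply v))
  · refine Continuous.prodMk (X := InfiniteAdeleRing F) (Y := FiniteAdeleRing (𝓞 F) F)
      continuous_const ?_
    exact key.comp (continuous_pi fun v => Units.continuous_coe_inv.comp (continuous_apply v))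

open Classical in
theorem unitIdele_mulSingle (v : FinPlace F) (y : (Ov F v)ˣ) :
    unitIdele (Pi.mulSingle v y) = localIdele v (Units.map (adicCompletionIntegers F v).subtype.toMonoidHom y) := by
  refine units_adele_ext rfl fun w => ?_
  rw [finComp_unitIdele]
  by_cases h : w = v
  · subst h
    rw [finComp_localIdele_self, Pi.mulSingle_eq_same]; rfl
  · rw [finComp_localIdele_of_ne h, Pi.mulSingle_eq_of_ne h]; rfl

open Classical in
/-- A continuous character of the ideles which is trivial on the units of each `𝒪_{F,v}` at which
`z` is not `1` is trivial at `z`: products over finitely many places are dense. -/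
theorem map_unitIdele_eq_one {ω : (Adele F)ˣ →* ℂˣ} (hω : Continuous ω)
    (z : ∀ v : FinPlace F, (Ov F v)ˣ)
    (hz : ∀ v, ω (localIdele v (Units.map (adicCompletionIntegers F v).subtype.toMonoidHom (z v))) = 1) :
    ω (unitIdele z) = 1 := by
  have ht : Filter.Tendsto (fun S : Finset (FinPlace F) => ∏ v ∈ S, Pi.mulSingle v (z v))
      Filter.atTop (nhds z) := by
    rw [tendsto_pi_nhds]
    intro v
    refine tendsto_const_nhds.congr' ?_
    filter_upwards [Filter.eventually_ge_atTop {v}] with S hS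
    rw [Finset.prod_apply, Finset.prod_eq_single v]
    · rw [Pi.mulSingle_eq_same]
    · intro w _ hw; exact Pi.mulSingle_eq_of_ne hw.symm _
    · intro h; exact absurd (hS (Finset.mem_singleton_self v)) h
  have h1 := ((hω.comp continuous_unitIdele).tendsto z).comp ht
  refine tendsto_nhds_unique h1 ?_
  refine tendsto_const_nhds.congr fun S => ?_
  change 1 = ω (unitIdele (∏ v ∈ S, Pi.mulSingle v (z v)))
  rw [map_prod, map_prod, Finset.prod_eq_one]
  intro v _
  rw [unitIdele_mulSingle, hz]

namespace Datum

variable (D : Datum F p)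

/-- The finite set of places dividing the level, prime to `p`. -/
def levelPlaces : Finset (FinPlace F) :=
  (((Ideal.finite_factors (R := 𝓞 F) D.level_ne_bot).subset
    (Set.inter_subset_left (t := {v | v ∉ placesAbove F p})))).toFinset

theorem mem_levelPlaces {v : FinPlace F} :
    v ∈ D.levelPlaces ↔ v.asIdeal ∣ D.level ∧ v ∉ placesAbove F p := by
  simp [levelPlaces]

theorem localIdeal_eq_of_not_dvd {v : FinPlace F} {I : Ideal (𝓞 F)} (hv : ¬ v.asIdeal ∣ I)
    {x : Fv F v} (hx : ‖x‖ ≤ 1) : x ∈ localIdeal I v := by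
  obtain ⟨t, ht, ht'⟩ : ∃ t ∈ I, t ∉ v.asIdeal := by
    by_contra! h
    exact hv (Ideal.dvd_iff_le.2 h)
  have h1 : ‖((t : F) : Fv F v)‖ = 1 := (norm_coe_eq_one_iff v t).2 ht'
  have h0 : ((t : F) : Fv F v) ≠ 0 := norm_ne_zero_iff.1 (by rw [h1]; exact one_ne_zero)
  have hm : x * ((t : F) : Fv F v)⁻¹ ∈ v.adicCompletionIntegers F := by
    rw [← norm_le_one_iff_mem, norm_mul, norm_inv, h1, inv_one, mul_one]; exact hx
  refine ⟨⟨_, hm⟩ * algebraMap (𝓞 F) (Ov F v) t,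
    Ideal.mul_mem_left _ _ (Ideal.mem_map_of_mem _ ht), ?_⟩
  exact inv_mul_cancel_right₀ h0 x

theorem localIdeal_norm_le_one {v : FinPlace F} {I : Ideal (𝓞 F)} {x : Fv F v}
    (hx : x ∈ localIdeal I v) : ‖x‖ ≤ 1 := by
  obtain ⟨a, _, rfl⟩ := hx
  exact norm_le_one_iff_mem.2 a.2

theorem mul_mem_localIdeal {v : FinPlace F} {I : Ideal (𝓞 F)} {x y : Fv F v}
    (hy : ‖y‖ ≤ 1) (hx : x ∈ localIdeal I v) : y * x ∈ localIdeal I v := by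
  obtain ⟨a, ha, rfl⟩ := hx
  exact ⟨⟨y, norm_le_one_iff_mem.1 hy⟩ * a, Ideal.mul_mem_left _ _ ha, rfl⟩

theorem mul_mem_localIdeal_iff {v : FinPlace F} {I : Ideal (𝓞 F)} {x y : Fv F v}
    (hy : ‖y‖ = 1) : y * x ∈ localIdeal I v ↔ x ∈ localIdeal I v := by
  refine ⟨fun h => ?_, mul_mem_localIdeal hy.le⟩
  have h0 : y ≠ 0 := norm_ne_zero_iff.1 (by rw [hy]; exact one_ne_zero)
  have := mul_mem_localIdeal (y := y⁻¹) (by rw [norm_inv, hy, inv_one]) h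
  rwa [inv_mul_cancel_left₀ h0] at this

/-- Above p this is the unramifiedness assumption. Elsewhere v does not divide the level, so the
congruence in the conductor condition is empty. -/
theorem ω_localIdele_eq_one {v : FinPlace F} (hv : v ∉ D.levelPlaces) {u : (Fv F v)ˣ}
    (hu : ‖(u : Fv F v)‖ = 1) : D.ω (localIdele v u) = 1 := by
  by_cases hp : v ∈ placesAbove F p
  · exact D.ω_unramified v hp u hu
  · refine D.ω_conductor v u hu (localIdeal_eq_of_not_dvd (fun h => hv ?_) ?_)
    · exact D.mem_levelPlaces.2 ⟨h, hp⟩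
    · rw [norm_le_one_iff_mem]
      exact sub_mem (norm_le_one_iff_mem.1 hu.le) (one_mem _)

theorem ωv_mul (v : FinPlace F) {x y : Fv F v} (hx : x ≠ 0) (hy : y ≠ 0) :
    D.ωv v (x * y) = D.ωv v x * D.ωv v y := by
  rw [ωv, ωv, ωv, dif_neg hx, dif_neg hy, dif_neg (mul_ne_zero hx hy), Units.mk0_mul,
    localIdele_mul, map_mul, Units.val_mul]

theorem ωv_ne_zero (v : FinPlace F) {x : Fv F v} (hx : x ≠ 0) : D.ωv v x ≠ 0 := by
  rw [ωv, dif_neg hx]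
  exact Units.ne_zero _

theorem ωv_one (v : FinPlace F) : D.ωv v 1 = 1 := by
  have h := D.ωv_mul v (one_ne_zero (α := Fv F v)) one_ne_zero
  rw [mul_one] at h
  exact (mul_eq_left₀ (D.ωv_ne_zero v one_ne_zero)).1 h.symm

theorem ωv_inv (v : FinPlace F) {x : Fv F v} (hx : x ≠ 0) : D.ωv v x⁻¹ = (D.ωv v x)⁻¹ := by
  refine eq_inv_of_mul_eq_one_left ?_
  rw [← D.ωv_mul v (inv_ne_zero hx) hx, inv_mul_cancel₀ hx, D.ωv_one]

theorem ωv_pow (v : FinPlace F) {x : Fv F v} (hx : x ≠ 0) (n : ℕ) :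
    D.ωv v (x ^ n) = D.ωv v x ^ n := by
  induction n with
  | zero => rw [pow_zero, pow_zero, D.ωv_one]
  | succ n ih => rw [pow_succ, D.ωv_mul v (pow_ne_zero _ hx) hx, ih, pow_succ]

/-- The product formula for `ω` at the principal idele `p`. -/
theorem prod_ωv_p :
    (∏ v ∈ D.levelPlaces, D.ωv v (p : Fv F v)) *
      ∏ v ∈ placesAbove F p, D.ωv v (p : Fv F v) = 1 := by
  classical
  have hp0 : (p : F) ≠ 0 := Nat.cast_ne_zero.2 (Fact.out : p.Prime).ne_zero
  have hdisj : Disjoint D.levelPlaces (placesAbove F p) :=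
    Finset.disjoint_left.2 fun v hv => (D.mem_levelPlaces.1 hv).2
  rw [← Finset.prod_union hdisj]
  set W := D.levelPlaces ∪ placesAbove F p
  let P : ∀ v : FinPlace F, (Fv F v)ˣ := fun v => Units.mk0 (p : Fv F v) (p_ne_zero v)
  let u : (Adele F)ˣ := Units.map (algebraMap F (Adele F)).toMonoidHom (Units.mk0 (p : F) hp0)
  have hu : ∀ v, finComp v (u : Adele F) = (p : Fv F v) := fun v =>
    map_natCast (algebraMap F (Fv F v)) p
  let π : (Adele F)ˣ := ∏ v ∈ W, localIdele v (P v)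
  have hπ : ∀ v, finComp v (π : Adele F) = if v ∈ W then (p : Fv F v) else 1 := by
    intro v
    have h1 : finComp v (π : Adele F) = ∏ w ∈ W, finComp v (localIdele w (P w) : Adele F) := by
      rw [← map_prod]; congr 1
      exact map_prod (Units.coeHom (Adele F)) _ _
    rw [h1]
    split_ifs with h
    · rw [Finset.prod_eq_single v]
      · exact finComp_localIdele_self v (P v)
      · intro w _ hw; exact finComp_localIdele_of_ne hw.symm _
      · intro h'; exact absurd h h'
    · refine Finset.prod_eq_one fun w hw => finComp_localIdele_of_ne ?_ _
      rintro rfl; exact h hw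
  have hW : ∀ v ∉ W, ‖(p : Fv F v)‖ = 1 := fun v hv =>
    norm_p_eq_one fun h => hv (Finset.mem_union_right _ h)
  let z : ∀ v : FinPlace F, (Ov F v)ˣ := fun v =>
    if h : v ∈ W then 1 else
      IsUnit.unit (a := (⟨p, norm_le_one_iff_mem.1 (hW v h).le⟩ : Ov F v))
        ((adicCompletionIntegers.isUnit_iff_valued_eq_one).2
          (norm_eq_one_iff_valued.1 (hW v h)))
  have hz : ∀ v, ((z v : Ov F v) : Fv F v) = if v ∈ W then 1 else (p : Fv F v) := by
    intro v
    by_cases h : v ∈ W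
    · simp only [z, dif_pos h, if_pos h]; rfl
    · simp only [z, dif_neg h, if_neg h]; rfl
  have h1 : D.ω (unitIdele z) = 1 := by
    refine map_unitIdele_eq_one D.ω_continuous z fun v => ?_
    by_cases h : v ∈ W
    · have : z v = 1 := by simp only [z, dif_pos h]
      have h2 : localIdele v 1 = 1 := units_adele_ext rfl fun w => by
        by_cases hw : w = v
        · subst hw; rw [finComp_localIdele_self]; rfl
        · rw [finComp_localIdele_of_ne hw]; rfl
      rw [this, map_one, h2, map_one]
    · refine D.ω_localIdele_eq_one (fun h' => h (Finset.mem_union_left _ h')) ?_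
      change ‖((z v : Ov F v) : Fv F v)‖ = 1
      rw [hz, if_neg h]
      exact hW v h
  -- The principal idele p equals π times the unit idele z up to an idele with trivial finite part.
  -- Since ω kills principal ideles, z and archimedean ideles, it kills π, the part of p at the
  -- level and above p.
  have h2 : D.ω (u * (π * unitIdele z)⁻¹) = 1 := by
    refine D.ω_infinite _ (FiniteAdeleRing.ext F fun v => ?_)
    change finComp v ((u * (π * unitIdele z)⁻¹ : (Adele F)ˣ) : Adele F) = 1
    have h3 : finComp v ((π * unitIdele z : (Adele F)ˣ) : Adele F) = (p : Fv F v) := by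
      rw [Units.val_mul, map_mul, hπ, finComp_unitIdele, hz]
      split_ifs <;> simp
    have h4 : finComp v ((u * (π * unitIdele z)⁻¹ : (Adele F)ˣ) : Adele F) *
        finComp v ((π * unitIdele z : (Adele F)ˣ) : Adele F) =
        finComp v (u : Adele F) := by
      rw [← map_mul, ← Units.val_mul, inv_mul_cancel_right]
    rw [h3, hu] at h4
    exact (mul_eq_right₀ (p_ne_zero v)).1 h4
  have h3 : D.ω π = 1 := by
    have hu1 : D.ω u = 1 := D.ω_principal _
    rw [map_mul, map_inv, map_mul, h1, mul_one, hu1, one_mul] at h2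
    exact inv_eq_one.1 h2
  have h4 : ∀ v, D.ωv v (p : Fv F v) = (D.ω (localIdele v (P v)) : ℂ) := fun v => by
    rw [ωv, dif_neg (p_ne_zero v)]
  rw [Finset.prod_congr rfl fun v _ => h4 v]
  have h5 := congrArg (Units.coeHom ℂ) h3
  rw [map_prod, map_prod, map_one] at h5
  exact h5

open Classical in
/-- Scaling by `p` of the local Schwartz functions at the places prime to `p`. -/
theorem ΦFin_p_smul (r r' : ℕ) {v : FinPlace F} (hv : v ∉ placesAbove F p) (a b : Fv F v) :
    D.ΦFin r' v a b = (if v ∈ D.levelPlaces then (D.ωv v (p : Fv F v))⁻¹ else 1) *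
      D.ΦFin r v ((p : Fv F v)⁻¹ * a) ((p : Fv F v)⁻¹ * b) := by
  have h1 : ‖(p : Fv F v)⁻¹‖ = 1 := by rw [norm_inv, norm_p_eq_one hv, inv_one]
  have h2 : ∀ c : Fv F v, ‖(p : Fv F v)⁻¹ * c‖ = ‖c‖ := fun c => by rw [norm_mul, h1, one_mul]
  rw [ΦFin, ΦFin, if_neg hv, if_neg hv]
  simp only [h2, mul_mem_localIdeal_iff h1, mem_levelPlaces, hv, not_false_eq_true, and_true]
  by_cases hl : v.asIdeal ∣ D.level
  · simp only [if_pos hl]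
    split_ifs with h
    · have hb : b ≠ 0 := norm_ne_zero_iff.1 (by rw [h.2]; exact one_ne_zero)
      rw [D.ωv_mul v (inv_ne_zero (p_ne_zero v)) hb, D.ωv_inv v (p_ne_zero v), mul_inv, inv_inv,
        inv_mul_cancel_left₀ (D.ωv_ne_zero v (p_ne_zero v))]
    · rw [mul_zero]
  · simp only [if_neg hl, one_mul]

end Datum

end HeckeCharacter

open MeasureTheory

/-! ### Archimedean zeta integrals, determinants and idele norms. -/

section Archimedean

variable {F : Type*} [Field F] [NumberField F] {p : ℕ} [Fact p.Prime]

theorem prod_norm_mul_finprod_norm_coe [IsTotallyReal F] {x : F} (hx : x ≠ 0) :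
    (∏ σ : InfinitePlace F, σ x) * ∏ᶠ v : FinPlace F, ‖(x : Fv F v)‖ = 1 := by
  have h := InfinitePlace.prod_eq_abs_norm x
  simp only [IsTotallyReal.mult_eq, pow_one] at h
  rw [finprod_norm_coe hx, h, ← Rat.cast_abs, mul_inv_cancel₀]
  exact_mod_cast abs_ne_zero.2 (Algebra.norm_ne_zero_iff.2 hx)

theorem finite_norm_finComp_ne_one {d : Adele F} (hd : IsUnit d) :
    {v : FinPlace F | ‖finComp v d‖ ≠ 1}.Finite := by
  have h : IsUnit (M := InfiniteAdeleRing F × FiniteAdeleRing (𝓞 F) F) d := hd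
  have h2 := FiniteAdeleRing.isUnit_iff.1 (Prod.isUnit_iff.1 h).2
  refine (Filter.eventually_cofinite.1 h2.2).subset fun v hv h' => hv ?_
  exact norm_eq_one_iff_valued.2 h'

theorem finNorm_eq (d : Adele F) : finNorm d.2 = ∏ᶠ v, ‖finComp v d‖ := rfl

theorem finNorm_mul {d d' : Adele F} (hd : IsUnit d) (hd' : IsUnit d') :
    finNorm (d * d').2 = finNorm d.2 * finNorm d'.2 := by
  rw [finNorm_eq, finNorm_eq, finNorm_eq, ← finprod_mul_distrib]
  · simp only [map_mul, norm_mul]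
  · exact finite_norm_finComp_ne_one hd
  · exact finite_norm_finComp_ne_one hd'

theorem finNorm_pos {d : Adele F} (hd : IsUnit d) : 0 < finNorm d.2 := by
  rw [finNorm_eq]
  refine finprod_induction (fun x : ℝ => 0 < x) one_pos (fun _ _ h h' => mul_pos h h') fun v => ?_
  exact norm_pos_iff.2 (hd.map (finComp v)).ne_zero

namespace Datum

variable (D : Datum F p)

/-- The archimedean zeta integral at the row vector `(x, y)`. -/
def archInt (σ : InfinitePlace F) (s : ℂ) (x y : ℝ) : ℂ :=
  ∫ t : ℝ, D.ΦInf σ (t * x) (t * y) * (D.φ₁Inf t * (D.φ₂Inf t)⁻¹) *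
    ((|t| : ℝ) : ℂ) ^ (2 * s + 1) * ((|t| : ℝ) : ℂ)⁻¹

/-- The exponents add up: (1/2 - a) + (2h + a + 1/2) + (2s + 1) - 1 = 2h + 1 + 2s. The point t = 0,
where powers cannot be combined, is a null set. -/
theorem archInt_eq (σ : InfinitePlace F) (s : ℂ) (x y : ℝ) :
    D.archInt σ s x y = ∫ t : ℝ, D.ΦInf σ (t * x) (t * y) *
      ((|t| : ℝ) : ℂ) ^ (2 * (D.h : ℂ) + 1 + 2 * s) := by
  refine integral_congr_ae ?_
  have : ∀ᵐ t : ℝ, t ≠ 0 := by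
    rw [ae_iff]; simp
  filter_upwards [this] with t ht
  have ht' : ((|t| : ℝ) : ℂ) ≠ 0 := by exact_mod_cast abs_ne_zero.2 ht
  rw [mul_assoc, mul_assoc, φ₁Inf, φ₂Inf, ← Complex.cpow_neg, ← Complex.cpow_add _ _ ht']
  congr 1
  rw [← Complex.cpow_neg_one, ← Complex.cpow_add _ _ ht', ← Complex.cpow_add _ _ ht']
  congr 1; ring

theorem archInt_smul (σ : InfinitePlace F) (s : ℂ) {c : ℝ} (hc : c ≠ 0) (x y : ℝ) :
    D.archInt σ s (c * x) (c * y) =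
      ((|c| : ℝ) : ℂ) ^ (-(2 * (D.h : ℂ) + 2 + 2 * s)) * D.archInt σ s x y := by
  have hc' : ((|c| : ℝ) : ℂ) ≠ 0 := by exact_mod_cast abs_ne_zero.2 hc
  rw [archInt_eq, archInt_eq]
  set e : ℂ := 2 * (D.h : ℂ) + 1 + 2 * s
  -- Substitution u = ct. The constant |c|^{-e} is kept inside the integrand so that the substituted
  -- integrand is exactly the required one; the Jacobian contributes the remaining |c|⁻¹.
  have h := Measure.integral_comp_mul_left (fun u : ℝ => D.ΦInf σ (u * x) (u * y) *
      (((|u| : ℝ) : ℂ) ^ e * ((|c| : ℝ) : ℂ) ^ (-e))) c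
  have h1 : ∀ t : ℝ, D.ΦInf σ (c * t * x) (c * t * y) *
      (((|c * t| : ℝ) : ℂ) ^ e * ((|c| : ℝ) : ℂ) ^ (-e)) =
      D.ΦInf σ (t * (c * x)) (t * (c * y)) * ((|t| : ℝ) : ℂ) ^ e := by
    intro t
    rw [abs_mul, Complex.ofReal_mul, Complex.mul_cpow_ofReal_nonneg (abs_nonneg _) (abs_nonneg _),
      Complex.cpow_neg, mul_comm (((|c| : ℝ) : ℂ) ^ e), mul_inv_cancel_right₀]
    · congr 2 <;> ring
    · rw [Complex.cpow_ne_zero_iff]; exact Or.inl hc'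
  simp only [h1] at h
  rw [h]
  simp only [← mul_assoc]
  rw [integral_mul_const, Complex.real_smul, mul_comm (∫ _, _) _, ← mul_assoc]
  congr 1
  rw [abs_inv, Complex.ofReal_inv, ← Complex.cpow_neg_one, ← Complex.cpow_add _ _ hc']
  congr 1
  simp only [e]; ring

theorem norm_ΦInf (σ : InfinitePlace F) (x y : ℝ) :
    ‖D.ΦInf σ x y‖ = 2⁻¹ ^ D.k σ * √(x ^ 2 + y ^ 2) ^ D.k σ *
      Real.exp (-(Real.pi * √(x ^ 2 + y ^ 2) ^ 2)) := by
  have h : ‖(x : ℂ) + Complex.I * y‖ = √(x ^ 2 + y ^ 2) := by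
    rw [mul_comm, Complex.norm_add_mul_I]
  rw [ΦInf, norm_mul, norm_mul, norm_pow, norm_pow, h, Complex.norm_exp,
    Real.sq_sqrt (by positivity), Complex.neg_re, Complex.ofReal_re, norm_inv, Complex.norm_ofNat]

/-- The absolute value of Φ_σ depends only on the Euclidean length ρ of the row, so scaling t by ρ
reduces to one integral that does not depend on the row. -/
theorem exists_norm_archInt_le (σ : InfinitePlace F) (s : ℂ) :
    ∃ K : ℝ, 0 ≤ K ∧ ∀ x y : ℝ, 0 < x ^ 2 + y ^ 2 →
      ‖D.archInt σ s x y‖ ≤ K * √(x ^ 2 + y ^ 2) ^ (-(2 * (D.h : ℝ) + 2 + 2 * s.re)) := by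
  set e : ℝ := 2 * (D.h : ℝ) + 1 + 2 * s.re with he
  let Ψ : ℝ → ℝ := fun u => 2⁻¹ ^ D.k σ * |u| ^ D.k σ * Real.exp (-(Real.pi * |u| ^ 2)) * |u| ^ e
  have hΨ : ∀ u, 0 ≤ Ψ u := fun u => by positivity
  -- Integrability of Ψ need not be checked: the norm inequality and the change of variables hold
  -- with the convention that a divergent integral is 0.
  refine ⟨∫ u, Ψ u, integral_nonneg hΨ, fun x y hxy => ?_⟩
  set ρ := √(x ^ 2 + y ^ 2) with hρ
  have hρ0 : 0 < ρ := Real.sqrt_pos.2 hxy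
  rw [archInt_eq]
  refine (norm_integral_le_integral_norm _).trans (le_of_eq ?_)
  have h1 : (fun t : ℝ => ‖D.ΦInf σ (t * x) (t * y) *
      ((|t| : ℝ) : ℂ) ^ (2 * (D.h : ℂ) + 1 + 2 * s)‖) =ᵐ[volume]
      fun t => Ψ (ρ * t) * ρ ^ (-e) := by
    have : ∀ᵐ t : ℝ, t ≠ 0 := by
      rw [ae_iff]; simp
    filter_upwards [this] with t ht
    have ht' : 0 < |t| := abs_pos.2 ht
    have h2 : √((t * x) ^ 2 + (t * y) ^ 2) = |ρ * t| := by
      rw [abs_mul, abs_of_pos hρ0, hρ, show (t * x) ^ 2 + (t * y) ^ 2 = (x ^ 2 + y ^ 2) * t ^ 2 by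
        ring, Real.sqrt_mul hxy.le, Real.sqrt_sq_eq_abs]
    have h3 : ‖((|t| : ℝ) : ℂ) ^ (2 * (D.h : ℂ) + 1 + 2 * s)‖ = |t| ^ e := by
      rw [Complex.norm_cpow_eq_rpow_re_of_pos ht']
      congr 1
      simp [he]
    rw [norm_mul, norm_ΦInf, h2, h3]
    simp only [Ψ]
    rw [abs_mul ρ t, abs_of_pos hρ0, Real.mul_rpow hρ0.le ht'.le, Real.rpow_neg hρ0.le]
    have : ρ ^ e ≠ 0 := (Real.rpow_pos_of_pos hρ0 e).ne'
    field_simp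
  rw [integral_congr_ae h1, integral_mul_const, Measure.integral_comp_mul_left Ψ ρ, abs_inv,
    abs_of_pos hρ0, smul_eq_mul, mul_comm ρ⁻¹, mul_assoc]
  congr 1
  rw [← Real.rpow_neg_one, ← Real.rpow_add hρ0]
  congr 1
  rw [he]; ring

/-- The finite part `Φ_fin^{(r)}` of the Schwartz function. -/
def ΦFinProd (r : ℕ) (a b : Adele F) : ℂ := ∏ᶠ v : FinPlace F, D.ΦFin r v (finComp v a) (finComp v b)

end Datum

variable [IsTotallyReal F]

/-- The component at an infinite place, as a ring homomorphism. -/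
def infHom (σ : InfinitePlace F) : Adele F →+* ℝ where
  toFun := infComp σ
  map_one' := map_one (InfinitePlace.Completion.extensionEmbeddingOfIsReal
    (IsTotallyReal.isReal σ))
  map_mul' a b := map_mul (InfinitePlace.Completion.extensionEmbeddingOfIsReal
    (IsTotallyReal.isReal σ)) (a.1 σ) (b.1 σ)
  map_zero' := map_zero (InfinitePlace.Completion.extensionEmbeddingOfIsReal
    (IsTotallyReal.isReal σ))
  map_add' a b := map_add (InfinitePlace.Completion.extensionEmbeddingOfIsReal
    (IsTotallyReal.isReal σ)) (a.1 σ) (b.1 σ)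

theorem abs_infHom_algebraMap (σ : InfinitePlace F) (x : F) :
    |infHom σ (algebraMap F (Adele F) x)| = σ x := by
  change |InfinitePlace.Completion.extensionEmbeddingOfIsReal
    (IsTotallyReal.isReal σ) (x : σ.Completion)| = σ x
  rw [InfinitePlace.Completion.extensionEmbeddingOfIsReal_coe, ← Real.norm_eq_abs,
    InfinitePlace.norm_embedding_of_isReal]
  rfl

/-- The idele norm. -/
def ideleNorm (d : Adele F) : ℝ := (∏ σ : InfinitePlace F, |infHom σ d|) * finNorm d.2

theorem ideleNorm_mul {d d' : Adele F} (hd : IsUnit d) (hd' : IsUnit d') :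
    ideleNorm (d * d') = ideleNorm d * ideleNorm d' := by
  rw [ideleNorm, ideleNorm, ideleNorm, finNorm_mul hd hd']
  simp only [map_mul, abs_mul, Finset.prod_mul_distrib]
  ring

theorem ideleNorm_algebraMap {x : F} (hx : x ≠ 0) :
    ideleNorm (algebraMap F (Adele F) x) = 1 := by
  rw [ideleNorm]
  simp only [abs_infHom_algebraMap]
  exact prod_norm_mul_finprod_norm_coe hx

namespace Datum

variable (D : Datum F p)

/-- The factor of `D.term r s g` which depends only on the determinant `d` of `g`. -/
def detFactor (s : ℂ) (d : Adele F) : ℂ :=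
  (∏ σ : InfinitePlace F, D.φ₁Inf (infHom σ d) * ((|infHom σ d| : ℝ) : ℂ) ^ (s + 1 / 2)) *
    D.φ₁Fin d.2 * (finNorm d.2 : ℂ) ^ (s + 1 / 2)

/-- The local powers of |d| assemble into one power of the idele norm. Hence multiplication by
`GL₂(F)`, by the product formula, and by the translating matrices leaves this factor unchanged. -/
theorem detFactor_eq (s : ℂ) {d : Adele F} (hd : IsUnit d) :
    D.detFactor s d = (ideleNorm d : ℂ) ^ (s + 1 - (D.a : ℂ)) := by
  have h1 : ∀ t : ℝ, t ≠ 0 → D.φ₁Inf t * ((|t| : ℝ) : ℂ) ^ (s + 1 / 2) =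
      ((|t| : ℝ) : ℂ) ^ (s + 1 - (D.a : ℂ)) := by
    intro t ht
    rw [φ₁Inf, ← Complex.cpow_add _ _ (by exact_mod_cast abs_ne_zero.2 ht)]
    congr 1; ring
  have h2 := finNorm_pos hd
  rw [detFactor, Finset.prod_congr rfl fun σ _ => h1 _ (hd.map (infHom σ)).ne_zero, φ₁Fin,
    mul_assoc, ← Complex.cpow_add _ _ (by exact_mod_cast h2.ne'), ideleNorm, Complex.ofReal_mul,
    Complex.mul_cpow_ofReal_nonneg (Finset.prod_nonneg fun _ _ => abs_nonneg _) h2.le]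
  congr 1
  · rw [Complex.ofReal_prod]
    induction (Finset.univ : Finset (InfinitePlace F)) using Finset.cons_induction with
    | empty => simp
    | cons σ S hσ ih =>
      rw [Finset.prod_cons, Finset.prod_cons, ih, ← Complex.ofReal_prod,
        Complex.mul_cpow_ofReal_nonneg (abs_nonneg _) (Finset.prod_nonneg fun _ _ => abs_nonneg _)]
  · congr 1; ring

theorem detFactor_mul (s : ℂ) {d d' : Adele F} (hd : IsUnit d) (hd' : IsUnit d')
    (h : ideleNorm d = 1) : D.detFactor s (d * d') = D.detFactor s d' := by
  rw [D.detFactor_eq s (hd.mul hd'), D.detFactor_eq s hd', ideleNorm_mul hd hd', h, one_mul]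

theorem term_eq (r : ℕ) (s : ℂ) (g : GL (Fin 2) (Adele F)) :
    D.term r s g = D.detFactor s (g : Matrix (Fin 2) (Fin 2) (Adele F)).det *
      (∏ σ, D.archInt σ s (infHom σ (g 1 0)) (infHom σ (g 1 1))) *
      D.ΦFinProd r (g 1 0) (g 1 1) := by
  have hdet : ∀ σ, (Matrix.of fun i j => infComp σ (g i j)).det =
      infHom σ (g : Matrix (Fin 2) (Fin 2) (Adele F)).det := by
    intro σ
    rw [RingHom.map_det]; rfl
  have h1 : ∏ σ : InfinitePlace F,
      realSection D.φ₁Inf D.φ₂Inf (D.ΦInf σ) s (Matrix.of fun i j => infComp σ (g i j)) =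
      (∏ σ, D.φ₁Inf (infHom σ (g : Matrix (Fin 2) (Fin 2) (Adele F)).det) *
        ((|infHom σ (g : Matrix (Fin 2) (Fin 2) (Adele F)).det| : ℝ) : ℂ) ^ (s + 1 / 2)) *
      ∏ σ, D.archInt σ s (infHom σ (g 1 0)) (infHom σ (g 1 1)) := by
    rw [← Finset.prod_mul_distrib]
    refine Finset.prod_congr rfl fun σ _ => ?_
    rw [realSection, hdet]; rfl
  rw [term, h1, detFactor, ΦFinProd]
  simp only [finComp_apply]
  ring

end Datum

end Archimedean

/-! ### The finite Schwartz function under translation, scaling by p, and congruence units. -/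

section Translation

variable {F : Type*} [Field F] [NumberField F] {p : ℕ} [Fact p.Prime]

theorem finite_one_lt_norm_finComp (a : Adele F) : {v : FinPlace F | ¬ ‖finComp v a‖ ≤ 1}.Finite :=
  (Filter.eventually_cofinite.1 a.2.2).subset fun _ hv h => hv (norm_le_one_iff_mem.2 h)

theorem finComp_natCast (v : FinPlace F) (n : ℕ) : finComp v (n : Adele F) = n :=
  map_natCast (finComp v) n

namespace Datum

variable (D : Datum F p)

open Classical in
/-- The places at which `Φ_v^{(r)}` may differ from the characteristic function of `𝒪_{F,v}²`. -/
def badPlaces : Finset (FinPlace F) := placesAbove F p ∪ D.levelPlaces ∪ {D.v₀}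

theorem ΦFin_eq_one (r : ℕ) {v : FinPlace F} (hv : v ∉ D.badPlaces) {a b : Fv F v}
    (ha : ‖a‖ ≤ 1) (hb : ‖b‖ ≤ 1) : D.ΦFin r v a b = 1 := by
  simp only [badPlaces, Finset.mem_union, Finset.mem_singleton, not_or] at hv
  have hl : ¬ v.asIdeal ∣ D.level := fun h => hv.1.2 (D.mem_levelPlaces.2 ⟨h, hv.1.1⟩)
  rw [ΦFin, if_neg hv.1.1, if_neg hl, if_neg fun h => hv.2 h.2, if_pos ⟨ha, hb⟩]

theorem norm_le_one_of_ΦFin_ne_zero {r : ℕ} {v : FinPlace F} {a b : Fv F v}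
    (h : D.ΦFin r v a b ≠ 0) : ‖a‖ ≤ 1 ∧ ‖b‖ ≤ 1 := by
  by_contra h'
  refine h ?_
  rw [ΦFin]
  by_cases h1 : v ∈ placesAbove F p
  · rw [if_pos h1, if_neg h']
  by_cases h2 : v.asIdeal ∣ D.level
  · rw [if_neg h1, if_pos h2, if_neg fun h3 => h' ⟨localIdeal_norm_le_one h3.1, h3.2.le⟩]
  by_cases h3 : D.UsesAux ∧ v = D.v₀
  · rw [if_neg h1, if_neg h2, if_pos h3, if_neg fun h4 => h' ⟨h4.1.le, h4.2⟩]
  · rw [if_neg h1, if_neg h2, if_neg h3, if_neg h']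

theorem ΦFinProd_eq_prod (r : ℕ) {a b : Adele F} {T : Finset (FinPlace F)} (hT : D.badPlaces ⊆ T)
    (ha : ∀ v ∉ T, ‖finComp v a‖ ≤ 1) (hb : ∀ v ∉ T, ‖finComp v b‖ ≤ 1) :
    D.ΦFinProd r a b = ∏ v ∈ T, D.ΦFin r v (finComp v a) (finComp v b) := by
  refine finprod_eq_prod_of_mulSupport_subset _ fun v hv => ?_
  by_contra h
  exact hv (D.ΦFin_eq_one r (fun h' => h (hT h')) (ha v h) (hb v h))

theorem exists_finset_norm_le_one (a b : Adele F) : ∃ T : Finset (FinPlace F),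
    D.badPlaces ⊆ T ∧ (∀ v ∉ T, ‖finComp v a‖ ≤ 1) ∧ ∀ v ∉ T, ‖finComp v b‖ ≤ 1 := by
  classical
  refine ⟨D.badPlaces ∪ ((finite_one_lt_norm_finComp a).toFinset ∪
    (finite_one_lt_norm_finComp b).toFinset), Finset.subset_union_left, fun v hv => ?_,
    fun v hv => ?_⟩ <;> simp only [Finset.mem_union, Set.Finite.mem_toFinset, not_or,
      Set.mem_ofPred_eq, not_not] at hv
  · exact hv.2.1
  · exact hv.2.2

theorem placesAbove_subset_badPlaces : placesAbove F p ⊆ D.badPlaces := by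
  classical
  exact Finset.subset_union_left.trans Finset.subset_union_left

theorem levelPlaces_subset_badPlaces : D.levelPlaces ⊆ D.badPlaces := by
  classical
  exact Finset.subset_union_right.trans Finset.subset_union_left

/-- The places above p give the orthogonality average. At all other places the translation is
trivial and division of the row by p produces only the factors ω_v(p)⁻¹ at the level. -/
theorem sum_ΦFinProd_translate
    (hunram : ∀ v ∈ placesAbove F p, ¬ v.asIdeal ^ 2 ∣ Ideal.span {(p : 𝓞 F)})
    {r : ℕ} (hr : 1 ≤ r) (R : Finset (Op F p))
    (hR : Function.Bijective fun x : R => Ideal.Quotient.mk (Ideal.span {(p : Op F p)}) x.1)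
    (a b a' b' : Adele F) (ha : (p : Adele F) * a' = a) (hb : (p : Adele F) * b' = b) :
    ∑ x ∈ R, ∑ y ∈ R, D.ΦFinProd (r + 1)
      (a * (1 + extendOp x * (p : Adele F) ^ r) + b * (extendOp y * (p : Adele F) ^ r)) b =
    (R.card : ℂ) ^ 2 * (∏ v ∈ D.levelPlaces, (D.ωv v (p : Fv F v))⁻¹) * D.ΦFinProd r a' b' := by
  classical
  obtain ⟨T, hT, hTa, hTb⟩ := D.exists_finset_norm_le_one a b
  have hS := D.placesAbove_subset_badPlaces.trans hT
  have hcomp : ∀ (x y : Op F p) (v : FinPlace F), finComp v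
      (a * (1 + extendOp x * (p : Adele F) ^ r) + b * (extendOp y * (p : Adele F) ^ r)) =
      finComp v a * (1 + (extendOp x).2 v * (p : Fv F v) ^ r) +
        finComp v b * ((extendOp y).2 v * (p : Fv F v) ^ r) := by
    intro x y v
    simp only [map_add, map_mul, map_one, map_pow, finComp_natCast]
    rfl
  have hcomp' : ∀ (x y : Op F p) (v : FinPlace F), v ∉ placesAbove F p → finComp v
      (a * (1 + extendOp x * (p : Adele F) ^ r) + b * (extendOp y * (p : Adele F) ^ r)) =
      finComp v a := by
    intro x y v hv
    rw [hcomp, extendOp_snd_apply_of_notMem x hv, extendOp_snd_apply_of_notMem y hv]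
    ring
  have ha' : ∀ v, finComp v a' = (p : Fv F v)⁻¹ * finComp v a := fun v => by
    rw [← ha, map_mul, finComp_natCast, inv_mul_cancel_left₀ (p_ne_zero v)]
  have hb' : ∀ v, finComp v b' = (p : Fv F v)⁻¹ * finComp v b := fun v => by
    rw [← hb, map_mul, finComp_natCast, inv_mul_cancel_left₀ (p_ne_zero v)]
  have hnorm : ∀ v ∉ T, ∀ c : Fv F v, ‖(p : Fv F v)⁻¹ * c‖ = ‖c‖ := fun v hv c => by
    rw [norm_mul, norm_inv, norm_p_eq_one fun h => hv (hS h), inv_one, one_mul]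
  -- One finite set T serves for all x and y at once, since the row changes only above p and these
  -- places lie in T.
  have hL : ∀ x y : Op F p, D.ΦFinProd (r + 1)
      (a * (1 + extendOp x * (p : Adele F) ^ r) + b * (extendOp y * (p : Adele F) ^ r)) b =
      (∏ v ∈ T \ placesAbove F p, D.ΦFin (r + 1) v (finComp v a) (finComp v b)) *
      ∏ v ∈ placesAbove F p, D.ΦFin (r + 1) v
        (finComp v a * (1 + (extendOp x).2 v * (p : Fv F v) ^ r) +
        finComp v b * ((extendOp y).2 v * (p : Fv F v) ^ r)) (finComp v b) := by
    intro x y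
    rw [D.ΦFinProd_eq_prod (r + 1) hT (fun v hv => by
      rw [hcomp' x y v fun h => hv (hS h)]; exact hTa v hv) hTb, ← Finset.prod_sdiff hS]
    congr 1
    refine Finset.prod_congr rfl fun v hv => ?_
    rw [hcomp' x y v (Finset.mem_sdiff.1 hv).2]
  rw [Finset.sum_congr rfl fun x _ => Finset.sum_congr rfl fun y _ => hL x y]
  simp only [← Finset.mul_sum]
  rw [sum_prod_ΦFin_translate D hunram hr R hR, D.ΦFinProd_eq_prod r hT
    (fun v hv => by rw [ha', hnorm v hv]; exact hTa v hv)
    (fun v hv => by rw [hb', hnorm v hv]; exact hTb v hv), ← Finset.prod_sdiff hS]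
  simp only [ha', hb']
  rw [Finset.prod_congr (s₁ := T \ placesAbove F p) rfl fun v hv =>
    D.ΦFin_p_smul r (r + 1) (Finset.mem_sdiff.1 hv).2 (finComp v a) (finComp v b),
    Finset.prod_mul_distrib]
  have hlev : ∏ v ∈ T \ placesAbove F p,
      (if v ∈ D.levelPlaces then (D.ωv v (p : Fv F v))⁻¹ else 1) =
      ∏ v ∈ D.levelPlaces, (D.ωv v (p : Fv F v))⁻¹ := by
    rw [Finset.prod_ite_mem, Finset.inter_eq_right.2]
    intro v hv
    exact Finset.mem_sdiff.2 ⟨hT (D.levelPlaces_subset_badPlaces hv), (D.mem_levelPlaces.1 hv).2⟩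
  rw [hlev]
  ring

/-- Above p, ψ_v(ua/p^r) and ψ_v(a/p^r) agree because p^r divides u - 1; at the level, ω_v(u) = 1 by
the conductor condition; elsewhere only norms matter. -/
theorem ΦFin_smul {r : ℕ} {v : FinPlace F} {u : Fv F v} (hu : ‖u‖ = 1)
    (hp : v ∈ placesAbove F p → ‖u - 1‖ ≤ ‖(p : Fv F v) ^ r‖)
    (hl : u - 1 ∈ localIdeal D.level v) (a b : Fv F v) :
    D.ΦFin r v (u * a) (u * b) = D.ΦFin r v a b := by
  have hu0 : u ≠ 0 := norm_ne_zero_iff.1 (by rw [hu]; exact one_ne_zero)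
  have hnorm : ∀ c : Fv F v, ‖u * c‖ = ‖c‖ := fun c => by rw [norm_mul, hu, one_mul]
  rw [ΦFin, ΦFin]
  by_cases hv : v ∈ placesAbove F p
  · rw [if_pos hv, if_pos hv]
    by_cases h : ‖a‖ ≤ 1 ∧ ‖b‖ ≤ 1
    · rw [if_pos h, if_pos (by rwa [hnorm, hnorm])]
      refine psi_eq_of_sub_mem v ?_
      rw [← sub_div, ← sub_one_mul, ← norm_le_one_iff_mem, norm_div, norm_mul,
        div_le_one (norm_pos_iff.2 (pow_ne_zero r (p_ne_zero v)))]
      exact (mul_le_of_le_one_right (norm_nonneg _) h.1).trans (hp hv)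
    · rw [if_neg h, if_neg (by rwa [hnorm, hnorm])]
  · rw [if_neg hv, if_neg hv]
    by_cases hd : v.asIdeal ∣ D.level
    · rw [if_pos hd, if_pos hd]
      by_cases h : a ∈ localIdeal D.level v ∧ ‖b‖ = 1
      · rw [if_pos h, if_pos (by rwa [hnorm, mul_mem_localIdeal_iff hu])]
        have hb : b ≠ 0 := norm_ne_zero_iff.1 (by rw [h.2]; exact one_ne_zero)
        have h2 : D.ωv v u = 1 := by
          rw [ωv, dif_neg hu0, D.ω_conductor v (Units.mk0 u hu0) hu hl, Units.val_one]
        rw [D.ωv_mul v hu0 hb, h2, one_mul]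
      · rw [if_neg h, if_neg (by rwa [hnorm, mul_mem_localIdeal_iff hu])]
    · rw [if_neg hd, if_neg hd, hnorm, hnorm]

/-- Invariance of `Φ_fin^{(r)}` under units congruent to `1` modulo `p^r 𝔫`. -/
theorem ΦFin_unit_smul {r : ℕ} {ε : (𝓞 F)ˣ} (hε : ε ∈ D.units r) (v : FinPlace F)
    (a b : Fv F v) :
    D.ΦFin r v (algebraMap F (Fv F v) (algebraMap (𝓞 F) F ε) * a)
      (algebraMap F (Fv F v) (algebraMap (𝓞 F) F ε) * b) = D.ΦFin r v a b := by
  have hmem : (ε : 𝓞 F) - 1 ∈ Ideal.span {(p : 𝓞 F)} ^ r * D.level := by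
    rw [← Ideal.Quotient.eq]
    have := congrArg Units.val ((MonoidHom.mem_ker).1 hε)
    simpa using this
  have h1 := Ideal.mul_le_left (I := Ideal.span {(p : 𝓞 F)} ^ r) (J := D.level) hmem
  have h2 := Ideal.mul_le_right (I := Ideal.span {(p : 𝓞 F)} ^ r) (J := D.level) hmem
  have hsub : algebraMap F (Fv F v) (algebraMap (𝓞 F) F ε) - 1 =
      algebraMap F (Fv F v) (algebraMap (𝓞 F) F (ε - 1)) := by
    rw [map_sub (algebraMap (𝓞 F) F), map_one, map_sub, map_one]
  refine D.ΦFin_smul ?_ (fun _ => ?_) ?_ a b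
  · refine (norm_coe_eq_one_iff v _).2 fun h => ?_
    exact v.isPrime.ne_top (Ideal.eq_top_of_isUnit_mem _ h ε.isUnit)
  · rw [Ideal.span_singleton_pow] at h1
    obtain ⟨c, hc⟩ := Ideal.mem_span_singleton.1 h1
    rw [hsub, hc, map_mul (algebraMap (𝓞 F) F), map_mul, norm_mul, map_pow, map_natCast, map_pow,
      map_natCast]
    exact mul_le_of_le_one_right (norm_nonneg _) (norm_coe_le_one v c)
  · rw [hsub]
    exact ⟨algebraMap (𝓞 F) (Ov F v) ((ε : 𝓞 F) - 1),
      Ideal.mem_map_of_mem _ h2, rfl⟩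

theorem ΦFinProd_unit_smul {r : ℕ} {ε : (𝓞 F)ˣ} (hε : ε ∈ D.units r) (a b : Adele F) :
    D.ΦFinProd r (algebraMap F (Adele F) (algebraMap (𝓞 F) F ε) * a)
      (algebraMap F (Adele F) (algebraMap (𝓞 F) F ε) * b) = D.ΦFinProd r a b :=
  finprod_congr fun v => by
    rw [map_mul, map_mul]
    exact D.ΦFin_unit_smul hε v _ _

end Datum

end Translation

/-! ### The distribution relation for a single term and the constant c_r. -/

section Term

variable {F : Type*} [Field F] [NumberField F] {p : ℕ} [Fact p.Prime] 

theorem prod_ofReal_cpow {ι : Type*} (S : Finset ι) (f : ι → ℝ) (hf : ∀ i, 0 ≤ f i) (w : ℂ) :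
    ∏ i ∈ S, (f i : ℂ) ^ w = ((∏ i ∈ S, f i : ℝ) : ℂ) ^ w := by
  induction S using Finset.cons_induction with
  | empty => simp
  | cons i S hi ih =>
    rw [Finset.prod_cons, Finset.prod_cons, ih, Complex.ofReal_mul,
      Complex.mul_cpow_ofReal_nonneg (hf i) (Finset.prod_nonneg fun i _ => hf i)]

theorem glEmb_mul_one_apply (δ : GL (Fin 2) F) (g : GL (Fin 2) (Adele F)) (j : Fin 2) :
    (glEmb F δ * g) 1 j = algebraMap F (Adele F) (δ 1 0) * g 0 j +
      algebraMap F (Adele F) (δ 1 1) * g 1 j := by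
  rw [Units.val_mul, Matrix.mul_apply, Fin.sum_univ_two]
  rfl

theorem scalarEmb_mul_apply (x : Fˣ) (g : GL (Fin 2) (Adele F)) (j : Fin 2) :
    (scalarEmb F x * g) 1 j = algebraMap F (Adele F) x * g 1 j := by
  have h := glEmb_mul_one_apply (Matrix.GeneralLinearGroup.scalar (Fin 2) x) g j
  rw [scalarEmb, MonoidHom.comp_apply, h]
  simp

variable [IsTotallyReal F]

theorem ideleNorm_one_add_extendOp {r : ℕ} (hr : 1 ≤ r) (x : Op F p) :
    ideleNorm (1 + extendOp x * (p : Adele F) ^ r) = 1 := by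
  have h1 : ∀ σ : InfinitePlace F, |infHom σ (1 + extendOp x * (p : Adele F) ^ r)| = 1 := by
    intro σ
    have : infHom σ (extendOp x) = 0 := map_zero (InfinitePlace.Completion.extensionEmbeddingOfIsReal
      (IsTotallyReal.isReal σ))
    rw [map_add, map_mul, this, zero_mul, add_zero, map_one, abs_one]
  rw [ideleNorm, Finset.prod_congr rfl fun σ _ => h1 σ, Finset.prod_const_one, one_mul, finNorm_eq]
  refine finprod_eq_one_of_forall_eq_one fun v => ?_
  rw [map_add, map_mul, map_one, map_pow, finComp_natCast]
  exact norm_one_add_extendOp hr x v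

theorem infHom_extendOp (σ : InfinitePlace F) (x : Op F p) : infHom σ (extendOp x) = 0 :=
  map_zero (InfinitePlace.Completion.extensionEmbeddingOfIsReal (IsTotallyReal.isReal σ))

namespace Datum

variable (D : Datum F p)

theorem prod_archInt_smul (s : ℂ) {c : F} (hc : c ≠ 0) (a b : Adele F) :
    ∏ σ, D.archInt σ s (infHom σ (algebraMap F (Adele F) c * a))
      (infHom σ (algebraMap F (Adele F) c * b)) =
    ((∏ σ : InfinitePlace F, σ c : ℝ) : ℂ) ^ (-(2 * (D.h : ℂ) + 2 + 2 * s)) *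
      ∏ σ, D.archInt σ s (infHom σ a) (infHom σ b) := by
  rw [← prod_ofReal_cpow _ _ fun σ => apply_nonneg σ c, ← Finset.prod_mul_distrib]
  refine Finset.prod_congr rfl fun σ _ => ?_
  have h0 : infHom σ (algebraMap F (Adele F) c) ≠ 0 := by
    rw [← abs_pos, abs_infHom_algebraMap]
    exact InfinitePlace.pos_iff.2 hc
  rw [map_mul, map_mul, D.archInt_smul σ s h0, abs_infHom_algebraMap]

theorem detFactor_glEmb_mul (s : ℂ) (δ : GL (Fin 2) F) (g : GL (Fin 2) (Adele F)) :
    D.detFactor s ((glEmb F δ * g : GL (Fin 2) (Adele F)) : Matrix (Fin 2) (Fin 2) (Adele F)).det =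
      D.detFactor s (g : Matrix (Fin 2) (Fin 2) (Adele F)).det := by
  have h1 : ((glEmb F δ : GL (Fin 2) (Adele F)) : Matrix (Fin 2) (Fin 2) (Adele F)).det =
      algebraMap F (Adele F) (δ : Matrix (Fin 2) (Fin 2) F).det := by
    rw [RingHom.map_det]; rfl
  have h2 : IsUnit (δ : Matrix (Fin 2) (Fin 2) F).det :=
    (Matrix.isUnit_iff_isUnit_det _).1 δ.isUnit
  rw [Units.val_mul, Matrix.det_mul, h1]
  exact D.detFactor_mul s (h2.map _) ((Matrix.isUnit_iff_isUnit_det _).1 g.isUnit)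
    (ideleNorm_algebraMap h2.ne_zero)

theorem term_scalarEmb_mul (r : ℕ) (s : ℂ) (x : Fˣ) (g : GL (Fin 2) (Adele F)) :
    D.term r s (scalarEmb F x * g) = D.detFactor s (g : Matrix (Fin 2) (Fin 2) (Adele F)).det *
      (((∏ σ : InfinitePlace F, σ (x : F) : ℝ) : ℂ) ^ (-(2 * (D.h : ℂ) + 2 + 2 * s)) *
        ∏ σ, D.archInt σ s (infHom σ (g 1 0)) (infHom σ (g 1 1))) *
      D.ΦFinProd r (algebraMap F (Adele F) x * g 1 0) (algebraMap F (Adele F) x * g 1 1) := by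
  have h : D.detFactor s ((scalarEmb F x * g : GL (Fin 2) (Adele F)) :
      Matrix (Fin 2) (Fin 2) (Adele F)).det =
      D.detFactor s (g : Matrix (Fin 2) (Fin 2) (Adele F)).det :=
    D.detFactor_glEmb_mul s (Matrix.GeneralLinearGroup.scalar (Fin 2) x) g
  rw [term_eq, scalarEmb_mul_apply, scalarEmb_mul_apply, D.prod_archInt_smul s x.ne_zero, h]

/-- The homogeneity factor at infinity is a power of |N(ε)| = 1, and the finite part is invariant by
the congruence. -/
theorem term_unit_mul (r : ℕ) (s : ℂ) {ε : Fˣ} (hε : ε ∈ D.unitsF r)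
    (g : GL (Fin 2) (Adele F)) : D.term r s (scalarEmb F ε * g) = D.term r s g := by
  obtain ⟨ε, hε, rfl⟩ := hε
  have h1 : ∏ σ : InfinitePlace F, σ (algebraMap (𝓞 F) F ε) = 1 := by
    have h := prod_norm_mul_finprod_norm_coe (x := algebraMap (𝓞 F) F ε) (by simp)
    rwa [finprod_eq_one_of_forall_eq_one, mul_one] at h
    intro v
    exact (norm_coe_eq_one_iff v _).2 fun h =>
      v.isPrime.ne_top (Ideal.eq_top_of_isUnit_mem _ h ε.isUnit)
  have h2 : ((Units.map (algebraMap (𝓞 F) F).toMonoidHom ε : Fˣ) : F) = algebraMap (𝓞 F) F ε := rfl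
  rw [term_scalarEmb_mul, term_eq, h2, h1, D.ΦFinProd_unit_smul hε, Complex.ofReal_one,
    Complex.one_cpow, one_mul]

theorem translation_apply_one_zero (g : GL (Fin 2) (Adele F)) {r : ℕ} (hr : 1 ≤ r) (x y : Op F p) :
    (g * translation r hr x y) 1 0 = g 1 0 * (1 + extendOp x * (p : Adele F) ^ r) +
      g 1 1 * (extendOp y * (p : Adele F) ^ r) := by
  rw [Units.val_mul, Matrix.mul_apply, Fin.sum_univ_two]
  rfl

theorem translation_apply_one_one (g : GL (Fin 2) (Adele F)) {r : ℕ} (hr : 1 ≤ r) (x y : Op F p) :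
    (g * translation r hr x y) 1 1 = g 1 1 := by
  rw [Units.val_mul, Matrix.mul_apply, Fin.sum_univ_two]
  change g 1 0 * 0 + g 1 1 * 1 = g 1 1
  rw [mul_zero, zero_add, mul_one]

theorem detFactor_translation (s : ℂ) (g : GL (Fin 2) (Adele F)) {r : ℕ} (hr : 1 ≤ r)
    (x y : Op F p) :
    D.detFactor s ((g * translation r hr x y : GL (Fin 2) (Adele F)) : Matrix (Fin 2) (Fin 2) (Adele F)).det =
      D.detFactor s (g : Matrix (Fin 2) (Fin 2) (Adele F)).det := by
  have h1 : ((translation r hr x y : GL (Fin 2) (Adele F)) : Matrix (Fin 2) (Fin 2) (Adele F)).det =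
      1 + extendOp x * (p : Adele F) ^ r := by
    change (!![1 + extendOp x * (p : Adele F) ^ r, 0; extendOp y * (p : Adele F) ^ r, 1]).det = _
    rw [Matrix.det_fin_two_of, mul_one, zero_mul, sub_zero]
  rw [Units.val_mul, Matrix.det_mul, h1, mul_comm]
  exact D.detFactor_mul s (isUnit_one_add r hr x) ((Matrix.isUnit_iff_isUnit_det _).1 g.isUnit)
    (ideleNorm_one_add_extendOp hr x)

variable (p) in
/-- `p` as an element of `Fˣ`. -/
def _root_.DistEis.pUnit (F : Type*) [Field F] [NumberField F] : Fˣ :=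
  Units.mk0 (p : F) (Nat.cast_ne_zero.2 (Fact.out : p.Prime).ne_zero)

theorem prod_infinitePlace_p : ∏ σ : InfinitePlace F, σ (p : F) =
    ((p ^ Module.finrank ℚ F : ℕ) : ℝ) := by
  have h := InfinitePlace.prod_eq_abs_norm (p : F)
  simp only [IsTotallyReal.mult_eq, pow_one] at h
  have hn : Algebra.norm ℚ (p : F) = (p : ℚ) ^ Module.finrank ℚ F := by
    have := Algebra.norm_algebraMap (S := F) (p : ℚ)
    simpa using this
  rw [h, hn, abs_of_nonneg (by positivity)]
  push_cast
  rfl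

/-- This is the relation before summation. The average produces the finite function of level r at
the row divided by p; rewriting the archimedean part at that row by homogeneity makes it the term at
p⁻¹g. -/
theorem sum_term_translation
    (hunram : ∀ v ∈ placesAbove F p, ¬ v.asIdeal ^ 2 ∣ Ideal.span {(p : 𝓞 F)})
    {r : ℕ} (hr : 1 ≤ r) (R : Finset (Op F p))
    (hR : Function.Bijective fun x : R => Ideal.Quotient.mk (Ideal.span {(p : Op F p)}) x.1)
    (s : ℂ) (g : GL (Fin 2) (Adele F)) :
    ∑ x ∈ R, ∑ y ∈ R, D.term (r + 1) s (g * translation r hr x y) =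
      ((R.card : ℂ) ^ 2 * (∏ v ∈ D.levelPlaces, (D.ωv v (p : Fv F v))⁻¹) *
        ((p ^ Module.finrank ℚ F : ℕ) : ℂ) ^ (-(2 * (D.h : ℂ) + 2 + 2 * s))) *
      D.term r s (scalarEmb F (pUnit p F)⁻¹ * g) := by
  have hterm : ∀ x y : Op F p, D.term (r + 1) s (g * translation r hr x y) =
      D.detFactor s (g : Matrix (Fin 2) (Fin 2) (Adele F)).det *
      (∏ σ, D.archInt σ s (infHom σ (g 1 0)) (infHom σ (g 1 1))) *
      D.ΦFinProd (r + 1) (g 1 0 * (1 + extendOp x * (p : Adele F) ^ r) +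
        g 1 1 * (extendOp y * (p : Adele F) ^ r)) (g 1 1) := by
    intro x y
    rw [term_eq, detFactor_translation, translation_apply_one_zero, translation_apply_one_one]
    congr 2
    refine Finset.prod_congr rfl fun σ _ => ?_
    congr 1
    simp only [map_add, map_mul, infHom_extendOp, map_one]
    ring
  have hp0 : (p : F) ≠ 0 := (pUnit p F).ne_zero
  have hcancel : ∀ a : Adele F, (p : Adele F) *
      (algebraMap F (Adele F) ((pUnit p F)⁻¹ : Fˣ) * a) = a := by
    intro a
    have h1 : (p : Adele F) = algebraMap F (Adele F) (pUnit p F : Fˣ) :=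
      (map_natCast (algebraMap F (Adele F)) p).symm
    rw [h1, ← mul_assoc, ← map_mul, Units.mul_inv, map_one, one_mul]
  simp only [hterm, ← Finset.mul_sum]
  rw [D.sum_ΦFinProd_translate hunram hr R hR _ _ _ _ (hcancel _) (hcancel _),
    term_scalarEmb_mul]
  have h2 : ∏ σ : InfinitePlace F, σ (((pUnit p F)⁻¹ : Fˣ) : F) =
      ((p ^ Module.finrank ℚ F : ℕ) : ℝ)⁻¹ := by
    rw [← prod_infinitePlace_p, ← Finset.prod_inv_distrib]
    refine Finset.prod_congr rfl fun σ _ => ?_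
    rw [Units.val_inv_eq_inv_val, map_inv₀]; rfl
  set N : ℕ := p ^ Module.finrank ℚ F with hN
  have hN0 : (N : ℂ) ≠ 0 := by
    rw [hN]; exact_mod_cast (pow_ne_zero _ (Fact.out : p.Prime).ne_zero)
  -- Homogeneity at p⁻¹ introduces this power of N⁻¹ = p^{-d}; the power of N in the asserted
  -- constant compensates for it.
  have h3 : (((N : ℝ)⁻¹ : ℝ) : ℂ) ^ (-(2 * (D.h : ℂ) + 2 + 2 * s)) *
      (N : ℂ) ^ (-(2 * (D.h : ℂ) + 2 + 2 * s)) = 1 := by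
    rw [← Complex.ofReal_natCast N, ← Complex.mul_cpow_ofReal_nonneg (inv_nonneg.2 (Nat.cast_nonneg N)) (Nat.cast_nonneg N),
      ← Complex.ofReal_mul, inv_mul_cancel₀ (by exact_mod_cast hN0), Complex.ofReal_one,
      Complex.one_cpow]
  rw [h2]
  linear_combination (-(R.card : ℂ) ^ 2 * (∏ v ∈ D.levelPlaces, (D.ωv v (p : Fv F v))⁻¹) *
    D.detFactor s (g : Matrix (Fin 2) (Fin 2) (Adele F)).det *
      (∏ σ, D.archInt σ s (infHom σ (g 1 0)) (infHom σ (g 1 1))) *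
      D.ΦFinProd r (algebraMap F (Adele F) ((pUnit p F)⁻¹ : Fˣ) * g 1 0)
        (algebraMap F (Adele F) ((pUnit p F)⁻¹ : Fˣ) * g 1 1)) * h3

theorem ωp_inv_pow_eq (r : ℕ) :
    D.ωp_inv_pow r = ((∏ v ∈ placesAbove F p, D.ωv v (p : Fv F v)) ^ r)⁻¹ := by
  rw [ωp_inv_pow, ← Finset.prod_pow, ← Finset.prod_inv_distrib]
  refine Finset.prod_congr rfl fun v _ => ?_
  rw [D.ωv_inv v (pow_ne_zero r (p_ne_zero v)), D.ωv_pow v (p_ne_zero v)]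

/-- By the product formula the level factors ∏ ω_v(p)⁻¹ equal ω_p(p), which cancels the extra
ω_p(p⁻¹) in c_{r+1}. With N = p^d = ∏ q_v, the powers cancel as 2(s + h) + 2 - (2h + 2 + 2s) = 0. -/
theorem c_succ_mul
    (hunram : ∀ v ∈ placesAbove F p, ¬ v.asIdeal ^ 2 ∣ Ideal.span {(p : 𝓞 F)})
    (r : ℕ) (s : ℂ) :
    D.c (r + 1) s * ((((p ^ Module.finrank ℚ F : ℕ) : ℂ)) ^ 2 *
      (∏ v ∈ D.levelPlaces, (D.ωv v (p : Fv F v))⁻¹) *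
        ((p ^ Module.finrank ℚ F : ℕ) : ℂ) ^ (-(2 * (D.h : ℂ) + 2 + 2 * s))) = D.c r s := by
  have hq : ∏ v ∈ placesAbove F p, (qv v : ℂ) ^ (2 * (s + (D.h : ℂ)) * ((r + 1 : ℕ) : ℂ)) =
      (∏ v ∈ placesAbove F p, (qv v : ℂ) ^ (2 * (s + (D.h : ℂ)) * (r : ℂ))) *
        ((p ^ Module.finrank ℚ F : ℕ) : ℂ) ^ (2 * (s + (D.h : ℂ))) := by
    have h1 := prod_ofReal_cpow (placesAbove F p) (fun v => (qv v : ℝ))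
      (fun v => Nat.cast_nonneg _) (2 * (s + (D.h : ℂ)))
    rw [← Nat.cast_prod, prod_qv hunram, Complex.ofReal_natCast] at h1
    rw [← h1, ← Finset.prod_mul_distrib]
    refine Finset.prod_congr rfl fun v _ => ?_
    have : (qv v : ℂ) ≠ 0 := by
      have := HeightOneSpectrum.absNorm_ne_zero v
      exact_mod_cast this
    rw [Complex.ofReal_natCast, ← Complex.cpow_add _ _ this]
    congr 1
    push_cast; ring
  set N : ℕ := p ^ Module.finrank ℚ F with hN
  have hN0 : (N : ℂ) ≠ 0 := by
    rw [hN]; exact_mod_cast (pow_ne_zero _ (Fact.out : p.Prime).ne_zero)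
  have h2 : (N : ℂ) ^ (2 * (s + (D.h : ℂ))) * ((N : ℂ) ^ 2 *
      (N : ℂ) ^ (-(2 * (D.h : ℂ) + 2 + 2 * s))) = 1 := by
    rw [← Complex.cpow_two, ← Complex.cpow_add _ _ hN0, ← Complex.cpow_add _ _ hN0,
      show 2 * (s + (D.h : ℂ)) + (2 + -(2 * (D.h : ℂ) + 2 + 2 * s)) = 0 by ring, Complex.cpow_zero]
  have h3 := D.prod_ωv_p
  set P := ∏ v ∈ placesAbove F p, D.ωv v (p : Fv F v) with hP
  have hP0 : P ≠ 0 := right_ne_zero_of_mul_eq_one h3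
  have h4 : (∏ v ∈ D.levelPlaces, (D.ωv v (p : Fv F v))⁻¹) = P := by
    rw [Finset.prod_inv_distrib]
    exact inv_eq_of_mul_eq_one_right h3
  rw [c, c, hq, h4, ωp_inv_pow_eq, ωp_inv_pow_eq, ← hP, pow_succ, mul_inv]
  have h5 : P⁻¹ * P = 1 := inv_mul_cancel₀ hP0
  set Q := ∏ v ∈ placesAbove F p, (qv v : ℂ) ^ (2 * (s + (D.h : ℂ)) * (r : ℂ))
  linear_combination (P ^ r)⁻¹ * Q * (P⁻¹ * P) * h2 + (P ^ r)⁻¹ * Q * h5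

end Datum

end Term

/-! ### Sums over quotients of a commutative group. -/

section QuotientSum

variable {A : Type*} [CommGroup A]

theorem apply_out_mk {B : Type*} {H : Subgroup A} {f : A → B} (hf : ∀ h ∈ H, ∀ a, f (h * a) = f a)
    (a : A) : f (a : A ⧸ H).out = f a := by
  obtain ⟨h, hh⟩ := QuotientGroup.mk_out_eq_mul H a
  rw [hh, mul_comm, hf _ h.2]

theorem tsum_quotient_mul_left {H : Subgroup A} {f : A → ℂ} (hf : ∀ h ∈ H, ∀ a, f (h * a) = f a)
    (b : A) : ∑' q : A ⧸ H, f (b * q.out) = ∑' q : A ⧸ H, f q.out := by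
  rw [← (Equiv.mulLeft (b : A ⧸ H)).tsum_eq fun q : A ⧸ H => f q.out]
  refine tsum_congr fun q => ?_
  have h : Equiv.mulLeft (b : A ⧸ H) q = ((b * q.out : A) : A ⧸ H) := by
    rw [Equiv.coe_mulLeft, QuotientGroup.mk_mul, QuotientGroup.out_eq']
  rw [h, apply_out_mk hf]

/-- The fibres of A/H' → A/H all have [H : H'] elements and f is constant on them. -/
theorem tsum_quotient_of_le {H' H : Subgroup A} (hle : H' ≤ H) (hfin : H'.relIndex H ≠ 0)
    {f : A → ℂ} (hf : ∀ h ∈ H, ∀ a, f (h * a) = f a)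
    (hs : Summable fun q : A ⧸ H => ‖f q.out‖) :
    ∑' q : A ⧸ H', f q.out = H'.relIndex H * ∑' q : A ⧸ H, f q.out := by
  have hfi : (H'.subgroupOf H).FiniteIndex := ⟨hfin⟩
  have : Fintype (H ⧸ H'.subgroupOf H) := Fintype.ofFinite _
  have h1 : ∀ q : A ⧸ H', f q.out = f (Subgroup.quotientEquivProdOfLE hle q).1.out * 1 := by
    intro q
    have h2 : (Subgroup.quotientEquivProdOfLE hle q).1 = ((q.out : A) : A ⧸ H) := by
      conv_lhs => rw [← QuotientGroup.out_eq' q]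
      rfl
    rw [h2, apply_out_mk hf, mul_one]
  rw [tsum_congr h1, (Subgroup.quotientEquivProdOfLE hle).tsum_eq
    fun q : (A ⧸ H) × (H ⧸ H'.subgroupOf H) => f q.1.out * (1 : ℂ),
    ← tsum_mul_tsum_of_summable_norm (f := fun q : A ⧸ H => f q.out)
      (g := fun _ : H ⧸ H'.subgroupOf H => (1 : ℂ)) hs (Summable.of_finite), mul_comm]
  congr 1
  rw [tsum_fintype, Finset.sum_const, nsmul_eq_mul, mul_one, Finset.card_univ,
    ← Nat.card_eq_fintype_card]
  rfl

end QuotientSum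

/-! ### Congruence units and the normalising index. -/

section Units

variable {F : Type*} [Field F] [NumberField F] {p : ℕ} [Fact p.Prime]

theorem finiteIndex_congruenceUnits {I : Ideal (𝓞 F)} (hI : I ≠ ⊥) :
    (congruenceUnits I).FiniteIndex := by
  have : Finite (𝓞 F ⧸ I) := Ideal.finiteQuotientOfFreeOfNeBot I hI
  exact Subgroup.finiteIndex_ker _

theorem mem_congruenceUnits {I : Ideal (𝓞 F)} {u : (𝓞 F)ˣ} :
    u ∈ congruenceUnits I ↔ (u : 𝓞 F) - 1 ∈ I := by
  rw [congruenceUnits, MonoidHom.mem_ker, Units.ext_iff, ← Ideal.Quotient.eq_zero_iff_mem, map_sub,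
    map_one, sub_eq_zero]
  rfl

theorem one_mem_span_natCast_of_odd {A : Type*} [CommRing A] {n : ℕ} (hn : Odd n)
    (h : (-1 - 1 : A) ∈ Ideal.span {(n : A)}) : (1 : A) ∈ Ideal.span {(n : A)} := by
  obtain ⟨k, rfl⟩ := hn
  have h2 : (1 : A) = ((2 * k + 1 : ℕ) : A) + (k : A) * (-1 - 1) := by push_cast; ring
  exact h2.symm ▸ add_mem (Ideal.mem_span_singleton_self _) (Ideal.mul_mem_left _ _ h)

variable (F p) in
theorem span_p_ne_top : Ideal.span {(p : 𝓞 F)} ≠ ⊤ := by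
  rw [ne_eq, ← Ideal.absNorm_eq_one_iff, Ideal.absNorm_span_singleton]
  have h := Algebra.norm_algebraMap (S := 𝓞 F) (p : ℤ)
  rw [algebraMap_int_eq, eq_intCast, Int.cast_natCast] at h
  rw [h, Int.natAbs_pow, Int.natAbs_natCast]
  exact (one_lt_pow₀ (Fact.out : p.Prime).one_lt Module.finrank_pos.ne').ne'

namespace Datum

variable (D : Datum F p)

theorem finiteIndex_units (r : ℕ) : (D.units r).FiniteIndex := by
  refine finiteIndex_congruenceUnits (mul_ne_zero (pow_ne_zero r ?_) D.level_ne_bot)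
  simpa [Ideal.span_singleton_eq_bot] using (Fact.out : p.Prime).ne_zero

theorem units_succ_le (r : ℕ) : D.units (r + 1) ≤ D.units r := by
  intro u hu
  rw [units, mem_congruenceUnits] at hu ⊢
  exact Ideal.mul_mono_left (Ideal.pow_le_pow_right r.le_succ) hu

theorem neg_one_notMem_units (hp : p ≠ 2) {r : ℕ} (hr : 1 ≤ r) : (-1 : (𝓞 F)ˣ) ∉ D.units r := by
  intro h
  have h0 := mem_congruenceUnits.1 h
  rw [Units.val_neg, Units.val_one] at h0
  have hle : Ideal.span {(p : 𝓞 F)} ^ r * D.level ≤ Ideal.span {(p : 𝓞 F)} :=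
    Ideal.mul_le_left.trans (Ideal.pow_le_self (Nat.one_le_iff_ne_zero.1 hr))
  have h1 : (-1 - 1 : 𝓞 F) ∈ Ideal.span {(p : 𝓞 F)} := hle h0
  exact span_p_ne_top F p ((Ideal.eq_top_iff_one _).2
    (one_mem_span_natCast_of_odd ((Fact.out : p.Prime).odd_of_ne_two hp) h1))

/-- For odd p and r ≥ 1 the group {±1} meets the congruence units trivially, so adjoining -1 exactly
halves the index. -/
theorem two_mul_unitIndex (hp : p ≠ 2) {r : ℕ} (hr : 1 ≤ r) :
    2 * D.unitIndex r = (D.units r).index := by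
  rw [← Subgroup.relIndex_mul_index (le_sup_left : D.units r ≤ D.units r ⊔ Subgroup.zpowers (-1)),
    unitIndex]
  congr 1
  have h2 : orderOf (-1 : (𝓞 F)ˣ) = 2 := by
    rw [← orderOf_units, Units.val_neg, Units.val_one, orderOf_neg_one, if_neg]
    rw [ringChar.eq_zero]; norm_num
  have hbot : D.units r ⊓ Subgroup.zpowers (-1) = ⊥ := by
    rw [eq_bot_iff]
    rintro u ⟨hu, ⟨k, rfl⟩⟩
    rcases Int.even_or_odd k with hk | hk
    · simp [hk.neg_one_zpow]
    · simp only [hk.neg_one_zpow] at hu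
      exact absurd hu (D.neg_one_notMem_units hp hr)
  rw [Subgroup.relIndex_sup_left, ← Subgroup.inf_relIndex_right, hbot, Subgroup.relIndex_bot_left,
    Nat.card_zpowers, h2]

theorem unitsF_succ_le (r : ℕ) : D.unitsF (r + 1) ≤ D.unitsF r :=
  Subgroup.map_mono (D.units_succ_le r)

theorem relIndex_unitsF (r : ℕ) :
    (D.unitsF (r + 1)).relIndex (D.unitsF r) = (D.units (r + 1)).relIndex (D.units r) :=
  Subgroup.relIndex_map_map_of_injective _ _
    (Units.map_injective (FaithfulSMul.algebraMap_injective (𝓞 F) F))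

theorem relIndex_unitsF_ne_zero (r : ℕ) : (D.unitsF (r + 1)).relIndex (D.unitsF r) ≠ 0 := by
  have := D.finiteIndex_units (r + 1)
  rw [relIndex_unitsF]
  exact mt Subgroup.index_eq_zero_of_relIndex_eq_zero this.index_ne_zero

/-- The normalisation grows by the very factor by which the sum over `Fˣ` modulo units grows. -/
theorem unitIndex_succ (hp : p ≠ 2) {r : ℕ} (hr : 1 ≤ r) :
    D.unitIndex (r + 1) = (D.unitsF (r + 1)).relIndex (D.unitsF r) * D.unitIndex r := by
  have h1 := D.two_mul_unitIndex hp hr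
  have h2 := D.two_mul_unitIndex hp (r := r + 1) (by omega)
  rw [← Subgroup.relIndex_mul_index (D.units_succ_le r), ← h1, ← relIndex_unitsF] at h2
  linarith

end Datum

end Units

/-! ### Balancing archimedean sizes by units. -/

section UnitReduction

variable {F : Type*} [Field F] [NumberField F]

open scoped Classical in
theorem normAtPlace_le_norm (x : mixedEmbedding.mixedSpace F) (σ : InfinitePlace F) :
    mixedEmbedding.normAtPlace σ x ≤ ‖x‖ := by
  rw [mixedEmbedding.norm_eq_sup'_normAtPlace]
  exact Finset.le_sup' (fun w => mixedEmbedding.normAtPlace w x) (Finset.mem_univ σ)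

variable [IsTotallyReal F]

open scoped Classical in
-- Dirichlet's unit theorem in the form that the part of norm at most 1 of the fundamental cone is
-- bounded: a positive vector is scaled to norm 1 and moved into the cone by a unit. As F is totally
-- real, the real vector m is a point of the mixed space.
theorem exists_unit_mul_pow_le : ∃ B : ℝ, 0 < B ∧ ∀ m : InfinitePlace F → ℝ, (∀ σ, 0 < m σ) →
    ∃ u : (𝓞 F)ˣ, ∀ σ : InfinitePlace F,
      (σ (algebraMap (𝓞 F) F u) * m σ) ^ Module.finrank ℚ F ≤ B * ∏ τ, m τ := by
  obtain ⟨B₀, hB₀, hB⟩ :=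
    (mixedEmbedding.fundamentalCone.isBounded_normLeOne F).exists_pos_norm_le
  refine ⟨B₀ ^ Module.finrank ℚ F, by positivity, fun m hm => ?_⟩
  let x : mixedEmbedding.mixedSpace F := (fun w => m w.1, 0)
  have hx : ∀ σ, mixedEmbedding.normAtPlace σ x = m σ := fun σ => by
    rw [mixedEmbedding.normAtPlace_apply_of_isReal (IsTotallyReal.isReal σ)]
    exact abs_of_pos (hm σ)
  have hP : 0 < ∏ τ, m τ := Finset.prod_pos fun τ _ => hm τ
  have hnorm : mixedEmbedding.norm x = ∏ τ, m τ := by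
    rw [mixedEmbedding.norm_apply]
    exact Finset.prod_congr rfl fun σ _ => by rw [hx, IsTotallyReal.mult_eq, pow_one]
  obtain ⟨u, hu⟩ := mixedEmbedding.fundamentalCone.exists_unit_smul_mem (x := x)
    (by rw [hnorm]; exact hP.ne')
  refine ⟨u, fun σ => ?_⟩
  have hd : Module.finrank ℚ F ≠ 0 := Module.finrank_pos.ne'
  -- Scaling all d coordinates by c multiplies the norm by c^d, so this c makes the norm 1.
  set c : ℝ := ((∏ τ, m τ)⁻¹) ^ ((Module.finrank ℚ F : ℝ)⁻¹) with hc
  have hc0 : 0 < c := Real.rpow_pos_of_pos (inv_pos.2 hP) _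
  have hcd : c ^ Module.finrank ℚ F = (∏ τ, m τ)⁻¹ :=
    Real.rpow_inv_natCast_pow (inv_pos.2 hP).le hd
  have hmem : c • u • x ∈ mixedEmbedding.fundamentalCone.normLeOne F := by
    refine ⟨mixedEmbedding.fundamentalCone.smul_mem_of_mem hu hc0.ne', ?_⟩
    rw [Set.mem_ofPred_eq, mixedEmbedding.norm_smul, mixedEmbedding.norm_unit_smul, hnorm,
      abs_of_pos hc0, hcd, inv_mul_cancel₀ hP.ne']
  have h := (normAtPlace_le_norm _ σ).trans (hB _ hmem)
  rw [mixedEmbedding.normAtPlace_smul, mixedEmbedding.unitSMul_smul, map_mul,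
    mixedEmbedding.normAtPlace_apply, hx, abs_of_pos hc0] at h
  have h2 := pow_le_pow_left₀ (by have := hm σ; positivity) h (Module.finrank ℚ F)
  rwa [mul_pow, hcd, inv_mul_le_iff₀ hP, mul_comm (∏ τ, m τ)] at h2

theorem exists_mem_mul_pow_le (U : Subgroup (𝓞 F)ˣ) [U.FiniteIndex] :
    ∃ B : ℝ, 0 < B ∧ ∀ m : InfinitePlace F → ℝ, (∀ σ, 0 < m σ) →
    ∃ u ∈ U, ∀ σ : InfinitePlace F,
      (σ (algebraMap (𝓞 F) F u) * m σ) ^ Module.finrank ℚ F ≤ B * ∏ τ, m τ := by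
  obtain ⟨B, hB0, hB⟩ := exists_unit_mul_pow_le (F := F)
  have hfin : Finite ((𝓞 F)ˣ ⧸ U) := inferInstance
  obtain ⟨K, hK⟩ := (Set.finite_range fun q : ((𝓞 F)ˣ ⧸ U) × InfinitePlace F =>
    q.2 (algebraMap (𝓞 F) F ((q.1.out⁻¹ : (𝓞 F)ˣ) : 𝓞 F))).bddAbove
  have hK' : ∀ q (σ : InfinitePlace F), σ (algebraMap (𝓞 F) F (((q : (𝓞 F)ˣ ⧸ U).out⁻¹ : (𝓞 F)ˣ) : 𝓞 F)) ≤ K :=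
    fun q σ => hK ⟨(q, σ), rfl⟩
  have hK0 : 0 < K := by
    obtain ⟨σ⟩ := (inferInstance : Nonempty (InfinitePlace F))
    exact lt_of_lt_of_le (InfinitePlace.pos_iff.2 (by simp)) (hK' (1 : (𝓞 F)ˣ) σ)
  refine ⟨K ^ Module.finrank ℚ F * B, by positivity, fun m hm => ?_⟩
  obtain ⟨u, hu⟩ := hB m hm
  -- The balancing unit u is corrected by its coset representative to land in U. There are finitely
  -- many representatives, so this costs only the bounded factor K.
  obtain ⟨h, hh⟩ := QuotientGroup.mk_out_eq_mul U u
  refine ⟨(h : (𝓞 F)ˣ)⁻¹, inv_mem h.2, fun σ => ?_⟩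
  have h1 : (h : (𝓞 F)ˣ)⁻¹ = ((u : (𝓞 F)ˣ ⧸ U).out)⁻¹ * u := by rw [hh]; group
  rw [h1, Units.val_mul, map_mul, map_mul, mul_assoc, mul_pow, mul_assoc]
  exact mul_le_mul (pow_le_pow_left₀ (apply_nonneg σ _) (hK' _ σ) _) (hu σ)
    (pow_nonneg (mul_nonneg (apply_nonneg σ _) (hm σ).le) _) (by positivity)

end UnitReduction

/-! ### Sums of powers of heights over the ring of integers. -/

section LatticeSum

variable {F : Type*} [Field F] [NumberField F]

open scoped Classical in
/-- The largest archimedean absolute value of an algebraic integer, or `1` if that is smaller. -/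
def height (x : 𝓞 F) : ℝ := max 1 ‖mixedEmbedding F (x : F)‖

theorem one_le_height (x : 𝓞 F) : 1 ≤ height x := le_max_left _ _

open scoped Classical in
theorem summable_height_rpow {e : ℝ}
    (he : Module.finrank ℤ (mixedEmbedding.integerLattice F) < e) :
    Summable fun x : 𝓞 F => height x ^ (-e) := by
  have h1 := ZLattice.summable_norm_rpow (mixedEmbedding.integerLattice F) (-e) (neg_lt_neg he)
  let j : 𝓞 F → mixedEmbedding.integerLattice F := fun x =>
    ⟨mixedEmbedding F (x : F), ⟨x, rfl⟩⟩
  have hj : Function.Injective j := fun x y h => by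
    have := mixedEmbedding_injective F (congrArg Subtype.val h)
    exact RingOfIntegers.ext this
  have h2 : Summable fun x : 𝓞 F => ‖j x‖ ^ (-e) := h1.comp_injective hj
  refine Summable.of_norm_bounded_eventually h2 ?_
  -- The comparison can fail only at 0, where the height is 1 while the power of the zero norm is 0
  -- by convention.
  refine (Set.finite_singleton (0 : 𝓞 F)).subset fun x hx => ?_
  by_contra hx0
  refine hx ?_
  have hpos : 0 < ‖j x‖ := by
    rw [norm_pos_iff]
    intro h
    have h' : mixedEmbedding F (x : F) = 0 := congrArg Subtype.val h
    exact hx0 (by simpa using h')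
  have h0 : 0 < height x := one_pos.trans_le (one_le_height x)
  rw [Set.mem_ofPred_eq, Real.norm_of_nonneg (Real.rpow_nonneg h0.le _)]
  exact Real.rpow_le_rpow_of_nonpos hpos (le_max_right _ _)
    (neg_nonpos.2 ((Nat.cast_nonneg _).trans he.le))

open scoped Classical in
theorem height_le {x : 𝓞 F} {M : ℝ} (h1 : 1 ≤ M) (h : ∀ σ : InfinitePlace F, σ (x : F) ≤ M) :
    height x ≤ M := by
  refine max_le h1 ?_
  rw [mixedEmbedding.norm_eq_sup'_normAtPlace]
  exact Finset.sup'_le _ _ fun σ _ => by rw [mixedEmbedding.normAtPlace_apply]; exact h σ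

/-- The product of the archimedean absolute values is the norm of a nonzero integer, hence at least
1. -/
theorem exists_one_le_apply [IsTotallyReal F] {x : 𝓞 F} (hx : x ≠ 0) :
    ∃ σ : InfinitePlace F, 1 ≤ σ (x : F) := by
  by_contra! h
  have h1 := InfinitePlace.prod_eq_abs_norm (x : F)
  simp only [IsTotallyReal.mult_eq, pow_one] at h1
  have h2 : ∏ σ : InfinitePlace F, σ (x : F) < ∏ _σ : InfinitePlace F, (1 : ℝ) :=
    Finset.prod_lt_prod_of_nonempty
      (fun σ _ => InfinitePlace.pos_iff.2 (by simpa using hx)) (fun σ _ => h σ)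
      Finset.univ_nonempty
  rw [h1, Finset.prod_const_one, ← Algebra.coe_norm_int] at h2
  have h3 : |Algebra.norm ℤ x| < 1 := by exact_mod_cast h2
  exact hx (Algebra.norm_eq_zero_iff.1 (Int.abs_lt_one_iff.1 h3))

end LatticeSum

/-! ### Boundedness and support of the finite Schwartz function. -/

section Bounds

variable {F : Type*} [Field F] [NumberField F]

theorem coe_integer_mul (v : FinPlace F) (a b : 𝓞 F) : (((a * b : 𝓞 F) : F) : Fv F v) =
    ((a : F) : Fv F v) * ((b : F) : Fv F v) :=
  map_mul ((algebraMap F (Fv F v)).comp (algebraMap (𝓞 F) F)) a b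

theorem coe_integer_sub (v : FinPlace F) (a b : 𝓞 F) : (((a - b : 𝓞 F) : F) : Fv F v) =
    ((a : F) : Fv F v) - ((b : F) : Fv F v) :=
  map_sub ((algebraMap F (Fv F v)).comp (algebraMap (𝓞 F) F)) a b

theorem coe_integer_pow (v : FinPlace F) (a : 𝓞 F) (k : ℕ) : (((a ^ k : 𝓞 F) : F) : Fv F v) =
    ((a : F) : Fv F v) ^ k :=
  map_pow ((algebraMap F (Fv F v)).comp (algebraMap (𝓞 F) F)) a k

theorem exists_coe_eq_of_norm_le_one {x : F} (h : ∀ v : FinPlace F, ‖(x : Fv F v)‖ ≤ 1) :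
    ∃ a : 𝓞 F, (a : F) = x := by
  refine HeightOneSpectrum.mem_integers_of_valuation_le_one F x fun v => ?_
  rw [← HeightOneSpectrum.valuedAdicCompletion_eq_valuation']
  exact norm_le_one_iff_mem.1 (h v)

/-- Approximate x/d modulo 𝒪_{F,v} by y ∈ F integral at all other places; then dy is integral
everywhere. -/
theorem exists_integer_norm_sub_le (v : FinPlace F) {x : Fv F v} (hx : ‖x‖ ≤ 1) {d : 𝓞 F}
    (hd : d ≠ 0) : ∃ a : 𝓞 F, ‖x - ((a : F) : Fv F v)‖ ≤ ‖((d : F) : Fv F v)‖ := by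
  have hd0 : ((d : F) : Fv F v) ≠ 0 := by
    rw [coe_eq_algebraMap]; simpa using hd
  obtain ⟨y, hy, hy'⟩ := exists_integral_away v (x / ((d : F) : Fv F v))
  have hmul : ∀ w : FinPlace F, (((d : F) * y : F) : Fv F w) = ((d : F) : Fv F w) * (y : Fv F w) :=
    fun w => map_mul (algebraMap F (Fv F w)) _ _
  have hle : ‖x - (((d : F) * y : F) : Fv F v)‖ ≤ ‖((d : F) : Fv F v)‖ := by
    have h1 : x - (((d : F) * y : F) : Fv F v) =
        ((d : F) : Fv F v) * (x / ((d : F) : Fv F v) - (y : Fv F v)) := by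
      rw [hmul, mul_sub, mul_div_cancel₀ _ hd0]
    rw [h1, norm_mul]
    exact mul_le_of_le_one_right (norm_nonneg _) (norm_le_one_iff_mem.2 hy')
  obtain ⟨a, ha⟩ := exists_coe_eq_of_norm_le_one (x := (d : F) * y) fun w => by
    by_cases h : w = v
    · subst h
      have h2 := norm_le_one_iff_mem.1 (hle.trans (norm_coe_le_one w d))
      have h3 := sub_mem (norm_le_one_iff_mem.1 hx) h2
      rw [sub_sub_cancel] at h3
      exact norm_le_one_iff_mem.2 h3
    · rw [hmul, norm_mul]
      exact mul_le_one₀ (norm_coe_le_one w d) (norm_nonneg _) (norm_le_one_iff_mem.2 (hy w h))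
  exact ⟨a, by rw [ha]; exact hle⟩

theorem coe_mem_localIdeal {v : FinPlace F} {I : Ideal (𝓞 F)} {a : 𝓞 F} (ha : a ∈ I) :
    ((a : F) : Fv F v) ∈ localIdeal I v :=
  ⟨algebraMap (𝓞 F) (Ov F v) a, Ideal.mem_map_of_mem _ ha, rfl⟩

theorem add_mem_localIdeal {v : FinPlace F} {I : Ideal (𝓞 F)} {x y : Fv F v}
    (hx : x ∈ localIdeal I v) (hy : y ∈ localIdeal I v) : x + y ∈ localIdeal I v := by
  obtain ⟨a, ha, rfl⟩ := hx
  obtain ⟨b, hb, rfl⟩ := hy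
  exact ⟨a + b, Ideal.add_mem _ ha hb, rfl⟩

theorem mem_localIdeal_of_norm_le {v : FinPlace F} {I : Ideal (𝓞 F)} {d : 𝓞 F} (hd : d ≠ 0)
    (hdI : d ∈ I) {x : Fv F v} (hx : ‖x‖ ≤ ‖((d : F) : Fv F v)‖) : x ∈ localIdeal I v := by
  have hd0 : ((d : F) : Fv F v) ≠ 0 := by
    rw [coe_eq_algebraMap]; simpa using hd
  have h := Datum.mul_mem_localIdeal (y := x / ((d : F) : Fv F v)) (by
    rw [norm_div]; exact div_le_one_of_le₀ hx (norm_nonneg _)) (coe_mem_localIdeal (v := v) hdI)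
  rwa [div_mul_cancel₀ _ hd0] at h

theorem norm_psi (v : FinPlace F) (x : Fv F v) : ‖psi v x‖ = 1 := by
  obtain ⟨a, ha, ha'⟩ := exists_integral_away v x
  rw [psi_eq v x a ha ha', Complex.norm_exp]
  simp

theorem exists_norm_finComp_mul_le_one (a : Adele F) :
    ∃ n : 𝓞 F, n ≠ 0 ∧ ∀ v : FinPlace F, ‖((n : F) : Fv F v) * finComp v a‖ ≤ 1 := by
  classical
  have h1 : ∀ v : FinPlace F, ∃ n : 𝓞 F, n ≠ 0 ∧ ‖((n : F) : Fv F v) * finComp v a‖ ≤ 1 := by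
    intro v
    obtain ⟨x, hx, hx0⟩ := Submodule.exists_mem_ne_zero_of_ne_bot v.ne_bot
    have hlt : ‖((x : F) : Fv F v)‖ < 1 :=
      lt_of_le_of_ne (norm_coe_le_one v x) fun h => (norm_coe_eq_one_iff v x).1 h hx
    obtain ⟨k, hk⟩ := exists_pow_lt_of_lt_one
      (y := ‖((x : F) : Fv F v)‖) (x := (‖finComp v a‖ + 1)⁻¹) (by positivity) hlt
    refine ⟨x ^ k, pow_ne_zero _ hx0, ?_⟩
    rw [coe_integer_pow, norm_mul, norm_pow]
    calc _ ≤ (‖finComp v a‖ + 1)⁻¹ * (‖finComp v a‖ + 1) :=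
          mul_le_mul hk.le (by linarith) (norm_nonneg _) (by positivity)
      _ = 1 := inv_mul_cancel₀ (by positivity)
  choose n hn0 hn using h1
  set S := (finite_one_lt_norm_finComp a).toFinset with hS
  refine ⟨∏ v ∈ S, n v, Finset.prod_ne_zero_iff.2 fun v _ => hn0 v, fun v => ?_⟩
  by_cases hv : v ∈ S
  · have h2 : (((∏ w ∈ S, n w : 𝓞 F) : F) : Fv F v) =
        (((∏ w ∈ S.erase v, n w : 𝓞 F) : F) : Fv F v) * ((n v : F) : Fv F v) := by
      rw [← Finset.prod_erase_mul _ _ hv, coe_integer_mul]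
    rw [h2, mul_assoc, norm_mul]
    exact mul_le_one₀ (norm_coe_le_one v _) (norm_nonneg _) (hn v)
  · have h2 : ‖finComp v a‖ ≤ 1 := by
      by_contra h
      exact hv ((finite_one_lt_norm_finComp a).mem_toFinset.2 h)
    rw [norm_mul]
    exact mul_le_one₀ (norm_coe_le_one v _) (norm_nonneg _) h2

theorem exists_forall_norm_finComp_mul_le_one {ι : Type*} [Fintype ι] (a : ι → Adele F) :
    ∃ n : 𝓞 F, n ≠ 0 ∧ ∀ i (v : FinPlace F), ‖((n : F) : Fv F v) * finComp v (a i)‖ ≤ 1 := by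
  classical
  choose n hn0 hn using fun i => exists_norm_finComp_mul_le_one (a i)
  refine ⟨∏ i, n i, Finset.prod_ne_zero_iff.2 fun i _ => hn0 i, fun i v => ?_⟩
  have h2 : (((∏ j, n j : 𝓞 F) : F) : Fv F v) =
      (((∏ j ∈ Finset.univ.erase i, n j : 𝓞 F) : F) : Fv F v) * ((n i : F) : Fv F v) := by
    rw [← Finset.prod_erase_mul _ _ (Finset.mem_univ i), coe_integer_mul]
  rw [h2, mul_assoc, norm_mul]
  exact mul_le_one₀ (norm_coe_le_one v _) (norm_nonneg _) (hn i v)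

namespace Datum

variable {p : ℕ} [Fact p.Prime] (D : Datum F p)

theorem ωv_eq_of_sub_mem {v : FinPlace F} {y z : Fv F v} (hy : ‖y‖ = 1) (hz : ‖z‖ = 1)
    (h : y - z ∈ localIdeal D.level v) : D.ωv v y = D.ωv v z := by
  have hy0 : y ≠ 0 := norm_ne_zero_iff.1 (by rw [hy]; exact one_ne_zero)
  have hz0 : z ≠ 0 := norm_ne_zero_iff.1 (by rw [hz]; exact one_ne_zero)
  have h1 : D.ωv v (y / z) = 1 := by
    rw [ωv, dif_neg (div_ne_zero hy0 hz0), D.ω_conductor v, Units.val_one]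
    · rw [Units.val_mk0, norm_div, hy, hz, div_one]
    · rw [Units.val_mk0, show y / z - 1 = z⁻¹ * (y - z) by field_simp]
      exact mul_mem_localIdeal (by rw [norm_inv, hz, inv_one]) h
  rw [← div_mul_cancel₀ y hz0, D.ωv_mul v (div_ne_zero hy0 hz0) hz0, h1, one_mul]

/-- Although ω is not assumed unitary, on local units ω_v depends only on a residue modulo a nonzero
ideal, so it takes finitely many values. -/
theorem exists_norm_ωv_inv_le (v : FinPlace F) :
    ∃ B : ℝ, ∀ y : Fv F v, ‖y‖ = 1 → ‖(D.ωv v y)⁻¹‖ ≤ B := by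
  -- Congruence modulo the level fixes ω_v; the extra factor v ensures that the chosen
  -- representative of a unit is again a unit at v, even if v does not divide the level.
  have hJ : D.level * v.asIdeal ≠ ⊥ := mul_ne_zero D.level_ne_bot v.ne_bot
  obtain ⟨d, hdJ, hd0⟩ := Submodule.exists_mem_ne_zero_of_ne_bot hJ
  have : Finite (𝓞 F ⧸ (D.level * v.asIdeal)) := Ideal.finiteQuotientOfFreeOfNeBot _ hJ
  obtain ⟨B, hB⟩ := (Set.finite_range fun q : 𝓞 F ⧸ (D.level * v.asIdeal) =>
    ‖(D.ωv v ((q.out : F) : Fv F v))⁻¹‖).bddAbove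
  refine ⟨B, fun y hy => ?_⟩
  obtain ⟨a, ha⟩ := exists_integer_norm_sub_le v hy.le hd0
  set z : 𝓞 F := Quotient.out (Ideal.Quotient.mk (D.level * v.asIdeal) a) with hz
  have hza : a - z ∈ D.level * v.asIdeal := by
    rw [← Ideal.Quotient.eq]
    exact (Quotient.out_eq _).symm
  have hsub : y - ((z : F) : Fv F v) =
      (y - ((a : F) : Fv F v)) + (((a - z : 𝓞 F) : F) : Fv F v) := by
    rw [coe_integer_sub, sub_add_sub_cancel]
  have hJl : D.level * v.asIdeal ≤ D.level := Ideal.mul_le_left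
  have hJv : D.level * v.asIdeal ≤ v.asIdeal := Ideal.mul_le_right
  have hmem : y - ((z : F) : Fv F v) ∈ localIdeal D.level v := by
    rw [hsub]
    exact add_mem_localIdeal (mem_localIdeal_of_norm_le hd0 (hJl hdJ) ha)
      (coe_mem_localIdeal (hJl hza))
  have hlt : ‖y - ((z : F) : Fv F v)‖ < 1 := by
    have hd1 : ‖((d : F) : Fv F v)‖ < 1 := lt_of_le_of_ne (norm_coe_le_one v d) fun h =>
      (norm_coe_eq_one_iff v d).1 h (hJv hdJ)
    have ha1 : ‖(((a - z : 𝓞 F) : F) : Fv F v)‖ < 1 :=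
      lt_of_le_of_ne (norm_coe_le_one v _) fun h =>
        (norm_coe_eq_one_iff v _).1 h (hJv hza)
    rw [hsub]
    exact (IsUltrametricDist.norm_add_le_max _ _).trans_lt (max_lt (ha.trans_lt hd1) ha1)
  have hz1 : ‖((z : F) : Fv F v)‖ = 1 := by
    have h1 : ‖y‖ ≠ ‖-(y - ((z : F) : Fv F v))‖ := by rw [norm_neg, hy]; exact hlt.ne'
    have h2 := IsUltrametricDist.norm_add_eq_max_of_norm_ne_norm h1
    rwa [norm_neg, hy, max_eq_left hlt.le, ← sub_eq_add_neg, sub_sub_cancel] at h2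
  rw [D.ωv_eq_of_sub_mem hy hz1 hmem]
  exact hB ⟨_, rfl⟩

theorem exists_norm_ΦFin_le (r : ℕ) (v : FinPlace F) :
    ∃ B : ℝ, 1 ≤ B ∧ (v ∉ D.badPlaces → B = 1) ∧ ∀ a b : Fv F v, ‖D.ΦFin r v a b‖ ≤ B := by
  by_cases h1 : v ∈ placesAbove F p
  · refine ⟨1, le_rfl, fun _ => rfl, fun a b => ?_⟩
    rw [ΦFin, if_pos h1]
    split_ifs
    · rw [norm_psi]
    · rw [norm_zero]; exact zero_le_one
  by_cases h2 : v.asIdeal ∣ D.level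
  · obtain ⟨B, hB⟩ := D.exists_norm_ωv_inv_le v
    refine ⟨max 1 B, le_max_left _ _, fun h => absurd ?_ h, fun a b => ?_⟩
    · exact D.levelPlaces_subset_badPlaces (D.mem_levelPlaces.2 ⟨h2, h1⟩)
    · rw [ΦFin, if_neg h1, if_pos h2]
      split_ifs with h
      · exact (hB b h.2).trans (le_max_right _ _)
      · rw [norm_zero]; exact zero_le_one.trans (le_max_left _ _)
  · refine ⟨1, le_rfl, fun _ => rfl, fun a b => ?_⟩
    rw [ΦFin, if_neg h1, if_neg h2]
    split_ifs <;> simp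

theorem exists_norm_ΦFinProd_le (r : ℕ) : ∃ B : ℝ, 0 ≤ B ∧ ∀ a b, ‖D.ΦFinProd r a b‖ ≤ B := by
  choose B hB1 hB2 hB using D.exists_norm_ΦFin_le r
  refine ⟨∏ v ∈ D.badPlaces, B v, Finset.prod_nonneg fun v _ => zero_le_one.trans (hB1 v),
    fun a b => ?_⟩
  obtain ⟨T, hT, ha, hb⟩ := D.exists_finset_norm_le_one a b
  rw [D.ΦFinProd_eq_prod r hT ha hb, norm_prod,
    Finset.prod_subset hT fun v _ hv => hB2 v hv]
  exact Finset.prod_le_prod (fun v _ => norm_nonneg _) fun v _ => hB v _ _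

theorem norm_le_one_of_ΦFinProd_ne_zero {r : ℕ} {a b : Adele F} (h : D.ΦFinProd r a b ≠ 0)
    (v : FinPlace F) : ‖finComp v a‖ ≤ 1 ∧ ‖finComp v b‖ ≤ 1 := by
  obtain ⟨T, hT, ha, hb⟩ := D.exists_finset_norm_le_one a b
  by_cases hv : v ∈ T
  · rw [D.ΦFinProd_eq_prod r hT ha hb, Finset.prod_ne_zero_iff] at h
    exact D.norm_le_one_of_ΦFin_ne_zero (h v hv)
  · exact ⟨ha v hv, hb v hv⟩

end Datum

end Bounds

/-! ### Bounding a term by the rational bottom row. -/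

section Convergence

variable {F : Type*} [Field F] [NumberField F]

/-- The rational row is recovered from the adelic row by multiplying by g⁻¹. Read at finite places
this bounds denominators, and at infinite places it bounds sizes, both uniformly in δ. -/
theorem algebraMap_row_eq (δ : GL (Fin 2) F) (g : GL (Fin 2) (Adele F)) (j : Fin 2) :
    algebraMap F (Adele F) (δ 1 j) =
      (glEmb F δ * g) 1 0 * g⁻¹ 0 j + (glEmb F δ * g) 1 1 * g⁻¹ 1 j := by
  have h : glEmb F δ = (glEmb F δ * g) * g⁻¹ := (mul_inv_cancel_right _ _).symm
  have h1 : algebraMap F (Adele F) (δ 1 j) = glEmb F δ 1 j := rfl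
  rw [h1]
  conv_lhs => rw [h]
  rw [Units.val_mul, Matrix.mul_apply, Fin.sum_univ_two]

theorem row_ne_zero (δ : GL (Fin 2) F) : δ 1 0 ≠ 0 ∨ δ 1 1 ≠ 0 := by
  by_contra! h
  have h2 : IsUnit (δ : Matrix (Fin 2) (Fin 2) F).det :=
    (Matrix.isUnit_iff_isUnit_det _).1 δ.isUnit
  refine h2.ne_zero ?_
  rw [Matrix.det_fin_two, h.1, h.2, mul_zero, mul_zero, sub_zero]

theorem exists_integral_row (g : GL (Fin 2) (Adele F)) : ∃ n : 𝓞 F, n ≠ 0 ∧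
    ∀ δ : GL (Fin 2) F, (∀ v : FinPlace F, ‖finComp v ((glEmb F δ * g) 1 0)‖ ≤ 1 ∧
      ‖finComp v ((glEmb F δ * g) 1 1)‖ ≤ 1) → ∀ j, ∃ a : 𝓞 F, (a : F) = n * δ 1 j := by
  obtain ⟨n, hn0, hn⟩ := exists_forall_norm_finComp_mul_le_one
    fun ij : Fin 2 × Fin 2 => g⁻¹ ij.1 ij.2
  refine ⟨n, hn0, fun δ hδ j => exists_coe_eq_of_norm_le_one fun v => ?_⟩
  have h1 : (((n : F) * δ 1 j : F) : Fv F v) =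
      finComp v ((glEmb F δ * g) 1 0) * (((n : F) : Fv F v) * finComp v (g⁻¹ 0 j)) +
        finComp v ((glEmb F δ * g) 1 1) * (((n : F) : Fv F v) * finComp v (g⁻¹ 1 j)) := by
    have h2 := congrArg (finComp v) (algebraMap_row_eq δ g j)
    rw [map_add, map_mul, map_mul] at h2
    have h3 : finComp v (algebraMap F (Adele F) (δ 1 j)) = algebraMap F (Fv F v) (δ 1 j) := rfl
    rw [coe_eq_algebraMap, coe_eq_algebraMap, map_mul, ← h3, h2]
    ring
  rw [h1]
  refine (IsUltrametricDist.norm_add_le_max _ _).trans (max_le ?_ ?_)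
  · rw [norm_mul]; exact mul_le_one₀ (hδ v).1 (norm_nonneg _) (hn (0, j) v)
  · rw [norm_mul]; exact mul_le_one₀ (hδ v).2 (norm_nonneg _) (hn (1, j) v)

variable [IsTotallyReal F]

theorem exists_row_le (g : GL (Fin 2) (Adele F)) (σ : InfinitePlace F) : ∃ C : ℝ, 0 < C ∧
    ∀ δ : GL (Fin 2) F, max (σ (δ 1 0)) (σ (δ 1 1)) ≤
      C * √(infHom σ ((glEmb F δ * g) 1 0) ^ 2 + infHom σ ((glEmb F δ * g) 1 1) ^ 2) := by
  refine ⟨∑ i, ∑ j, |infHom σ (g⁻¹ i j)| + 1, by positivity, fun δ => ?_⟩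
  set a := infHom σ ((glEmb F δ * g) 1 0) with ha
  set b := infHom σ ((glEmb F δ * g) 1 1) with hb
  have hrow : ∀ j, σ (δ 1 j) = |a * infHom σ (g⁻¹ 0 j) + b * infHom σ (g⁻¹ 1 j)| := fun j => by
    rw [← abs_infHom_algebraMap, algebraMap_row_eq δ g j, map_add, map_mul, map_mul]
  have h1 : |a| ≤ √(a ^ 2 + b ^ 2) := Real.abs_le_sqrt (by nlinarith [sq_nonneg b])
  have h2 : |b| ≤ √(a ^ 2 + b ^ 2) := Real.abs_le_sqrt (by nlinarith [sq_nonneg a])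
  have h3 : ∀ j, σ (δ 1 j) ≤
      (|infHom σ (g⁻¹ 0 j)| + |infHom σ (g⁻¹ 1 j)|) * √(a ^ 2 + b ^ 2) := fun j => by
    rw [hrow]
    refine (abs_add_le _ _).trans ?_
    rw [abs_mul, abs_mul, add_mul, mul_comm, mul_comm |b|]
    gcongr
  simp only [Fin.sum_univ_two]
  refine max_le ((h3 0).trans (mul_le_mul_of_nonneg_right ?_ (Real.sqrt_nonneg _)))
    ((h3 1).trans (mul_le_mul_of_nonneg_right ?_ (Real.sqrt_nonneg _)))
  · linarith [abs_nonneg (infHom σ (g⁻¹ 0 1)), abs_nonneg (infHom σ (g⁻¹ 1 1))]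
  · linarith [abs_nonneg (infHom σ (g⁻¹ 0 0)), abs_nonneg (infHom σ (g⁻¹ 1 0))]

theorem max_place_pos {x y : F} (h : x ≠ 0 ∨ y ≠ 0) (σ : InfinitePlace F) :
    0 < max (σ x) (σ y) := by
  rcases h with h | h
  · exact lt_max_of_lt_left (InfinitePlace.pos_iff.2 h)
  · exact lt_max_of_lt_right (InfinitePlace.pos_iff.2 h)

namespace Datum

variable {p : ℕ} [Fact p.Prime] (D : Datum F p)

theorem exists_norm_archInt_row_le (s : ℂ) (hs : 0 ≤ s.re) (g : GL (Fin 2) (Adele F))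
    (σ : InfinitePlace F) : ∃ K : ℝ, 0 ≤ K ∧ ∀ δ : GL (Fin 2) F,
      ‖D.archInt σ s (infHom σ ((glEmb F δ * g) 1 0)) (infHom σ ((glEmb F δ * g) 1 1))‖ ≤
        K * max (σ (δ 1 0)) (σ (δ 1 1)) ^ (-(2 * (D.h : ℝ) + 2 + 2 * s.re)) := by
  obtain ⟨K, hK0, hK⟩ := D.exists_norm_archInt_le σ s
  obtain ⟨C, hC0, hC⟩ := exists_row_le g σ
  refine ⟨K * C ^ (2 * (D.h : ℝ) + 2 + 2 * s.re), by positivity, fun δ => ?_⟩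
  have hm := max_place_pos (row_ne_zero δ) σ
  have h1 := hC δ
  have hpos : 0 < √(infHom σ ((glEmb F δ * g) 1 0) ^ 2 + infHom σ ((glEmb F δ * g) 1 1) ^ 2) :=
    pos_of_mul_pos_right (hm.trans_le h1) hC0.le
  refine (hK _ _ (Real.sqrt_pos.1 hpos)).trans ?_
  rw [mul_assoc]
  refine mul_le_mul_of_nonneg_left ?_ hK0
  have h2 := Real.rpow_le_rpow_of_nonpos hm h1
    (show -(2 * (D.h : ℝ) + 2 + 2 * s.re) ≤ 0 by
      have : (0 : ℝ) ≤ D.h := Nat.cast_nonneg _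
      linarith)
  rw [Real.mul_rpow hC0.le hpos.le, Real.rpow_neg hC0.le, inv_mul_le_iff₀ (by positivity)] at h2
  exact h2

/-- The determinant factor does not depend on δ, the finite part is bounded, and each archimedean
integral decays with the size of the row at its place. -/
theorem exists_norm_term_le (r : ℕ) (s : ℂ) (hs : 0 ≤ s.re) (g : GL (Fin 2) (Adele F)) :
    ∃ K : ℝ, 0 ≤ K ∧ ∀ δ : GL (Fin 2) F, ‖D.term r s (glEmb F δ * g)‖ ≤
      K * (∏ σ : InfinitePlace F, max (σ (δ 1 0)) (σ (δ 1 1))) ^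
        (-(2 * (D.h : ℝ) + 2 + 2 * s.re)) := by
  choose K hK0 hK using D.exists_norm_archInt_row_le s hs g
  obtain ⟨B, hB0, hB⟩ := D.exists_norm_ΦFinProd_le r
  refine ⟨‖D.detFactor s (g : Matrix (Fin 2) (Fin 2) (Adele F)).det‖ * (∏ σ, K σ) * B,
    mul_nonneg (mul_nonneg (norm_nonneg _) (Finset.prod_nonneg fun σ _ => hK0 σ)) hB0,
    fun δ => ?_⟩
  rw [term_eq, detFactor_glEmb_mul, norm_mul, norm_mul, norm_prod,
    ← Real.finsetProd_rpow _ _ fun σ _ => (max_place_pos (row_ne_zero δ) σ).le]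
  have h1 : ∏ σ, ‖D.archInt σ s (infHom σ ((glEmb F δ * g) 1 0))
      (infHom σ ((glEmb F δ * g) 1 1))‖ ≤ (∏ σ, K σ) * ∏ σ : InfinitePlace F,
        max (σ (δ 1 0)) (σ (δ 1 1)) ^ (-(2 * (D.h : ℝ) + 2 + 2 * s.re)) := by
    rw [← Finset.prod_mul_distrib]
    exact Finset.prod_le_prod (fun σ _ => norm_nonneg _) fun σ _ => hK σ δ
  have h2 := hB ((glEmb F δ * g) 1 0) ((glEmb F δ * g) 1 1)
  calc _ ≤ ‖D.detFactor s (g : Matrix (Fin 2) (Fin 2) (Adele F)).det‖ * ((∏ σ, K σ) *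
        ∏ σ : InfinitePlace F,
          max (σ (δ 1 0)) (σ (δ 1 1)) ^ (-(2 * (D.h : ℝ) + 2 + 2 * s.re))) * B :=
        mul_le_mul (mul_le_mul_of_nonneg_left h1 (norm_nonneg _)) h2 (norm_nonneg _)
          (mul_nonneg (norm_nonneg _) ((Finset.prod_nonneg fun _ _ => norm_nonneg _).trans h1))
    _ = _ := by ring

end Datum

end Convergence

/-! ### Absolute convergence of the double series. -/

section AbsoluteConvergence

variable {F : Type*} [Field F] [NumberField F]

/-- The cosets of the Borel subgroup are the points of the projective line, through the bottom row.
-/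
theorem rightRel_of_row_eq {γ γ' : GL (Fin 2) F} {c : F} (hc : c ≠ 0)
    (h : ∀ j, γ 1 j = c * γ' 1 j) :
    (QuotientGroup.rightRel (borel F)).r γ γ' := by
  rw [QuotientGroup.rightRel_apply]
  have h1 : (γ' * γ⁻¹) 1 0 = 0 := by
    have h2 : ∀ j, γ' 1 j = c⁻¹ * γ 1 j := fun j => by rw [h, inv_mul_cancel_left₀ hc]
    have h3 : (γ' * γ⁻¹) 1 0 = c⁻¹ * (γ * γ⁻¹) 1 0 := by
      simp only [Units.val_mul, Matrix.mul_apply, Fin.sum_univ_two, h2]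
      ring
    rw [h3, mul_inv_cancel, Units.val_one, Matrix.one_apply_ne (by decide), mul_zero]
  exact h1

variable [IsTotallyReal F]

/-- A unit brings all archimedean sizes of the integral row nx below a common M with M^d a constant
times the product of maxima. Thus M^{-dκ} can be shared equally between the heights of the two
entries, which decouples the double sum. -/
theorem exists_unit_mul_height_le (U : Subgroup (𝓞 F)ˣ) [U.FiniteIndex] {n : 𝓞 F} (hn : n ≠ 0) :
    ∃ B : ℝ, 0 < B ∧ ∀ (x : Fin 2 → F), (x 0 ≠ 0 ∨ x 1 ≠ 0) →
      (∀ j, ∃ a : 𝓞 F, (a : F) = n * x j) → ∃ ε ∈ U, ∃ a : Fin 2 → 𝓞 F,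
        (∀ j, (a j : F) = algebraMap (𝓞 F) F ε * (n * x j)) ∧ ∀ κ : ℝ, 0 ≤ κ →
        (∏ σ : InfinitePlace F, max (σ (x 0)) (σ (x 1))) ^ (-κ) ≤ B ^ κ *
          (height (a 0) ^ (-(Module.finrank ℚ F * κ / 2)) *
            height (a 1) ^ (-(Module.finrank ℚ F * κ / 2))) := by
  obtain ⟨B, hB0, hB⟩ := exists_mem_mul_pow_le U
  set d := Module.finrank ℚ F with hd
  have hd0 : d ≠ 0 := Module.finrank_pos.ne'
  have hnF : (n : F) ≠ 0 := by simpa using hn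
  have hN : 0 < ∏ σ : InfinitePlace F, σ (n : F) :=
    Finset.prod_pos fun σ _ => InfinitePlace.pos_iff.2 hnF
  refine ⟨B * ∏ σ : InfinitePlace F, σ (n : F), by positivity, fun x hx hint => ?_⟩
  have hm : ∀ σ : InfinitePlace F, 0 < max (σ (x 0)) (σ (x 1)) := max_place_pos hx
  obtain ⟨ε, hεU, hε⟩ := hB (fun σ => σ (n : F) * max (σ (x 0)) (σ (x 1)))
    fun σ => mul_pos (InfinitePlace.pos_iff.2 hnF) (hm σ)
  rw [Finset.prod_mul_distrib, ← mul_assoc] at hε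
  choose b hb using hint
  have ha : ∀ j, ((ε * b j : 𝓞 F) : F) = algebraMap (𝓞 F) F ε * (n * x j) := fun j => by
    rw [← hb]; exact map_mul (algebraMap (𝓞 F) F) _ _
  refine ⟨ε, hεU, fun j => ε * b j, ha, fun κ hκ => ?_⟩
  set C := B * ∏ σ : InfinitePlace F, σ (n : F) with hC
  set P := ∏ σ : InfinitePlace F, max (σ (x 0)) (σ (x 1)) with hP
  have hC0 : 0 < C := by positivity
  have hP0 : 0 < P := Finset.prod_pos fun σ _ => hm σ
  set M : ℝ := (C * P) ^ ((d : ℝ)⁻¹) with hM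
  have hM0 : 0 < M := by positivity
  have hMd : M ^ d = C * P := Real.rpow_inv_natCast_pow (by positivity) hd0
  have hle : ∀ j (σ : InfinitePlace F), σ ((ε * b j : 𝓞 F) : F) ≤ M := fun j σ => by
    refine le_of_pow_le_pow_left₀ hd0 hM0.le (le_trans ?_ ((hε σ).trans_eq hMd.symm))
    rw [ha, map_mul, map_mul]
    refine pow_le_pow_left₀ (by positivity) ?_ _
    gcongr
    fin_cases j
    · exact le_max_left _ _
    · exact le_max_right _ _
  -- A nonzero integral entry is at least 1 at some place; this is needed since heights are at least
  -- 1 by definition.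
  have hM1 : 1 ≤ M := by
    obtain ⟨j, hj⟩ : ∃ j, x j ≠ 0 := hx.elim (fun h => ⟨0, h⟩) fun h => ⟨1, h⟩
    have h0 : (ε * b j : 𝓞 F) ≠ 0 := by
      intro h
      have h1 := ha j
      rw [h] at h1
      have h2 : algebraMap (𝓞 F) F ε ≠ 0 := by simp
      exact mul_ne_zero h2 (mul_ne_zero hnF hj) (h1.symm.trans (map_zero _))
    obtain ⟨σ, hσ⟩ := exists_one_le_apply h0
    exact hσ.trans (hle j σ)
  have hheight : ∀ j, M ^ (-(d * κ / 2)) ≤ height (ε * b j : 𝓞 F) ^ (-(d * κ / 2)) := fun j =>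
    Real.rpow_le_rpow_of_nonpos (one_pos.trans_le (one_le_height _)) (height_le hM1 (hle j))
      (neg_nonpos.2 (by positivity))
  have h1 : P ^ (-κ) = C ^ κ * (M ^ (-(d * κ / 2)) * M ^ (-(d * κ / 2))) := by
    rw [← Real.rpow_add hM0, show -(d * κ / 2) + -(d * κ / 2) = (d : ℝ) * -κ by ring,
      Real.rpow_mul hM0.le, Real.rpow_natCast, hMd, Real.mul_rpow hC0.le hP0.le, ← mul_assoc,
      ← Real.rpow_add hC0, add_neg_cancel, Real.rpow_zero, one_mul]
  rw [h1]
  exact mul_le_mul_of_nonneg_left (mul_le_mul (hheight 0) (hheight 1) (by positivity)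
    ((by positivity : (0 : ℝ) ≤ M ^ (-(d * κ / 2))).trans (hheight 0))) (by positivity)

namespace Datum

variable {p : ℕ} [Fact p.Prime] (D : Datum F p)

/-- After balancing by a unit of U_r, distinct nonzero terms give distinct pairs of integers, and
the terms are dominated by a product of two convergent lattice sums. -/
theorem absConverges (r : ℕ) {s : ℂ}
    (hs : (Module.finrank ℤ (mixedEmbedding.integerLattice F) : ℝ) ≤ s.re)
    (g : GL (Fin 2) (Adele F)) : D.AbsConverges r s g := by
  have hs0 : 0 ≤ s.re := (Nat.cast_nonneg _).trans hs
  set κ : ℝ := 2 * (D.h : ℝ) + 2 + 2 * s.re with hκ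
  have hh : (0 : ℝ) ≤ D.h := Nat.cast_nonneg _
  have hκ0 : 0 ≤ κ := by positivity
  obtain ⟨K, hK0, hK⟩ := D.exists_norm_term_le r s hs0 g
  obtain ⟨n, hn0, hn⟩ := exists_integral_row g
  have := D.finiteIndex_units r
  obtain ⟨B, hB0, hB⟩ := exists_unit_mul_height_le (D.units r) hn0
  set e : ℝ := Module.finrank ℚ F * κ / 2 with he
  -- Here e = d(h + 1 + Re s) ≥ 1 + Re s, which exceeds the lattice rank.
  have hsum : Summable fun x : 𝓞 F => height x ^ (-e) := by
    refine summable_height_rpow ?_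
    have h1 : (1 : ℝ) ≤ Module.finrank ℚ F := by exact_mod_cast Module.finrank_pos
    nlinarith
  have hsum2 : Summable fun x : 𝓞 F × 𝓞 F =>
      K * (B ^ κ * (height x.1 ^ (-e) * height x.2 ^ (-e))) := by
    refine Summable.mul_left _ (Summable.mul_left _ (hsum.mul_of_nonneg hsum ?_ ?_)) <;>
    exact fun x => Real.rpow_nonneg (zero_le_one.trans (one_le_height x)) _
  let δ : Quotient (QuotientGroup.rightRel (borel F)) × (Fˣ ⧸ D.unitsF r) → GL (Fin 2) F :=
    fun q => Matrix.GeneralLinearGroup.scalar (Fin 2) q.2.out * q.1.out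
  have hδ : ∀ q j, δ q 1 j = (q.2.out : F) * q.1.out 1 j := by
    intro q j
    simp [δ, Units.val_mul, Matrix.mul_apply, Fin.sum_univ_two]
  have hterm : ∀ q : Quotient (QuotientGroup.rightRel (borel F)) × (Fˣ ⧸ D.unitsF r),
      scalarEmb F q.2.out * (glEmb F q.1.out * g) = glEmb F (δ q) * g := fun q => by
    rw [← mul_assoc]
    congr 1
    exact (map_mul (glEmb F) _ _).symm
  rw [AbsConverges]
  simp only [hterm]
  -- Only where the term is nonzero does the finite part force the row to be integral up to the
  -- denominator n.
  let S := {q : Quotient (QuotientGroup.rightRel (borel F)) × (Fˣ ⧸ D.unitsF r) //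
    D.term r s (glEmb F (δ q) * g) ≠ 0}
  have key : ∀ q : S, ∃ ε ∈ D.units r, ∃ a : 𝓞 F × 𝓞 F,
      (a.1 : F) = algebraMap (𝓞 F) F ε * (n * δ q.1 1 0) ∧
      (a.2 : F) = algebraMap (𝓞 F) F ε * (n * δ q.1 1 1) ∧
      ‖D.term r s (glEmb F (δ q.1) * g)‖ ≤
        K * (B ^ κ * (height a.1 ^ (-e) * height a.2 ^ (-e))) := by
    intro q
    have h1 := q.2
    rw [term_eq] at h1
    have h2 := D.norm_le_one_of_ΦFinProd_ne_zero (right_ne_zero_of_mul h1)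
    obtain ⟨ε, hε, a, ha, hle⟩ := hB (fun j => δ q.1 1 j) (row_ne_zero _) (hn _ h2)
    exact ⟨ε, hε, (a 0, a 1), ha 0, ha 1,
      (hK _).trans (mul_le_mul_of_nonneg_left (hle κ hκ0) hK0)⟩
  choose ε hε a ha0 ha1 hle using key
  have hnF : (n : F) ≠ 0 := by simpa using hn0
  -- Equal pairs have proportional rows, so the cosets γ agree. Cancelling a nonzero entry of the
  -- common representative then shows that the scalars agree up to the units ε, which lie in U_r.
  have hinj : Function.Injective a := by
    intro q q' hqq
    set u : Fˣ := Units.map (algebraMap (𝓞 F) F).toMonoidHom (ε q) with hu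
    set u' : Fˣ := Units.map (algebraMap (𝓞 F) F).toMonoidHom (ε q') with hu'
    have hrow : ∀ j, ((u * q.1.2.out : Fˣ) : F) * q.1.1.out 1 j =
        ((u' * q'.1.2.out : Fˣ) : F) * q'.1.1.out 1 j := by
      have h0 : (u : F) * (n * δ q.1 1 0) = (u' : F) * (n * δ q'.1 1 0) :=
        (ha0 q).symm.trans ((congrArg (fun z : 𝓞 F × 𝓞 F => (z.1 : F)) hqq).trans (ha0 q'))
      have h1 : (u : F) * (n * δ q.1 1 1) = (u' : F) * (n * δ q'.1 1 1) :=
        (ha1 q).symm.trans ((congrArg (fun z : 𝓞 F × 𝓞 F => (z.2 : F)) hqq).trans (ha1 q'))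
      rw [hδ, hδ] at h0 h1
      rw [Units.val_mul, Units.val_mul, Fin.forall_fin_two]
      exact ⟨mul_left_cancel₀ hnF (by linear_combination h0),
        mul_left_cancel₀ hnF (by linear_combination h1)⟩
    have hγ : q.1.1 = q'.1.1 := by
      rw [← Quotient.out_eq q.1.1, ← Quotient.out_eq q'.1.1]
      refine Quotient.sound (rightRel_of_row_eq
        (c := (((u * q.1.2.out)⁻¹ * (u' * q'.1.2.out) : Fˣ) : F)) (Units.ne_zero _) fun j => ?_)
      rw [Units.val_mul, mul_assoc, ← hrow, Units.inv_mul_cancel_left]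
    have hx : u * q.1.2.out = u' * q'.1.2.out := by
      rw [hγ] at hrow
      refine Units.ext ?_
      rcases row_ne_zero (q'.1.1.out) with h | h
      · exact mul_right_cancel₀ h (hrow 0)
      · exact mul_right_cancel₀ h (hrow 1)
    have hx2 : q.1.2 = q'.1.2 := by
      have h1 : ∀ (w : Fˣ) (_ : w ∈ D.unitsF r) (z : Fˣ ⧸ D.unitsF r),
          ((w * z.out : Fˣ) : Fˣ ⧸ D.unitsF r) = z := fun w hw z => by
        rw [mul_comm, QuotientGroup.mk_mul_of_mem _ hw, QuotientGroup.out_eq']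
      rw [← h1 u ⟨_, hε q, rfl⟩ q.1.2, hx, h1 u' ⟨_, hε q', rfl⟩]
    exact Subtype.ext (Prod.ext hγ hx2)
  have hS : Summable fun q : S => ‖D.term r s (glEmb F (δ q.1) * g)‖ :=
    Summable.of_nonneg_of_le (fun _ => norm_nonneg _) hle (hsum2.comp_injective hinj)
  refine (Function.Injective.summable_iff (g := (Subtype.val : S → _)) Subtype.val_injective
    fun q hq => ?_).1 hS
  by_contra h
  exact hq ⟨⟨q, fun h' => h (by rw [h', norm_zero])⟩, rfl⟩

end Datum

end AbsoluteConvergence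

/-! ### Summation of the relation and analytic continuation. -/

section Distribution

variable {F : Type*} [Field F] [NumberField F] [IsTotallyReal F] {p : ℕ} [Fact p.Prime]

namespace Datum

variable (D : Datum F p)

theorem card_eq_of_bijective_mk {R : Finset (Op F p)}
    (hR : Function.Bijective fun x : R => Ideal.Quotient.mk (Ideal.span {(p : Op F p)}) x.1)
    (hunram : ∀ v ∈ placesAbove F p, ¬ v.asIdeal ^ 2 ∣ Ideal.span {(p : 𝓞 F)}) :
    R.card = p ^ Module.finrank ℚ F := by
  rw [← card_quotient_p hunram, ← Nat.card_eq_of_bijective _ hR, Nat.card_eq_fintype_card,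
    Fintype.card_coe]

theorem sum_sect_translation (hp : p ≠ 2)
    (hunram : ∀ v ∈ placesAbove F p, ¬ v.asIdeal ^ 2 ∣ Ideal.span {(p : 𝓞 F)})
    {r : ℕ} (hr : 1 ≤ r) (R : Finset (Op F p))
    (hR : Function.Bijective fun x : R => Ideal.Quotient.mk (Ideal.span {(p : Op F p)}) x.1)
    (s : ℂ) (g : GL (Fin 2) (Adele F))
    (h1 : Summable fun q : Fˣ ⧸ D.unitsF r => ‖D.term r s (scalarEmb F q.out * g)‖)
    (h2 : ∀ x y : Op F p, Summable fun q : Fˣ ⧸ D.unitsF (r + 1) =>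
      ‖D.term (r + 1) s (scalarEmb F q.out * (g * translation r hr x y))‖) :
    D.c (r + 1) s * ∑ x ∈ R, ∑ y ∈ R, D.sect (r + 1) s (g * translation r hr x y) =
      D.c r s * D.sect r s g := by
  set b : Fˣ := (pUnit p F)⁻¹ with hb
  set κ : ℂ := (R.card : ℂ) ^ 2 * (∏ v ∈ D.levelPlaces, (D.ωv v (p : Fv F v))⁻¹) *
    ((p ^ Module.finrank ℚ F : ℕ) : ℂ) ^ (-(2 * (D.h : ℂ) + 2 + 2 * s)) with hκ
  have hc : D.c (r + 1) s * κ = D.c r s := by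
    rw [hκ, card_eq_of_bijective_mk hR hunram]
    exact D.c_succ_mul hunram r s
  let f : Fˣ → ℂ := fun x => D.term r s (scalarEmb F x * g)
  have hf : ∀ u ∈ D.unitsF r, ∀ a, f (u * a) = f a := fun u hu a => by
    change D.term r s (scalarEmb F (u * a) * g) = _
    rw [map_mul, mul_assoc, D.term_unit_mul r s hu]
  have hf' : ∀ u ∈ D.unitsF r, ∀ a, f (b * (u * a)) = f (b * a) := fun u hu a => by
    rw [mul_left_comm, hf u hu]
  have hfs : Summable fun q : Fˣ ⧸ D.unitsF r => ‖f (b * q.out)‖ := by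
    have h3 := (Equiv.mulLeft (b : Fˣ ⧸ D.unitsF r)).summable_iff.2 h1
    refine h3.congr fun q => ?_
    have h4 : Equiv.mulLeft (b : Fˣ ⧸ D.unitsF r) q = ((b * q.out : Fˣ) : Fˣ ⧸ D.unitsF r) := by
      rw [Equiv.coe_mulLeft, QuotientGroup.mk_mul, QuotientGroup.out_eq']
    rw [Function.comp_apply, h4]
    exact congrArg norm (apply_out_mk hf _)
  have hsum : ∑ x ∈ R, ∑ y ∈ R, ∑' q : Fˣ ⧸ D.unitsF (r + 1),
      D.term (r + 1) s (scalarEmb F q.out * (g * translation r hr x y)) =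
      κ * ∑' q : Fˣ ⧸ D.unitsF (r + 1), f (b * q.out) := by
    rw [← tsum_mul_left]
    have h3 : ∀ x ∈ R, ∑ y ∈ R, ∑' q : Fˣ ⧸ D.unitsF (r + 1),
        D.term (r + 1) s (scalarEmb F q.out * (g * translation r hr x y)) =
        ∑' q : Fˣ ⧸ D.unitsF (r + 1), ∑ y ∈ R,
        D.term (r + 1) s (scalarEmb F q.out * (g * translation r hr x y)) := fun x _ =>
      (Summable.tsum_finsetSum fun y _ => (h2 x y).of_norm).symm
    rw [Finset.sum_congr rfl h3, ← Summable.tsum_finsetSum fun x _ =>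
      summable_sum fun y _ => (h2 x y).of_norm]
    refine tsum_congr fun q => ?_
    simp only [← mul_assoc]
    rw [D.sum_term_translation hunram hr R hR s]
    change _ = κ * D.term r s (scalarEmb F (b * q.out) * g)
    rw [map_mul, mul_assoc (scalarEmb F b)]
  have hi := D.unitIndex_succ hp hr
  have hrel := D.relIndex_unitsF_ne_zero r
  simp only [sect, ← Finset.mul_sum]
  -- The shift by p⁻¹ is a permutation of the quotient, and the index [U_r : U_{r+1}] from the finer
  -- quotient cancels against the growth of the normalisation.
  rw [hsum, tsum_quotient_of_le (f := fun a => f (b * a)) (D.unitsF_succ_le r) hrel hf' hfs,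
    tsum_quotient_mul_left hf, hi, ← hc]
  have hrel' : (((D.unitsF (r + 1)).relIndex (D.unitsF r) : ℕ) : ℂ) ≠ 0 := by exact_mod_cast hrel
  push_cast
  rw [mul_inv]
  field_simp
  rfl

/-- Absolute convergence allows the finite sums to pass inside, after which the relation holds for
each coset γ with γg in place of g. -/
theorem sum_series_translation (hp : p ≠ 2)
    (hunram : ∀ v ∈ placesAbove F p, ¬ v.asIdeal ^ 2 ∣ Ideal.span {(p : 𝓞 F)})
    {r : ℕ} (hr : 1 ≤ r) (R : Finset (Op F p))
    (hR : Function.Bijective fun x : R => Ideal.Quotient.mk (Ideal.span {(p : Op F p)}) x.1)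
    (s : ℂ) (g : GL (Fin 2) (Adele F)) (h1 : D.AbsConverges r s g)
    (h2 : ∀ x y : Op F p, D.AbsConverges (r + 1) s (g * translation r hr x y)) :
    D.c (r + 1) s * ∑ x ∈ R, ∑ y ∈ R, D.series (r + 1) s (g * translation r hr x y) =
      D.c r s * D.series r s g := by
  have hsect : ∀ x y : Op F p, Summable fun γ : Quotient (QuotientGroup.rightRel (borel F)) =>
      D.sect (r + 1) s (glEmb F γ.out * (g * translation r hr x y)) := fun x y =>
    Summable.mul_left _ (h2 x y).of_norm.prod
  simp only [series]
  have h3 : ∀ x ∈ R, ∑ y ∈ R, ∑' γ : Quotient (QuotientGroup.rightRel (borel F)),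
      D.sect (r + 1) s (glEmb F γ.out * (g * translation r hr x y)) =
      ∑' γ : Quotient (QuotientGroup.rightRel (borel F)), ∑ y ∈ R,
      D.sect (r + 1) s (glEmb F γ.out * (g * translation r hr x y)) := fun x _ =>
    (Summable.tsum_finsetSum fun y _ => hsect x y).symm
  rw [Finset.sum_congr rfl h3, ← Summable.tsum_finsetSum fun x _ =>
    summable_sum fun y _ => hsect x y, ← tsum_mul_left, ← tsum_mul_left]
  refine tsum_congr fun γ => ?_
  simp only [← mul_assoc (glEmb F γ.out)]
  refine D.sum_sect_translation hp hunram hr R hR s _ (h1.prod_factor γ) fun x y => ?_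
  simpa only [mul_assoc] using (h2 x y).prod_factor γ

theorem differentiable_c (r : ℕ) : Differentiable ℂ fun s => D.c r s := by
  unfold c
  refine (Differentiable.fun_finsetProd fun v _ => ?_).const_mul _
  have hq : (qv v : ℂ) ≠ 0 := by
    have := HeightOneSpectrum.absNorm_ne_zero v
    exact_mod_cast this
  exact Differentiable.const_cpow (by fun_prop) (Or.inl hq)

end Datum

theorem eq_of_eqOn_re_gt {f g : ℂ → ℂ} (hf : Differentiable ℂ f) (hg : Differentiable ℂ g) {C : ℝ}
    (h : ∀ s : ℂ, C < s.re → f s = g s) : f = g := by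
  refine AnalyticOnNhd.eq_of_eventuallyEq (z₀ := ((C + 1 : ℝ) : ℂ))
    (fun z _ => hf.analyticAt z) (fun z _ => hg.analyticAt z) ?_
  have hopen : IsOpen {s : ℂ | C < s.re} := isOpen_lt continuous_const Complex.continuous_re
  filter_upwards [hopen.mem_nhds (show ((C + 1 : ℝ) : ℂ) ∈ {s : ℂ | C < s.re} by
    change C < ((C + 1 : ℝ) : ℂ).re
    rw [Complex.ofReal_re]; linarith)] with s hs using h s hs

end Distribution

end DistEis

end

theorem proposition5 {F : Type*} [Field F] [NumberField F] [IsTotallyReal F]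
    {p : ℕ} [Fact p.Prime] (hp : p ≠ 2)
    (hunram : ∀ v ∈ DistEis.placesAbove F p,
      ¬ v.asIdeal ^ 2 ∣ Ideal.span {(p : 𝓞 F)})
    (D : DistEis.Datum F p) (r : ℕ) (hr : 1 ≤ r)
    (R : Finset (DistEis.Op F p))
    (hR : Function.Bijective fun x : R =>
      Ideal.Quotient.mk (Ideal.span {(p : DistEis.Op F p)}) x.1) :
    (∃ C : ℝ, ∀ s : ℂ, C < s.re → ∀ g : GL (Fin 2) (DistEis.Adele F),
      D.AbsConverges r s g ∧ D.AbsConverges (r + 1) s g ∧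
      D.c (r + 1) s * ∑ x ∈ R, ∑ y ∈ R,
          D.series (r + 1) s (g * DistEis.translation r hr x y) =
        D.c r s * D.series r s g) ∧
    (∀ E E' : ℂ → GL (Fin 2) (DistEis.Adele F) → ℂ,
      D.IsContinuation r E → D.IsContinuation (r + 1) E' →
      ∀ (s : ℂ) (g : GL (Fin 2) (DistEis.Adele F)),
        D.c (r + 1) s * ∑ x ∈ R, ∑ y ∈ R, E' s (g * DistEis.translation r hr x y) =
          D.c r s * E s g) := by
  have hseries : ∀ s : ℂ, (Module.finrank ℤ (mixedEmbedding.integerLattice F) : ℝ) < s.re →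
      ∀ g : GL (Fin 2) (DistEis.Adele F), D.c (r + 1) s * ∑ x ∈ R, ∑ y ∈ R,
        D.series (r + 1) s (g * DistEis.translation r hr x y) = D.c r s * D.series r s g :=
    fun s hs g => D.sum_series_translation hp hunram hr R hR s g (D.absConverges r hs.le g)
      fun x y => D.absConverges (r + 1) hs.le _
  refine ⟨⟨_, fun s hs g => ⟨D.absConverges r hs.le g, D.absConverges (r + 1) hs.le g,
    hseries s hs g⟩⟩, fun E E' hE hE' s g => ?_⟩
  obtain ⟨C, hC⟩ := hE.2 g
  choose C' hC' using hE'.2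
  -- The half-plane on which a continuation agrees with the series may depend on g. Only finitely
  -- many translates of g occur, so one bound M serves them all.
  obtain ⟨M, hM⟩ := ((R ×ˢ R).finite_toSet.image
    fun z : DistEis.Op F p × DistEis.Op F p =>
      C' (g * DistEis.translation r hr z.1 z.2)).bddAbove
  refine congrFun (DistEis.eq_of_eqOn_re_gt
    (C := max (max C M) (Module.finrank ℤ (mixedEmbedding.integerLattice F)))
    ((D.differentiable_c (r + 1)).mul (Differentiable.fun_sum fun x _ =>
      Differentiable.fun_sum fun y _ => hE'.1 (g * DistEis.translation r hr x y)))
    ((D.differentiable_c r).mul (hE.1 g)) fun z hz => ?_) s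
  obtain ⟨hz1, hz2⟩ := max_lt_iff.1 hz
  obtain ⟨hz3, hz4⟩ := max_lt_iff.1 hz1
  have h := hseries z hz2 g
  change D.c (r + 1) z * ∑ x ∈ R, ∑ y ∈ R, E' z (g * DistEis.translation r hr x y) =
    D.c r z * E z g
  rw [(hC z hz3).2, ← h]
  congr 1
  refine Finset.sum_congr rfl fun x hx => Finset.sum_congr rfl fun y hy => ?_
  exact (hC' _ z ((hM ⟨(x, y), Finset.mk_mem_product hx hy, rfl⟩).trans_lt hz4)).2
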